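/- **Setting.** Alice is connected to Bob-1 and Bob-2 by a broadcast channel made of two independent binary erasure channels: every input bit is received by Bob-$i$ through a memoryless erasure channel with erasure probability $p_i\in[0,1]$, independently for $i=1,2$. There is also a noiseless public channel. For $i\in\{1,2\}$ write $\bar i=3-i$. Alice holds independent uniform strings $M_{i0},M_{i1}\in\{0,1\}^{k_i}$, Bob-$i$ holds an independent uniform choice bit $Z_i$ and wants $M_{iZ_i}$; $\bar Z_i$ is the complement of $Z_i$. For all lengths $s,k$ fix any family of two-universal hash functions $\{0,1\}^s\to\{0,1\}^k$ (that is, distinct inputs collide with probability at most $2^{-k}$ under a uniformly chosen member). **The sequential protocol (Protocol 2), with Bob-$i$ served first, $n$ channel uses.** Parameters: $0<\lambda<1$, rational $\lambda'>0$, and for each $j\in\{1,2\}$ either $\lambda'<r_j<p_{\bar j}\min\{p_j,1-p_j\}-\lambda$, or $r_j=0$ (then Bob-$j$ is idle: his strings are empty). 1. Alice sends $n$ independent uniform bits $X^n$; Bob-$j$ receives $Y_j^n$. 2. Bob-$i$ draws a uniform set $S_{Z_i}$ of $s=\lfloor r_i n/(p_{\bar i}-\lambda')\rfloor$ received positions,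 a uniform set $S_{\bar Z_i}$ of $s$ erased positions and, if $p_i>\frac12$, a uniform set $S'$ of $\lfloor (p_i-\lambda-r_i/(p_{\bar i}-\lambda'))n\rfloor$ (zero if negative) further erased positions; if $p_i\le\frac12$, $S'=\emptyset$. He announces $S_0,S_1,S'$, or aborts if such sets do not exist. 3. Alice draws $\kappa_{i0},\kappa_{i1}$ uniformly and independently from the hash family from $s$ bits to $k_i=n(r_i-\lambda')\in\mathbb N$ bits ($k_i=0$ if $r_i=0$), and announces them and $M_{ib}\oplus\kappa_{ib}(X|_{S_b})$, $b=0,1$. Bob-$i$ unmasks $M_{iZ_i}$. 4. If $p_i>\frac12$, Bob-$\bar i$ is served in the same way inside $S'$: he draws uniform sets $S'_{Z_{\bar i}}$ of $\lfloor r_{\bar i}n\rfloor$ positions of $S'$ that he received and $S'_{\bar Z_{\bar i}}$ of as many positions of $S'$ that were erased for him, announces $S'_0,S'_1$ (or aborts if this is impossible), and Alice masks strings of length $k_{\bar i}=n(r_{\bar i}-\lambda')\in\mathbb N$ ($0$ if $r_{\bar i}=0$). If $p_i\le\frac12$, then $k_{\bar i}=0$. The protocol may be time-shared between the two orders: a run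 on $n_a$ channel uses with Bob-1 first is followed by an independent run on $n_b$ uses with Bob-2 first, $n_a+n_b=n$, each with its own parameters and with the same choice bits; strings, transcripts and views are concatenated, and $k_i$ is the total length. **Rate region.** Let $\mathbf C$ be the public transcript, $U$ Alice's final view (strings, hash functions, $X^n$, $\mathbf C$) and $V_i$ Bob-$i$'s final view ($Z_i$, his random draws, $Y_i^n$, $\mathbf C$). Let $\mathcal R$ be the set of all $(R_1,R_2)\in\mathbb R_{\ge0}^2$ for which there are instances of this protocol, one for each number $n$ of channel uses (the parameters may depend on $n$), with $k_i/n\to R_i$ and, as $n\to\infty$, for $i=1,2$, $$\Pr[\hat M_{iZ_i}\ne M_{iZ_i}]\to0,\qquad I(M_{1\bar Z_1},M_{2\bar Z_2};V_1,V_2)\to0,\qquad I(Z_i;U,V_{\bar i})\to0,$$ $$I(Z_1,Z_2;U)\to0,\qquad I(M_{i0},M_{i1},M_{\bar i\bar Z_{\bar i}},Z_i;V_{\bar i})\to0,$$ an abort before Bob-$i$ is served counting as an error of Bob-$i$. **Proposition.** $\mathcal R_{\rm inner}\subseteq\mathcal R\subseteq\mathcal R_{\rm outer}$, where $\mathcal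 R_{\rm inner}$ is the set of $(R_1,R_2)\in\mathbb R_{\ge0}^2$ with $$R_1\le p_2\min\{p_1,1-p_1\},\qquad R_2\le p_1\min\{p_2,1-p_2\},$$ $$R_1+R_2\le p_2\min\{p_1,1-p_1\}+p_1\min\{p_2,1-p_2\}-\min\{p_1,1-p_1\}\min\{p_2,1-p_2\},$$ and $\mathcal R_{\rm outer}$ is the set of $(R_1,R_2)\in\mathbb R_{\ge0}^2$ with $$R_1\le p_2\min\{p_1,1-p_1\},\qquad R_2\le p_1\min\{p_2,1-p_2\},\qquad R_1+R_2\le\min\{p_1p_2,\,1-p_1p_2\}.$$ The outer inclusion also holds for the region obtained when the sizes of all index sets and the lengths of all strings in the protocol are chosen freely, without the relations to $r_i,\lambda,\lambda'$ above. -/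

import Mathlib

namespace BroadcastOT

noncomputable section

open scoped ENNReal

/-! ### Finite probability: products, random subsets, entropy, mutual information -/

/-- The product distribution of a finite family of distributions on finite alphabets
(independent coordinates). -/
def prodPMF {ι : Type} [Fintype ι] [DecidableEq ι] {α : Type} [Fintype α]
    (q : ι → PMF α) : PMF (ι → α) :=
  PMF.ofFintype (fun y => ∏ i, q i (y i)) (by
    rw [← Fintype.prod_sum (fun i a => q i a)]
    refine Finset.prod_eq_one fun i _ => ?_
    rw [← tsum_fintype (L := .unconditional _)]
    exact (q i).tsum_coe)

/-- A uniformly random subset of `T` with `m` elements. It is the empty set when `T` has fewer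
than `m` elements; the protocol below aborts in that case and does not use the value. -/
def uniformSubset {α : Type} (T : Finset α) (m : ℕ) : PMF (Finset α) :=
  if h : m ≤ T.card then
    PMF.uniformOfFinset (T.powersetCard m) (Finset.powersetCard_nonempty.2 h)
  else PMF.pure ∅

/-- Shannon entropy in bits. -/
def entropy {α : Type} [Fintype α] (μ : PMF α) : ℝ :=
  ∑ a, Real.negMulLog (μ a).toReal / Real.log 2

/-- `I(A; B) = H(A) + H(B) - H(A, B)` for random variables `A`, `B` with finitely many values. -/
def mutualInfo {Ω α β : Type} [Fintype α] [Fintype β] (μ : PMF Ω) (A : Ω → α) (B : Ω → β) : ℝ :=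
  entropy (μ.map A) + entropy (μ.map B) - entropy (μ.map fun ω => (A ω, B ω))

/-- Probability of an event. -/
def prob {Ω : Type} (μ : PMF Ω) (S : Set Ω) : ℝ := (μ.toOuterMeasure S).toReal

/-! ### The channel -/

/-- The binary erasure channel with erasure probability `p`; `none` is the erasure symbol. -/
def bec (p : unitInterval) (x : Bool) : PMF (Option Bool) :=
  PMF.ofFintype
    (fun y => match y with
      | none => ENNReal.ofReal p
      | some b => if b = x then ENNReal.ofReal (1 - p) else 0) (by
    rw [Fintype.sum_option]
    have h : ENNReal.ofReal (p : ℝ) + ENNReal.ofReal (1 - (p : ℝ)) = 1 := by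
      rw [← ENNReal.ofReal_add p.2.1 (sub_nonneg.2 p.2.2)]
      simp
    simpa using h)

/-- `n` uses of the broadcast channel made of two independent erasure channels: Bob-`i` observes
the whole input word through his own memoryless erasure channel with parameter `p i`.
Bob-1 has index `0`, Bob-2 has index `1`. -/
def channel (p : Fin 2 → unitInterval) {n : ℕ} (x : Fin n → Bool) :
    PMF (Fin 2 → Fin n → Option Bool) :=
  prodPMF fun i => prodPMF fun l => bec (p i) (x l)

/-- The index of the other receiver. -/
def other (i : Fin 2) : Fin 2 := 1 - i

/-- Positions that are not erased. -/
def received {n : ℕ} (y : Fin n → Option Bool) : Finset (Fin n) :=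
  Finset.univ.filter fun l => y l ≠ none

/-- Positions that are erased. -/
def erased {n : ℕ} (y : Fin n → Option Bool) : Finset (Fin n) :=
  Finset.univ.filter fun l => y l = none

/-- The subword `x|_A`, in increasing order of the positions, for a set `A` of `s` positions
(padded by `false` if `A` has fewer elements). -/
def subword {n : ℕ} (x : Fin n → Bool) (A : Finset (Fin n)) (s : ℕ) : Fin s → Bool :=
  fun j => if h : (j : ℕ) < A.card then x (A.orderEmbOfFin rfl ⟨j, h⟩) else false

/-! ### Two-universal hashing -/

/-- Functions from `s`-bit words to `k`-bit words. -/
abbrev HashFun (s k : ℕ) : Type := (Fin s → Bool) → (Fin k → Bool)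

/-- A (nonempty, finite) two-universal family of hash functions from `s` bits to `k` bits: for
distinct `x`, `x'`, a uniformly chosen member collides with probability at most `2 ^ (-k)`. -/
structure TwoUniversal (s k : ℕ) where
  funs : Finset (HashFun s k)
  nonempty : funs.Nonempty
  collision : ∀ x x' : Fin s → Bool, x ≠ x' →
    ((funs.filter fun g => g x = g x').card : ℝ) / (funs.card : ℝ) ≤ (1 / 2 : ℝ) ^ k

/-! ### One run of the sequential protocol -/

/-- Sizes in one run: `n` channel uses; Bob-`i` announces two index sets with `s i` elements each;
the receiver served first also announces a set of `left` further erased positions; the strings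
for Bob-`i` have `k i` bits. -/
structure Sizes where
  n : ℕ
  s : Fin 2 → ℕ
  left : ℕ
  k : Fin 2 → ℕ

/-- The sizes the protocol uses when Bob-`f` is served first, for rates `r`, and slacks
`lam`, `lam'`. Either `r i` is in the admissible range for Bob-`i`, or `r i = 0` and Bob-`i` gets
the empty string. There is a second phase only if `p f > 1/2`. -/
def IsProtocolSizes (p : Fin 2 → unitInterval) (f : Fin 2) (B : Sizes) : Prop :=
  ∃ (r : Fin 2 → ℝ) (lam : ℝ) (lam' : ℚ), 0 < lam ∧ lam < 1 ∧ 0 < lam' ∧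
    (∀ i, ((lam' : ℝ) < r i ∧
        r i < (p (other i) : ℝ) * min (p i : ℝ) (1 - (p i : ℝ)) - lam) ∨ r i = 0) ∧
    B.s f = ⌊r f / ((p (other f) : ℝ) - lam') * B.n⌋₊ ∧
    (B.k f : ℝ) = (if r f = 0 then 0 else B.n * (r f - lam')) ∧
    (if (1 / 2 : ℝ) < p f then
      B.left = ⌊((p f : ℝ) - lam - r f / ((p (other f) : ℝ) - lam')) * B.n⌋₊ ∧
      B.s (other f) = ⌊r (other f) * B.n⌋₊ ∧
      (B.k (other f) : ℝ) = (if r (other f) = 0 then 0 else B.n * (r (other f) - lam'))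
    else B.left = 0 ∧ B.s (other f) = 0 ∧ B.k (other f) = 0)

/-- The strings `m_{i0}, m_{i1}`, where the one for Bob-`i` have `k i` bits. -/
abbrev Strings (k : Fin 2 → ℕ) : Type := (i : Fin 2) → Bool → Fin (k i) → Bool

/-- The hash functions `κ_{i0}, κ_{i1}`. -/
abbrev Hashes (B : Sizes) : Type := (i : Fin 2) → Bool → HashFun (B.s i) (B.k i)

/-- Everything that happens in one run: Alice's strings, hash functions and channel inputs, the
channel outputs, the index sets `sel i 0, sel i 1` of Bob-`i`, and the set `left` of further
erased positions of the receiver served first. -/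
structure Run (B : Sizes) where
  msg : Strings B.k
  hash : Hashes B
  x : Fin B.n → Bool
  y : Fin 2 → Fin B.n → Option Bool
  sel : Fin 2 → Bool → Finset (Fin B.n)
  left : Finset (Fin B.n)

/-- The law of one run in which Bob-`f` is served first, given the choice bits `z`.
Bob-`f` draws `S_{z_f}` among his received positions and `S_{¬ z_f}` among his erased positions,
then `left` among his other erased positions (unless he aborts). The other receiver draws his
two sets in the same way, inside `left`. -/
def runLaw (H : (s k : ℕ) → TwoUniversal s k) (p : Fin 2 → unitInterval) (f : Fin 2) (B : Sizes)
    (z : Fin 2 → Bool) : PMF (Run B) :=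
  (PMF.uniformOfFintype (Strings B.k)).bind fun msg =>
  (PMF.uniformOfFinset
    (Fintype.piFinset fun i => Fintype.piFinset fun _ : Bool => (H (B.s i) (B.k i)).funs)
    (Fintype.piFinset_nonempty.2 fun i => Fintype.piFinset_nonempty.2 fun _ =>
      (H (B.s i) (B.k i)).nonempty)).bind fun hash =>
  (PMF.uniformOfFintype (Fin B.n → Bool)).bind fun x =>
  (channel p x).bind fun y =>
  (uniformSubset (received (y f)) (B.s f)).bind fun A =>
  (uniformSubset (erased (y f)) (B.s f)).bind fun A' =>
  (if (received (y f)).card < B.s f ∨ (erased (y f)).card < B.s f + B.left then PMF.pure ∅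
    else uniformSubset (erased (y f) \ A') B.left).bind fun L =>
  (uniformSubset (received (y (other f)) ∩ L) (B.s (other f))).bind fun D =>
  (uniformSubset (erased (y (other f)) ∩ L) (B.s (other f))).bind fun D' =>
  PMF.pure
    { msg := msg
      hash := hash
      x := x
      y := y
      sel := fun i b =>
        if i = f then (if b = z i then A else A') else (if b = z i then D else D')
      left := L }

namespace Run

variable {B : Sizes}

/-- Bob-`f`, who is served first, aborts: he cannot form his sets. -/
def Abort₁ (f : Fin 2) (ω : Run B) : Prop :=
  (received (ω.y f)).card < B.s f ∨ (erased (ω.y f)).card < B.s f + B.left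

/-- The other receiver aborts: he cannot form his sets inside `left`. -/
def Abort₂ (f : Fin 2) (ω : Run B) : Prop :=
  (received (ω.y (other f)) ∩ ω.left).card < B.s (other f) ∨
    (erased (ω.y (other f)) ∩ ω.left).card < B.s (other f)

/-- The masked string `m_{ib} ⊕ κ_{ib}(x|_{S_{ib}})`. -/
def cipher (ω : Run B) (i : Fin 2) (b : Bool) : Fin (B.k i) → Bool :=
  fun j => xor (ω.msg i b j) (ω.hash i b (subword ω.x (ω.sel i b) (B.s i)) j)

/-- The public messages about Bob-`i`'s strings: two index sets, two hash functions, two masked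
strings. -/
abbrev Public (B : Sizes) (i : Fin 2) : Type :=
  (Bool → Finset (Fin B.n)) × (Bool → HashFun (B.s i) (B.k i)) × (Bool → Fin (B.k i) → Bool)

/-- The public messages about Bob-`i`'s strings in a run. -/
def publicPart (ω : Run B) (i : Fin 2) : Public B i :=
  (ω.sel i, ω.hash i, ω.cipher i)

/-- Public transcripts; `none` records that the receiver concerned aborted. -/
abbrev Transcript (B : Sizes) (f : Fin 2) : Type :=
  Option ((Finset (Fin B.n) × Public B f) × Option (Public B (other f)))

open Classical in
/-- The public transcript of a run in which Bob-`f` is served first. -/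
def transcript (f : Fin 2) (ω : Run B) : Transcript B f :=
  if ω.Abort₁ f then none
  else some ((ω.left, ω.publicPart f),
    if ω.Abort₂ f then none else some (ω.publicPart (other f)))

/-- What Alice has at the end: strings, hash functions, channel inputs, public transcript. -/
abbrev AliceView (B : Sizes) (f : Fin 2) : Type :=
  Strings B.k × Hashes B × (Fin B.n → Bool) × Transcript B f

instance (B : Sizes) (f : Fin 2) : Fintype (Transcript B f) := instFintypeOption

instance (B : Sizes) (f : Fin 2) : Fintype (AliceView B f) :=
  instFintypeProd _ _

/-- Alice's view of a run. -/
def aliceView (f : Fin 2) (ω : Run B) : AliceView B f :=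
  (ω.msg, ω.hash, ω.x, ω.transcript f)

/-- What a receiver has at the end (besides his choice bit): his random draws, his channel
outputs, the public transcript. -/
abbrev BobView (B : Sizes) (f : Fin 2) : Type :=
  ((Bool → Finset (Fin B.n)) × Finset (Fin B.n)) × (Fin B.n → Option Bool) × Transcript B f

instance (B : Sizes) (f : Fin 2) : Fintype (BobView B f) :=
  instFintypeProd _ _

/-- Bob-`i`'s view of a run; only Bob-`f` draws the set `left`. -/
def bobView (f i : Fin 2) (ω : Run B) : BobView B f :=
  ((ω.sel i, if i = f then ω.left else ∅), ω.y i, ω.transcript f)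

open Classical in
/-- Bob-`i`'s estimate of the string with label `b`, his choice bit: he unmasks the string with the
hash value of his own channel outputs. It is `none` if the run was aborted before he was
served. -/
def estimate (f i : Fin 2) (b : Bool) (ω : Run B) : Option (Fin (B.k i) → Bool) :=
  if ω.Abort₁ f ∨ (i ≠ f ∧ ω.Abort₂ f) then none
  else some fun j => xor (ω.cipher i b j)
    (ω.hash i b (subword (fun l => (ω.y i l).getD false) (ω.sel i b) (B.s i)) j)

end Run

/-! ### Time sharing between the two orders -/

/-- A run `a` in which Bob-1 is served first, and then a run `b` in which Bob-2 is served first. -/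
structure Shared where
  a : Sizes
  b : Sizes

/-- The sizes of both runs are those of the protocol. -/
def IsProtocol (p : Fin 2 → unitInterval) (P : Shared) : Prop :=
  IsProtocolSizes p 0 P.a ∧ IsProtocolSizes p 1 P.b

namespace Shared

variable (P : Shared)

/-- Total number of channel uses. -/
def uses : ℕ := P.a.n + P.b.n

/-- Total length of each of the two strings for Bob-`i`. -/
def len (i : Fin 2) : ℕ := P.a.k i + P.b.k i

/-- Choice bits of the receivers, and the two runs. -/
abbrev Outcome (P : Shared) : Type := (Fin 2 → Bool) × Run P.a × Run P.b

/-- The law of the shared protocol: uniform choice bits, used in both runs; given them, the two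
runs are independent. -/
def law (H : (s k : ℕ) → TwoUniversal s k) (p : Fin 2 → unitInterval) : PMF P.Outcome :=
  (PMF.uniformOfFintype (Fin 2 → Bool)).bind fun z =>
  (runLaw H p 0 P.a z).bind fun ωa =>
  (runLaw H p 1 P.b z).bind fun ωb => PMF.pure (z, ωa, ωb)

variable {P}

/-- Choice bit `Z_i`. -/
def Z (i : Fin 2) (ω : P.Outcome) : Bool := ω.1 i

/-- The string `M_{ib}`, in two pieces, one for each run. -/
def M (i : Fin 2) (b : Bool) (ω : P.Outcome) : (Fin (P.a.k i) → Bool) × (Fin (P.b.k i) → Bool) :=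
  (ω.2.1.msg i b, ω.2.2.msg i b)

/-- The string that Bob-`i` did not choose. -/
def Munchosen (i : Fin 2) (ω : P.Outcome) : (Fin (P.a.k i) → Bool) × (Fin (P.b.k i) → Bool) :=
  M i (!(Z i ω)) ω

/-- Alice's final view `U`. -/
def U (ω : P.Outcome) : Run.AliceView P.a 0 × Run.AliceView P.b 1 :=
  (ω.2.1.aliceView 0, ω.2.2.aliceView 1)

/-- Bob-`i`'s final view `V_i`. -/
def V (i : Fin 2) (ω : P.Outcome) : Bool × Run.BobView P.a 0 × Run.BobView P.b 1 :=
  (Z i ω, ω.2.1.bobView 0 i, ω.2.2.bobView 1 i)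

/-- Bob-`i` fails to output the string he chose (in particular if a run is aborted before he is
served). -/
def Err (i : Fin 2) : Set P.Outcome :=
  {ω | ¬ (ω.2.1.estimate 0 i (Z i ω) = some (M i (Z i ω) ω).1 ∧
          ω.2.2.estimate 1 i (Z i ω) = some (M i (Z i ω) ω).2)}

end Shared

open Filter Topology Shared in
/-- Correctness and security against colluding honest-but-curious parties, for a sequence of
protocols. -/
structure SecureColluding (H : (s k : ℕ) → TwoUniversal s k) (p : Fin 2 → unitInterval)
    (P : ℕ → Shared) : Prop where
  correct : ∀ i, Tendsto (fun n => prob ((P n).law H p) (Err i)) atTop (𝓝 0)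
  unchosen_hidden : Tendsto (fun n => mutualInfo ((P n).law H p)
    (fun ω => (Munchosen 0 ω, Munchosen 1 ω)) (fun ω => (V 0 ω, V 1 ω))) atTop (𝓝 0)
  choice_hidden_collusion : ∀ i, Tendsto (fun n => mutualInfo ((P n).law H p)
    (Z i) (fun ω => (U ω, V (other i) ω))) atTop (𝓝 0)
  choices_hidden : Tendsto (fun n => mutualInfo ((P n).law H p)
    (fun ω => (Z 0 ω, Z 1 ω)) U) atTop (𝓝 0)
  receivers_separated : ∀ i, Tendsto (fun n => mutualInfo ((P n).law H p)
    (fun ω => (M i false ω, M i true ω, Munchosen (other i) ω, Z i ω)) (V (other i)))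
    atTop (𝓝 0)

open Filter Topology in
/-- All pairs of nonnegative rates that are limits of `(k_1 / n, k_2 / n)` along a sequence of
shared protocols with `n` channel uses that all satisfy `adm` and that are asymptotically correct
and secure against collusion. -/
def achieved (H : (s k : ℕ) → TwoUniversal s k) (p : Fin 2 → unitInterval)
    (adm : Shared → Prop) : Set (ℝ × ℝ) :=
  {R | 0 ≤ R.1 ∧ 0 ≤ R.2 ∧ ∃ P : ℕ → Shared,
    (∀ n, adm (P n) ∧ (P n).uses = n) ∧
    Tendsto (fun n : ℕ => ((P n).len 0 : ℝ) / n) atTop (𝓝 R.1) ∧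
    Tendsto (fun n : ℕ => ((P n).len 1 : ℝ) / n) atTop (𝓝 R.2) ∧
    SecureColluding H p P}

/-- The rate region of the protocol with colluding parties. -/
def rateRegion (H : (s k : ℕ) → TwoUniversal s k) (p : Fin 2 → unitInterval) : Set (ℝ × ℝ) :=
  achieved H p (IsProtocol p)

/-- The rate region when the sizes of the index sets and of the strings may be chosen freely,
without the relations in `IsProtocolSizes`. -/
def freeSizesRegion (H : (s k : ℕ) → TwoUniversal s k) (p : Fin 2 → unitInterval) :
    Set (ℝ × ℝ) :=
  achieved H p fun _ => True

/-- The inner region. -/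
def innerRegion (p₁ p₂ : ℝ) : Set (ℝ × ℝ) :=
  {R | 0 ≤ R.1 ∧ 0 ≤ R.2 ∧
    R.1 ≤ p₂ * min p₁ (1 - p₁) ∧
    R.2 ≤ p₁ * min p₂ (1 - p₂) ∧
    R.1 + R.2 ≤ p₂ * min p₁ (1 - p₁) + p₁ * min p₂ (1 - p₂)
      - min p₁ (1 - p₁) * min p₂ (1 - p₂)}

/-- The outer region. -/
def outerRegion (p₁ p₂ : ℝ) : Set (ℝ × ℝ) :=
  {R | 0 ≤ R.1 ∧ 0 ≤ R.2 ∧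
    R.1 ≤ p₂ * min p₁ (1 - p₁) ∧
    R.2 ≤ p₁ * min p₂ (1 - p₂) ∧
    R.1 + R.2 ≤ min (p₁ * p₂) (1 - p₁ * p₂)}

end

end BroadcastOT

namespace BroadcastOT

noncomputable section

open scoped ENNReal

/-! ### Expectations over finite probability spaces -/

/-! The output of an erasure channel is the input masked by an erasure pattern that is independent
of the input. So a run is a deterministic function `mkRun` of the choice bits and of base data
(strings, hash functions, input word, patterns, drawn sets) whose law does not involve the choice
bits (`runLaw_eq`, `law_eq`). Below, f is the receiver served first, o is the other one, and q_i =
min(p_i, 1 - p_i).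

Secrecy of the choice bits is exact. A receiver may complement his bit and interchange his received
and his erased set, altering his erasure pattern accordingly. All probabilities depend only on
cardinalities, so the law is preserved, while Alice and the other receiver see the same as before
(`expect_swapOutcome`, `swapOutcome_views`). Hence the bit is uniform given their views.

Secrecy of the strings is privacy amplification. The key for a string is hashed from a set S of
positions, and its protection lies in the part of S erased for the other receiver (`Draws.hidden`).
Leftover hashing (`mutualInfo_leak_le`, `mutualInfo_env_le`) bounds the leakage by the mean of
`leakBound`, which is exponentially small once the number of hidden positions exceeds the string
length linearly. For f about p_o s of the s positions are hidden, because the pattern of o is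
independent of the draws of f. For o all positions are hidden, because his sets lie inside erasures
of f.

For the inner region, Chernoff bounds make abort and leakage vanish whenever all sizes keep a linear
margin (`Sizes.Margin.abortProb_le`, `Sizes.Margin.runLeak_le`). Serving f at rate p_o q_f uses up a
share q_f of his erasures and leaves p_f - q_f, from which o obtains q_o (p_f - q_f). The two orders
give two corner points, and `exists_attainable_of_mem_innerRegion` reaches the inner region by time
sharing between the rectangles below them.

For the outer region, both views together leave an unchosen string undetermined only through the
input bits at hidden positions, so its length is at most the mean number of hidden positions plus
the leaked information, up to the effect of aborts (`length_le_of_mutualInfo`). The sets must also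
fit among the positions that the channel provides on average (`size_bounds`). Elementary
inequalities (`run_rate_bounds`) then bound each run linearly in its number of uses, with the same
coefficients for both orders, so the bounds add up under time sharing. No relation between sizes and
protocol parameters enters here. -/

open Classical in
/-- The indicator of a proposition, as a real number. -/
def ind (P : Prop) : ℝ := if P then 1 else 0

theorem ind_of {P : Prop} (h : P) : ind P = 1 := if_pos h

theorem ind_of_not {P : Prop} (h : ¬P) : ind P = 0 := if_neg h

theorem ind_nonneg (P : Prop) : 0 ≤ ind P := by
  by_cases h : P
  · simp [ind_of h]
  · simp [ind_of_not h]

theorem ind_le_one (P : Prop) : ind P ≤ 1 := by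
  by_cases h : P
  · simp [ind_of h]
  · simp [ind_of_not h]

theorem ind_mono {P Q : Prop} (h : P → Q) : ind P ≤ ind Q := by
  by_cases hP : P
  · rw [ind_of hP, ind_of (h hP)]
  · rw [ind_of_not hP]
    exact ind_nonneg Q

theorem ind_eq_ite (P : Prop) [Decidable P] : ind P = if P then 1 else 0 := by
  by_cases h : P
  · rw [ind_of h, if_pos h]
  · rw [ind_of_not h, if_neg h]

theorem ind_congr {P Q : Prop} (h : P ↔ Q) : ind P = ind Q := by rw [propext h]

theorem ind_or_le (P Q : Prop) : ind (P ∨ Q) ≤ ind P + ind Q := by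
  by_cases hP : P
  · rw [ind_of (Or.inl hP), ind_of hP]
    linarith [ind_nonneg Q]
  · rw [ind_of_not hP, zero_add]
    exact ind_mono fun h => h.resolve_left hP

section Expect

variable {α β γ : Type} [Fintype α] [Fintype β]

/-- Expectation of a real function on a finite probability space. -/
def expect (μ : PMF α) (f : α → ℝ) : ℝ := ∑ a, (μ a).toReal * f a

theorem toReal_bind (μ : PMF α) (κ : α → PMF γ) (b : γ) :
    ((μ.bind κ) b).toReal = expect μ fun a => (κ a b).toReal := by
  rw [PMF.bind_apply, tsum_fintype, ENNReal.toReal_sum]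
  · simp [expect, ENNReal.toReal_mul]
  · intro a _
    exact ENNReal.mul_ne_top (PMF.apply_ne_top _ _) (PMF.apply_ne_top _ _)

theorem toReal_pure (a b : γ) : (PMF.pure a b).toReal = ind (a = b) := by
  classical
  rw [PMF.pure_apply, ind_eq_ite]
  by_cases h : a = b
  · simp [h]
  · simp [h, Ne.symm h]

theorem toReal_map (μ : PMF α) (g : α → γ) (b : γ) :
    ((μ.map g) b).toReal = expect μ fun a => ind (g a = b) := by
  rw [← PMF.bind_pure_comp, toReal_bind]
  simp only [Function.comp_apply, toReal_pure]

theorem sum_toReal (μ : PMF α) : ∑ a, (μ a).toReal = 1 := by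
  rw [← ENNReal.toReal_sum fun a _ => PMF.apply_ne_top _ _, ← tsum_fintype (L := .unconditional _),
    μ.tsum_coe, ENNReal.toReal_one]

theorem expect_const (μ : PMF α) (c : ℝ) : (expect μ fun _ => c) = c := by
  rw [expect, ← Finset.sum_mul, sum_toReal, one_mul]

theorem expect_add (μ : PMF α) (f g : α → ℝ) :
    (expect μ fun a => f a + g a) = expect μ f + expect μ g := by
  simp [expect, mul_add, Finset.sum_add_distrib]

theorem expect_sub (μ : PMF α) (f g : α → ℝ) :
    (expect μ fun a => f a - g a) = expect μ f - expect μ g := by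
  simp [expect, mul_sub, Finset.sum_sub_distrib]

theorem expect_mul_left (μ : PMF α) (c : ℝ) (f : α → ℝ) :
    (expect μ fun a => c * f a) = c * expect μ f := by
  rw [expect, expect, Finset.mul_sum]
  exact Finset.sum_congr rfl fun a _ => by ring

theorem expect_mul_right (μ : PMF α) (c : ℝ) (f : α → ℝ) :
    (expect μ fun a => f a * c) = expect μ f * c := by
  rw [expect, expect, Finset.sum_mul]
  exact Finset.sum_congr rfl fun a _ => by ring

theorem expect_sum {ι : Type} (s : Finset ι) (μ : PMF α) (f : ι → α → ℝ) :
    (expect μ fun a => ∑ i ∈ s, f i a) = ∑ i ∈ s, expect μ (f i) := by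
  simp only [expect, Finset.mul_sum]
  rw [Finset.sum_comm]

theorem expect_mono_on {μ : PMF α} {f g : α → ℝ} (h : ∀ a ∈ μ.support, f a ≤ g a) :
    expect μ f ≤ expect μ g := by
  refine Finset.sum_le_sum fun a _ => ?_
  by_cases ha : a ∈ μ.support
  · exact mul_le_mul_of_nonneg_left (h a ha) ENNReal.toReal_nonneg
  · rw [← PMF.apply_eq_zero_iff] at ha
    simp [ha]

theorem expect_mono {μ : PMF α} {f g : α → ℝ} (h : ∀ a, f a ≤ g a) : expect μ f ≤ expect μ g :=
  expect_mono_on fun a _ => h a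

theorem expect_congr_on {μ : PMF α} {f g : α → ℝ} (h : ∀ a ∈ μ.support, f a = g a) :
    expect μ f = expect μ g :=
  le_antisymm (expect_mono_on fun a ha => (h a ha).le) (expect_mono_on fun a ha => (h a ha).ge)

theorem expect_nonneg_on {μ : PMF α} {f : α → ℝ} (h : ∀ a ∈ μ.support, 0 ≤ f a) :
    0 ≤ expect μ f := by
  have := expect_mono_on (μ := μ) h
  rwa [expect_const] at this

theorem expect_nonneg {μ : PMF α} {f : α → ℝ} (h : ∀ a, 0 ≤ f a) : 0 ≤ expect μ f :=
  expect_nonneg_on fun a _ => h a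

theorem expect_le_of_le {μ : PMF α} {f : α → ℝ} {c : ℝ} (h : ∀ a ∈ μ.support, f a ≤ c) :
    expect μ f ≤ c :=
  (expect_mono_on h).trans_eq (expect_const μ c)

theorem expect_bind (μ : PMF α) (κ : α → PMF β) (f : β → ℝ) :
    expect (μ.bind κ) f = expect μ fun a => expect (κ a) f := by
  simp only [expect, toReal_bind, Finset.sum_mul, Finset.mul_sum]
  rw [Finset.sum_comm]
  exact Finset.sum_congr rfl fun a _ => Finset.sum_congr rfl fun b _ => by ring

theorem expect_pure (a : α) (f : α → ℝ) : expect (PMF.pure a) f = f a := by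
  rw [expect, Finset.sum_eq_single a]
  · simp
  · intro b _ hb
    simp [hb]
  · simp

theorem expect_map (μ : PMF α) (g : α → β) (f : β → ℝ) :
    expect (μ.map g) f = expect μ fun a => f (g a) := by
  rw [← PMF.bind_pure_comp, expect_bind]
  simp [expect_pure]

theorem expect_comm (μ : PMF α) (ν : PMF β) (f : α → β → ℝ) :
    (expect μ fun a => expect ν fun b => f a b) = expect ν fun b => expect μ fun a => f a b := by
  simp only [expect, Finset.mul_sum]
  rw [Finset.sum_comm]
  exact Finset.sum_congr rfl fun a _ => Finset.sum_congr rfl fun b _ => by ring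

theorem expect_ind_eq (μ : PMF α) (a : α) : (expect μ fun b => ind (b = a)) = (μ a).toReal := by
  rw [expect, Finset.sum_eq_single a]
  · simp [ind_of]
  · intro b _ hb
    simp [ind_of_not hb]
  · simp

theorem prob_eq_expect (μ : PMF α) (S : Set α) : prob μ S = expect μ fun a => ind (a ∈ S) := by
  classical
  rw [prob, PMF.toOuterMeasure_apply_fintype, ENNReal.toReal_sum]
  · refine Finset.sum_congr rfl fun a _ => ?_
    by_cases h : a ∈ S
    · simp [h, ind_of]
    · simp [h, ind_of_not]
  · intro a _
    by_cases h : a ∈ S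
    · simp [h, PMF.apply_ne_top]
    · simp [h]

theorem expect_uniformOfFinset {s : Finset α} (hs : s.Nonempty) (f : α → ℝ) :
    expect (PMF.uniformOfFinset s hs) f = (∑ a ∈ s, f a) / s.card := by
  classical
  rw [expect, Finset.sum_div, ← Finset.sum_subset (Finset.subset_univ s)]
  · refine Finset.sum_congr rfl fun a ha => ?_
    rw [PMF.uniformOfFinset_apply_of_mem hs ha]
    simp [div_eq_inv_mul]
  · intro a _ ha
    rw [PMF.uniformOfFinset_apply_of_notMem hs ha]
    simp

theorem expect_uniformOfFintype [Nonempty α] (f : α → ℝ) :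
    expect (PMF.uniformOfFintype α) f = (∑ a, f a) / Fintype.card α := by
  rw [PMF.uniformOfFintype, expect_uniformOfFinset, Finset.card_univ]

theorem uniformOfFintype_toReal [Nonempty α] (a : α) :
    (PMF.uniformOfFintype α a).toReal = 1 / Fintype.card α := by
  simp

end Expect

theorem prob_map {α β : Type} (μ : PMF α) (g : α → β) (S : Set β) :
    prob (μ.map g) S = prob μ (g ⁻¹' S) := by
  rw [prob, prob, PMF.toOuterMeasure_map_apply]

theorem mutualInfo_map {Ω Ω' α β : Type} [Fintype α] [Fintype β] (ν : PMF Ω') (g : Ω' → Ω)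
    (A : Ω → α) (B : Ω → β) :
    mutualInfo (ν.map g) A B = mutualInfo ν (fun ω => A (g ω)) fun ω => B (g ω) := by
  simp [mutualInfo, PMF.map_comp, Function.comp_def]

/-! ### Entropy of random variables on a finite probability space -/

section Entropy

set_option linter.unusedSectionVars false

variable {Ω α β γ : Type} [Fintype Ω]

/-- `pr μ A a` is the probability that the random variable `A` takes the value `a`. -/
def pr (μ : PMF Ω) (A : Ω → α) (a : α) : ℝ := ((μ.map A) a).toReal

/-- Entropy in bits of the random variable `A`, as an expectation. -/
def ent (μ : PMF Ω) (A : Ω → α) : ℝ :=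
  (expect μ fun ω => -Real.log (pr μ A (A ω))) / Real.log 2

variable {μ : PMF Ω}

theorem pr_eq_expect (A : Ω → α) (a : α) : pr μ A a = expect μ fun ω => ind (A ω = a) :=
  toReal_map μ A a

theorem pr_nonneg (A : Ω → α) (a : α) : 0 ≤ pr μ A a := ENNReal.toReal_nonneg

theorem pr_pos (A : Ω → α) {ω : Ω} (h : ω ∈ μ.support) : 0 < pr μ A (A ω) := by
  refine ENNReal.toReal_pos ?_ (PMF.apply_ne_top _ _)
  rw [← PMF.mem_support_iff, PMF.mem_support_map_iff]
  exact ⟨ω, h, rfl⟩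

theorem pr_ne_zero_iff (A : Ω → α) (a : α) : pr μ A a ≠ 0 ↔ ∃ ω ∈ μ.support, A ω = a := by
  rw [← PMF.mem_support_map_iff, PMF.mem_support_iff, pr, ENNReal.toReal_ne_zero]
  exact and_iff_left (PMF.apply_ne_top _ _)

theorem sum_pr [Fintype α] (A : Ω → α) : ∑ a, pr μ A a = 1 := sum_toReal _

theorem sum_pr_left [Fintype α] (A : Ω → α) (B : Ω → β) (b : β) :
    ∑ a, pr μ (fun ω => (A ω, B ω)) (a, b) = pr μ B b := by
  classical
  simp only [pr_eq_expect]
  rw [← expect_sum]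
  refine expect_congr_on fun ω _ => ?_
  rw [Finset.sum_eq_single (A ω)]
  · exact ind_congr (by simp)
  · intro a _ ha
    exact ind_of_not (by simp [Ne.symm ha])
  · simp

theorem pr_congr {A : Ω → α} {B : Ω → β} {a : α} {b : β}
    (h : ∀ ω ∈ μ.support, A ω = a ↔ B ω = b) : pr μ A a = pr μ B b := by
  rw [pr_eq_expect, pr_eq_expect]
  exact expect_congr_on fun ω hω => ind_congr (h ω hω)

theorem entropy_map [Fintype α] (A : Ω → α) : entropy (μ.map A) = ent μ A := by
  rw [entropy, ent, ← Finset.sum_div]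
  congr 1
  have := expect_map μ A fun a => -Real.log (pr μ A a)
  rw [← this, expect]
  refine Finset.sum_congr rfl fun a _ => ?_
  rw [Real.negMulLog, pr]
  ring

theorem mutualInfo_eq_ent [Fintype α] [Fintype β] (A : Ω → α) (B : Ω → β) :
    mutualInfo μ A B = ent μ A + ent μ B - ent μ fun ω => (A ω, B ω) := by
  rw [mutualInfo, entropy_map, entropy_map, entropy_map]

/-- Entropy depends only on the partition that a variable induces on the support, so variables that
are functions of each other are interchangeable. This serves to regroup tuples. -/
theorem ent_congr {A : Ω → α} {B : Ω → β}
    (h : ∀ ω ∈ μ.support, ∀ ω' ∈ μ.support, A ω = A ω' ↔ B ω = B ω') : ent μ A = ent μ B := by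
  rw [ent, ent]
  congr 1
  refine expect_congr_on fun ω hω => ?_
  rw [pr_congr fun ω' hω' => h ω' hω' ω hω]

/-- Gibbs' inequality: the logarithm of a subprobability relative to the law of `A` has a
nonpositive expectation. -/
theorem expect_log_div_nonpos [Fintype α] (A : Ω → α) (F : α → ℝ)
    (hpos : ∀ ω ∈ μ.support, 0 < F (A ω)) (hF : ∀ a, 0 ≤ F a) (hsum : ∑ a, F a ≤ 1) :
    (expect μ fun ω => Real.log (F (A ω) / pr μ A (A ω))) ≤ 0 := by
  -- The mean likelihood ratio is the mass of `F` on the support of the law, at most 1; then log t ≤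
  -- t - 1.
  have h1 : (expect μ fun ω => F (A ω) / pr μ A (A ω)) ≤ 1 := by
    rw [← expect_map μ A fun a => F a / pr μ A a, expect]
    refine le_trans (Finset.sum_le_sum fun a _ => ?_) hsum
    change pr μ A a * (F a / pr μ A a) ≤ F a
    by_cases h : pr μ A a = 0
    · simp [h, hF]
    · rw [mul_div_cancel₀ _ h]
  have h2 : (expect μ fun ω => Real.log (F (A ω) / pr μ A (A ω))) ≤
      expect μ fun ω => F (A ω) / pr μ A (A ω) - 1 :=
    expect_mono_on fun ω hω => Real.log_le_sub_one_of_pos (div_pos (hpos ω hω) (pr_pos A hω))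
  rw [expect_sub, expect_const] at h2
  linarith

theorem log_two_pos : 0 < Real.log 2 := Real.log_pos one_lt_two

/-! ### Shannon inequalities -/

/-- Strong subadditivity of entropy. -/
theorem ent_submodular [Fintype α] [Fintype β] [Fintype γ] (A : Ω → α) (B : Ω → β) (C : Ω → γ) :
    (ent μ fun ω => (A ω, B ω, C ω)) + ent μ C ≤
      (ent μ fun ω => (A ω, C ω)) + ent μ fun ω => (B ω, C ω) := by
  -- The reference weight p(a,c) p(b,c) / p(c) is the law with the same pair marginals that makes
  -- `A` and `B` conditionally independent given `C`.
  have key := expect_log_div_nonpos (μ := μ) (fun ω => (A ω, B ω, C ω))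
    (fun x => pr μ (fun ω => (A ω, C ω)) (x.1, x.2.2) * pr μ (fun ω => (B ω, C ω)) (x.2.1, x.2.2) /
      pr μ C x.2.2)
    (fun ω hω => div_pos (mul_pos (pr_pos (fun ω => (A ω, C ω)) hω)
      (pr_pos (fun ω => (B ω, C ω)) hω)) (pr_pos C hω))
    (fun x => div_nonneg (mul_nonneg (pr_nonneg _ _) (pr_nonneg _ _)) (pr_nonneg _ _)) (by
      rw [Fintype.sum_prod_type_right, Fintype.sum_prod_type_right]
      rw [← sum_pr (μ := μ) C]
      refine Finset.sum_le_sum fun c _ => ?_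
      simp only [← Finset.sum_mul, ← Finset.sum_div, ← Finset.mul_sum, sum_pr_left]
      by_cases h : pr μ C c = 0
      · simp [h]
      · rw [mul_div_cancel_right₀ _ h])
  have h2 := log_two_pos
  simp only [ent]
  rw [← add_div, ← add_div]
  refine div_le_div_of_nonneg_right ?_ h2.le
  rw [← expect_add, ← expect_add, ← sub_nonpos, ← expect_sub]
  refine le_trans (le_of_eq (expect_congr_on fun ω hω => ?_)) key
  have p1 := pr_pos (fun ω => (A ω, C ω)) hω
  have p2 := pr_pos (fun ω => (B ω, C ω)) hω
  have p3 := pr_pos C hω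
  have p4 := pr_pos (fun ω => (A ω, B ω, C ω)) hω
  dsimp only at *
  rw [Real.log_div (by positivity) p4.ne', Real.log_div (by positivity) p3.ne',
    Real.log_mul p1.ne' p2.ne']
  ring

theorem ent_const (c : γ) : ent μ (fun _ => c) = 0 := by
  have : pr μ (fun _ : Ω => c) c = 1 := by
    rw [pr_eq_expect]
    simp [ind_of, expect_const]
  simp [ent, this, expect_const]

theorem ent_subadditive [Fintype α] [Fintype β] (A : Ω → α) (B : Ω → β) :
    (ent μ fun ω => (A ω, B ω)) ≤ ent μ A + ent μ B := by
  have h := ent_submodular (μ := μ) A B fun _ => ()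
  rw [ent_const, add_zero] at h
  refine le_trans (le_of_eq ?_) (h.trans (le_of_eq ?_))
  · exact ent_congr fun _ _ _ _ => by simp
  · congr 1 <;> exact ent_congr fun _ _ _ _ => by simp

/-- Data processing. -/
theorem mutualInfo_le_of_factor [Fintype α] [Fintype β] [Fintype γ] (A : Ω → α) {V : Ω → β}
    {W : Ω → γ} (h : ∀ ω ∈ μ.support, ∀ ω' ∈ μ.support, V ω = V ω' → W ω = W ω') :
    mutualInfo μ A W ≤ mutualInfo μ A V := by
  -- Conditioning on `W` expresses that `A` and `V` have nonnegative mutual information given `W`.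
  have h1 := ent_submodular (μ := μ) A V W
  have h2 : (ent μ fun ω => (V ω, W ω)) = ent μ V :=
    ent_congr fun ω hω ω' hω' => by simpa using h ω hω ω' hω'
  have h3 : (ent μ fun ω => (A ω, V ω, W ω)) = ent μ fun ω => (A ω, V ω) :=
    ent_congr fun ω hω ω' hω' => by simpa using fun _ => h ω hω ω' hω'
  rw [mutualInfo_eq_ent, mutualInfo_eq_ent]
  linarith

theorem mutualInfo_comm [Fintype α] [Fintype β] (A : Ω → α) (B : Ω → β) :
    mutualInfo μ A B = mutualInfo μ B A := by
  rw [mutualInfo_eq_ent, mutualInfo_eq_ent,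
    ent_congr (A := fun ω => (A ω, B ω)) (B := fun ω => (B ω, A ω))
      fun _ _ _ _ => by simp [and_comm]]
  ring

theorem mutualInfo_nonneg [Fintype α] [Fintype β] (A : Ω → α) (B : Ω → β) :
    0 ≤ mutualInfo μ A B := by
  rw [mutualInfo_eq_ent]
  linarith [ent_subadditive (μ := μ) A B]

/-- The information about a pair is at most the sum of the informations about its parts, the
other part being added to the observation. -/
theorem mutualInfo_pair_le [Fintype α] [Fintype β] [Fintype γ] (A : Ω → α) (B : Ω → β)
    (V : Ω → γ) :
    mutualInfo μ (fun ω => (A ω, B ω)) V ≤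
      mutualInfo μ A (fun ω => (V ω, B ω)) + mutualInfo μ B fun ω => (V ω, A ω) := by
  have h1 := ent_submodular (μ := μ) A B V
  have h2 := ent_subadditive (μ := μ) A B
  have e1 : (ent μ fun ω => ((A ω, B ω), V ω)) = ent μ fun ω => (A ω, B ω, V ω) :=
    ent_congr fun _ _ _ _ => by simp [and_assoc]
  have e2 : (ent μ fun ω => (A ω, V ω, B ω)) = ent μ fun ω => (A ω, B ω, V ω) :=
    ent_congr fun _ _ _ _ => by simp; tauto
  have e3 : (ent μ fun ω => (B ω, V ω, A ω)) = ent μ fun ω => (A ω, B ω, V ω) :=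
    ent_congr fun _ _ _ _ => by simp; tauto
  have e4 : (ent μ fun ω => (V ω, B ω)) = ent μ fun ω => (B ω, V ω) :=
    ent_congr fun _ _ _ _ => by simp [and_comm]
  have e5 : (ent μ fun ω => (V ω, A ω)) = ent μ fun ω => (A ω, V ω) :=
    ent_congr fun _ _ _ _ => by simp [and_comm]
  rw [mutualInfo_eq_ent, mutualInfo_eq_ent, mutualInfo_eq_ent, e1, e2, e3, e4, e5]
  linarith

/-- Chain rule, as an inequality. -/
theorem mutualInfo_pair_le' [Fintype α] [Fintype β] [Fintype γ] (A : Ω → α) (B : Ω → β)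
    (V : Ω → γ) :
    mutualInfo μ (fun ω => (A ω, B ω)) V ≤
      mutualInfo μ A (fun ω => (V ω, B ω)) + mutualInfo μ B V := by
  have h2 := ent_subadditive (μ := μ) A B
  have e1 : (ent μ fun ω => ((A ω, B ω), V ω)) = ent μ fun ω => (A ω, V ω, B ω) :=
    ent_congr fun _ _ _ _ => by simp; tauto
  have e4 : (ent μ fun ω => (V ω, B ω)) = ent μ fun ω => (B ω, V ω) :=
    ent_congr fun _ _ _ _ => by simp [and_comm]
  rw [mutualInfo_eq_ent, mutualInfo_eq_ent, mutualInfo_eq_ent, e1, e4]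
  linarith

/-- A joint law that does not depend on `a` makes `A` uniform on the whole type and independent of
`B`. Symmetries of the law are turned into exact secrecy in this form. -/
theorem mutualInfo_eq_zero_of_forall [Fintype α] [Fintype β] (A : Ω → α) (B : Ω → β)
    (h : ∀ a a' b, pr μ (fun ω => (A ω, B ω)) (a, b) = pr μ (fun ω => (A ω, B ω)) (a', b)) :
    mutualInfo μ A B = 0 := by
  have hB : ∀ a b, pr μ B b = Fintype.card α * pr μ (fun ω => (A ω, B ω)) (a, b) := by
    intro a b
    rw [← sum_pr_left A B b, Finset.sum_congr rfl fun a' _ => h a' a b]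
    simp
  have hA : ∀ a, Fintype.card α * pr μ A a = 1 := by
    intro a
    have : pr μ A a = ∑ b, pr μ (fun ω => (A ω, B ω)) (a, b) := by
      rw [← sum_pr_left B A a]
      exact Finset.sum_congr rfl fun b _ => pr_congr fun _ _ => by simp [and_comm]
    rw [this, Finset.mul_sum, ← sum_pr (μ := μ) B]
    exact Finset.sum_congr rfl fun b _ => (hB a b).symm
  rw [mutualInfo_eq_ent, ent, ent, ent, ← add_div, ← sub_div, ← expect_add, ← expect_sub,
    div_eq_zero_iff]
  left
  rw [← expect_const μ 0]
  refine expect_congr_on fun ω hω => ?_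
  have p1 := pr_pos A hω
  have p3 := pr_pos (fun ω => (A ω, B ω)) hω
  have hc : (0 : ℝ) < Fintype.card α := by
    by_contra hc
    have := hA (A ω)
    nlinarith
  have e : pr μ A (A ω) * pr μ B (B ω) = pr μ (fun ω => (A ω, B ω)) (A ω, B ω) := by
    rw [hB (A ω), ← mul_assoc, mul_comm (pr μ A (A ω)), hA, one_mul]
  have p2 := pr_pos B hω
  rw [← e, Real.log_mul p1.ne' p2.ne']
  ring

/-- If `A` is confined by `B` to a set of at most `N` values, then `B` reveals all of `A` but
`log N` bits. -/
theorem ent_sub_le_mutualInfo [Fintype α] [Fintype β] (A : Ω → α) (B : Ω → β) (N : Ω → ℝ)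
    (hN : ∀ ω ∈ μ.support,
      (Set.ncard {a | ∃ ω' ∈ μ.support, A ω' = a ∧ B ω' = B ω} : ℝ) ≤ N ω) :
    ent μ A - (expect μ fun ω => Real.log (N ω)) / Real.log 2 ≤ mutualInfo μ A B := by
  classical
  set S : β → Finset α := fun b =>
    Finset.univ.filter fun a => pr μ (fun ω => (A ω, B ω)) (a, b) ≠ 0 with hS
  have hcard : ∀ ω, Set.ncard {a | ∃ ω' ∈ μ.support, A ω' = a ∧ B ω' = B ω} = (S (B ω)).card := by
    intro ω
    rw [← Set.ncard_coe_finset]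
    congr 1
    ext a
    simp [hS, pr_ne_zero_iff]
  have hpos : ∀ ω ∈ μ.support, (0 : ℝ) < (S (B ω)).card := by
    intro ω hω
    have : A ω ∈ S (B ω) := by
      simp [hS]
      exact (pr_pos (fun ω => (A ω, B ω)) hω).ne'
    exact_mod_cast Finset.card_pos.2 ⟨_, this⟩
  -- The reference weight spreads the probability of `b` uniformly over the values of `A` compatible
  -- with `b`.
  have key := expect_log_div_nonpos (μ := μ) (fun ω => (A ω, B ω))
    (fun x => if x.1 ∈ S x.2 then pr μ B x.2 / (S x.2).card else 0)
    (fun ω hω => by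
      have : A ω ∈ S (B ω) := by
        simp [hS]
        exact (pr_pos (fun ω => (A ω, B ω)) hω).ne'
      simp only [this, if_true]
      exact div_pos (pr_pos B hω) (hpos ω hω))
    (fun x => by
      split_ifs
      · exact div_nonneg (pr_nonneg _ _) (Nat.cast_nonneg _)
      · exact le_rfl)
    (by
      rw [Fintype.sum_prod_type_right, ← sum_pr (μ := μ) B]
      refine Finset.sum_le_sum fun b _ => ?_
      rw [← Finset.sum_filter]
      simp only [Finset.filter_univ_mem, Finset.sum_const, nsmul_eq_mul]
      by_cases h : ((S b).card : ℝ) = 0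
      · simp [h, pr_nonneg]
      · rw [mul_div_cancel₀ _ h])
  have h2 := log_two_pos
  rw [mutualInfo_eq_ent]
  have : ent μ (fun ω => (A ω, B ω)) - ent μ B ≤
      (expect μ fun ω => Real.log (N ω)) / Real.log 2 := by
    rw [ent, ent, ← sub_div, ← expect_sub]
    gcongr
    rw [← sub_nonpos, ← expect_sub]
    refine le_trans (expect_mono_on fun ω hω => ?_) key
    have hm : A ω ∈ S (B ω) := by
      simp [hS]
      exact (pr_pos (fun ω => (A ω, B ω)) hω).ne'
    have p1 := pr_pos B hω
    have p2 := pr_pos (fun ω => (A ω, B ω)) hω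
    have p3 := hpos ω hω
    have p4 : Real.log (S (B ω)).card ≤ Real.log (N ω) :=
      Real.log_le_log p3 (by rw [← hcard]; exact hN ω hω)
    dsimp only at *
    rw [if_pos hm, Real.log_div (by positivity) p2.ne', Real.log_div p1.ne' p3.ne']
    linarith
  linarith

theorem ent_of_uniform {A : Ω → α} {c : ℝ} (h : ∀ ω ∈ μ.support, pr μ A (A ω) = 1 / 2 ^ c) :
    ent μ A = c := by
  have h2 := log_two_pos
  rw [ent, expect_congr_on (g := fun _ => c * Real.log 2) fun ω hω => ?_, expect_const,
    mul_div_cancel_right₀ _ h2.ne']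
  rw [h ω hω, one_div, Real.log_inv, Real.log_rpow two_pos, neg_neg]

end Entropy

/-! ### Erasure patterns -/

theorem pmf_ext_toReal {α : Type} {μ ν : PMF α} (h : ∀ a, (μ a).toReal = (ν a).toReal) : μ = ν :=
  PMF.ext fun a =>
    (ENNReal.toReal_eq_toReal_iff' (PMF.apply_ne_top _ _) (PMF.apply_ne_top _ _)).1 (h a)

theorem sum_prod_ite {R ι : Type} [CommSemiring R] [Fintype ι] [DecidableEq ι] (a b : ι → R) :
    ∑ E : Finset ι, ∏ l, (if l ∈ E then a l else b l) = ∏ l, (a l + b l) := by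
  rw [Finset.prod_add, Finset.powerset_univ]
  refine Finset.sum_congr rfl fun E _ => ?_
  rw [Finset.prod_ite]
  congr 2
  · ext l; simp
  · ext l; simp

/-- The law of the set of erased positions of `n` uses of a binary erasure channel. -/
def erasureLaw (p : unitInterval) (n : ℕ) : PMF (Finset (Fin n)) :=
  PMF.ofFintype
    (fun E => ∏ l, if l ∈ E then ENNReal.ofReal p else ENNReal.ofReal (1 - (p : ℝ))) (by
    rw [sum_prod_ite, Finset.prod_eq_one]
    intro l _
    rw [← ENNReal.ofReal_add p.2.1 (sub_nonneg.2 p.2.2)]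
    simp)

theorem erasureLaw_toReal (p : unitInterval) (n : ℕ) (E : Finset (Fin n)) :
    (erasureLaw p n E).toReal = ∏ l, if l ∈ E then (p : ℝ) else 1 - p := by
  rw [erasureLaw, PMF.ofFintype_apply, ENNReal.toReal_prod]
  refine Finset.prod_congr rfl fun l _ => ?_
  split_ifs
  · exact ENNReal.toReal_ofReal p.2.1
  · exact ENNReal.toReal_ofReal (sub_nonneg.2 p.2.2)

/-- Independence of the erasures. Factors 0 and 1 yield probabilities of single erasures; powers
yield moment generating functions of counts. -/
theorem expect_erasureLaw_prod (p : unitInterval) (n : ℕ) (a b : Fin n → ℝ) :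
    (expect (erasureLaw p n) fun E => ∏ l, if l ∈ E then a l else b l) =
      ∏ l, (p * a l + (1 - p) * b l) := by
  rw [← sum_prod_ite, expect]
  refine Finset.sum_congr rfl fun E _ => ?_
  rw [erasureLaw_toReal, ← Finset.prod_mul_distrib]
  refine Finset.prod_congr rfl fun l _ => ?_
  split_ifs <;> ring

/-- A pattern with e erasures has weight p^e (1 - p)^(n - e). This is why a receiver may exchange
erased for received positions unnoticed. -/
theorem erasureLaw_congr_card (p : unitInterval) (n : ℕ) {E E' : Finset (Fin n)}
    (h : E.card = E'.card) : erasureLaw p n E = erasureLaw p n E' := by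
  simp only [erasureLaw, PMF.ofFintype_apply, Finset.prod_ite, Finset.prod_const,
    Finset.filter_univ_mem]
  have : ∀ E : Finset (Fin n), (Finset.univ.filter fun l => l ∉ E) = Eᶜ := fun E => by ext; simp
  rw [this, this, Finset.card_compl, Finset.card_compl, h]

/-- The channel output when `x` is sent and the positions in `E` are erased. -/
def observe {n : ℕ} (x : Fin n → Bool) (E : Finset (Fin n)) : Fin n → Option Bool :=
  fun l => if l ∈ E then none else some (x l)

theorem erased_observe {n : ℕ} (x : Fin n → Bool) (E : Finset (Fin n)) :
    erased (observe x E) = E := by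
  ext l
  simp [erased, observe]

theorem received_observe {n : ℕ} (x : Fin n → Bool) (E : Finset (Fin n)) :
    received (observe x E) = Eᶜ := by
  ext l
  simp [received, observe]

theorem observe_congr {n : ℕ} {x x' : Fin n → Bool} {E : Finset (Fin n)}
    (h : ∀ l ∉ E, x l = x' l) : observe x E = observe x' E := by
  funext l
  by_cases hl : l ∈ E
  · simp [observe, hl]
  · simp [observe, hl, h l hl]

/-- The pattern can be drawn without looking at the input, since an output word determines its own
pattern and has positive weight only if it agrees with `x` elsewhere. -/
theorem bec_word (p : unitInterval) {n : ℕ} (x : Fin n → Bool) :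
    (prodPMF fun l => bec p (x l)) = (erasureLaw p n).map (observe x) := by
  refine pmf_ext_toReal fun y => ?_
  rw [toReal_map]
  have hL : ((prodPMF fun l => bec p (x l)) y).toReal = ∏ l, (bec p (x l) (y l)).toReal := by
    rw [prodPMF, PMF.ofFintype_apply, ENNReal.toReal_prod]
  rw [hL]
  by_cases h : y = observe x (erased y)
  · rw [expect, Finset.sum_eq_single (erased y)]
    · rw [ind_of h.symm, mul_one, erasureLaw_toReal]
      refine Finset.prod_congr rfl fun l _ => ?_
      by_cases hl : l ∈ erased y
      · have : y l = none := by rw [h]; simp [observe, hl]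
        simp [this, bec, hl, p.2.1]
      · have : y l = some (x l) := by rw [h]; simp [observe, hl]
        simp [this, bec, hl, p.2.2]
    · intro E _ hE
      rw [ind_of_not, mul_zero]
      rintro rfl
      exact hE (erased_observe x E).symm
    · simp
  · have h0 : ∀ E, observe x E ≠ y := by
      rintro E rfl
      exact h (by rw [erased_observe])
    simp only [ind_of_not (h0 _), expect_const]
    obtain ⟨l, hl⟩ := Function.ne_iff.1 h
    refine Finset.prod_eq_zero (Finset.mem_univ l) ?_
    cases hy : y l with
    | none => exact absurd (by simp [observe, erased, hy]) hl
    | some b =>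
      have : b ≠ x l := by
        rintro rfl
        exact hl (by simp [observe, erased, hy])
      simp [bec, this]

theorem other_ne (f : Fin 2) : other f ≠ f := by fin_cases f <;> decide

theorem other_other (f : Fin 2) : other (other f) = f := by fin_cases f <;> decide

theorem eq_or_eq_other (f i : Fin 2) : i = f ∨ i = other f := by
  fin_cases f <;> fin_cases i <;> decide

theorem eq_other_of_ne {f i : Fin 2} (h : i ≠ f) : i = other f :=
  (eq_or_eq_other f i).resolve_left h

theorem prodPMF_two {α : Type} [Fintype α] (q : Fin 2 → PMF α) (f : Fin 2) :
    prodPMF q = (q f).bind fun a => (q (other f)).bind fun b =>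
      PMF.pure fun i => if i = f then a else b := by
  refine pmf_ext_toReal fun y => ?_
  simp only [toReal_bind, toReal_pure]
  have h : ∀ a b, ind ((fun i => if i = f then a else b) = y) =
      ind (a = y f) * ind (b = y (other f)) := by
    intro a b
    by_cases h1 : a = y f
    · by_cases h2 : b = y (other f)
      · rw [ind_of h1, ind_of h2, ind_of, one_mul]
        funext i
        rcases eq_or_eq_other f i with rfl | rfl
        · simp [h1]
        · simp [h2, other_ne]
      · rw [ind_of_not h2, ind_of_not, mul_zero]
        rintro rfl
        simp [other_ne] at h2
    · rw [ind_of_not h1, ind_of_not, zero_mul]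
      rintro rfl
      simp at h1
  simp only [h, expect_mul_left, expect_mul_right, expect_ind_eq]
  rw [prodPMF, PMF.ofFintype_apply, ENNReal.toReal_prod, Fin.prod_univ_two]
  fin_cases f
  · rfl
  · exact mul_comm _ _

theorem channel_eq (p : Fin 2 → unitInterval) {n : ℕ} (x : Fin n → Bool) (f : Fin 2) :
    channel p x = (erasureLaw (p f) n).bind fun E => (erasureLaw (p (other f)) n).bind fun E' =>
      PMF.pure fun i => observe x (if i = f then E else E') := by
  rw [channel, prodPMF_two _ f]
  simp only [bec_word, PMF.bind_map, Function.comp_def]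
  congr 1
  funext E
  congr 1
  funext E'
  congr 1
  funext i
  split_ifs <;> rfl

/-! ### The random draws behind a run -/

/-- The erasure patterns `E`, `E'` of the receiver served first and of the other one, and the sets
which they draw. -/
structure Draws (n : ℕ) where
  E : Finset (Fin n)
  E' : Finset (Fin n)
  A : Finset (Fin n)
  A' : Finset (Fin n)
  L : Finset (Fin n)
  D : Finset (Fin n)
  D' : Finset (Fin n)

instance (n : ℕ) : Fintype (Draws n) :=
  Fintype.ofInjective (fun d : Draws n => (d.E, d.E', d.A, d.A', d.L, d.D, d.D')) (by
    rintro ⟨⟩ ⟨⟩ h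
    simpa using h)

/-- The law of the draws; it does not involve the choice bits. -/
def drawsLaw (p : Fin 2 → unitInterval) (f : Fin 2) (B : Sizes) : PMF (Draws B.n) :=
  (erasureLaw (p f) B.n).bind fun E =>
  (erasureLaw (p (other f)) B.n).bind fun E' =>
  (uniformSubset Eᶜ (B.s f)).bind fun A =>
  (uniformSubset E (B.s f)).bind fun A' =>
  (if Eᶜ.card < B.s f ∨ E.card < B.s f + B.left then PMF.pure ∅
    else uniformSubset (E \ A') B.left).bind fun L =>
  (uniformSubset (E'ᶜ ∩ L) (B.s (other f))).bind fun D =>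
  (uniformSubset (E' ∩ L) (B.s (other f))).bind fun D' =>
  PMF.pure ⟨E, E', A, A', L, D, D'⟩

/-- Strings, hash functions, channel inputs and draws. -/
abbrev Base (B : Sizes) : Type := Strings B.k × Hashes B × (Fin B.n → Bool) × Draws B.n

/-- The families from which the hash functions of a run are drawn. -/
def hashFinset (H : (s k : ℕ) → TwoUniversal s k) (B : Sizes) : Finset (Hashes B) :=
  Fintype.piFinset fun i => Fintype.piFinset fun _ : Bool => (H (B.s i) (B.k i)).funs

theorem hashFinset_nonempty (H : (s k : ℕ) → TwoUniversal s k) (B : Sizes) :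
    (hashFinset H B).Nonempty :=
  Fintype.piFinset_nonempty.2 fun i => Fintype.piFinset_nonempty.2 fun _ =>
    (H (B.s i) (B.k i)).nonempty

/-- The joint law of strings, hash functions, channel inputs and draws. -/
def baseLaw (H : (s k : ℕ) → TwoUniversal s k) (p : Fin 2 → unitInterval) (f : Fin 2)
    (B : Sizes) : PMF (Base B) :=
  (PMF.uniformOfFintype (Strings B.k)).bind fun msg =>
  (PMF.uniformOfFinset (hashFinset H B) (hashFinset_nonempty H B)).bind fun hash =>
  (PMF.uniformOfFintype (Fin B.n → Bool)).bind fun x =>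
  (drawsLaw p f B).bind fun d => PMF.pure (msg, hash, x, d)

/-- The index sets that are announced. -/
def Draws.sel {n : ℕ} (d : Draws n) (f : Fin 2) (z : Fin 2 → Bool) :
    Fin 2 → Bool → Finset (Fin n) :=
  fun i b => if i = f then (if b = z i then d.A else d.A') else (if b = z i then d.D else d.D')

/-- The erasure patterns by receivers. -/
def Draws.pattern {n : ℕ} (d : Draws n) (f i : Fin 2) : Finset (Fin n) :=
  if i = f then d.E else d.E'

/-- The run determined by choice bits, strings, hash functions, channel inputs and draws. -/
def mkRun {B : Sizes} (f : Fin 2) (z : Fin 2 → Bool) (a : Base B) : Run B where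
  msg := a.1
  hash := a.2.1
  x := a.2.2.1
  y := fun i => observe a.2.2.1 (a.2.2.2.pattern f i)
  sel := a.2.2.2.sel f z
  left := a.2.2.2.L

/-- All draws refer to erasure patterns only; the choice bits merely decide which label each drawn
set receives. -/
theorem runLaw_eq (H : (s k : ℕ) → TwoUniversal s k) (p : Fin 2 → unitInterval) (f : Fin 2)
    (B : Sizes) (z : Fin 2 → Bool) :
    runLaw H p f B z = (baseLaw H p f B).map (mkRun f z) := by
  simp only [runLaw, baseLaw, drawsLaw, PMF.map_bind, PMF.bind_bind, PMF.pure_bind, PMF.pure_map,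
    channel_eq p _ f, if_pos, received_observe, erased_observe, if_neg (other_ne f)]
  rfl

/-- Choice bits and the data behind the two runs. -/
abbrev BaseOutcome (P : Shared) : Type := (Fin 2 → Bool) × Base P.a × Base P.b

/-- The law of choice bits and the data behind the two runs. -/
def outcomeLaw (H : (s k : ℕ) → TwoUniversal s k) (p : Fin 2 → unitInterval) (P : Shared) :
    PMF (BaseOutcome P) :=
  (PMF.uniformOfFintype (Fin 2 → Bool)).bind fun z =>
  (baseLaw H p 0 P.a).bind fun a => (baseLaw H p 1 P.b).bind fun b => PMF.pure (z, a, b)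

/-- The outcome of the shared protocol determined by the choice bits and the data behind the two
runs. -/
def mkOutcome {P : Shared} (ω : BaseOutcome P) : P.Outcome :=
  (ω.1, mkRun 0 ω.1 ω.2.1, mkRun 1 ω.1 ω.2.2)

theorem law_eq (H : (s k : ℕ) → TwoUniversal s k) (p : Fin 2 → unitInterval) (P : Shared) :
    P.law H p = (outcomeLaw H p P).map mkOutcome := by
  simp only [Shared.law, outcomeLaw, runLaw_eq, PMF.map_bind, PMF.bind_map, PMF.pure_map,
    Function.comp_def]
  rfl

/-! ### Properties of the draws -/

theorem uniformSubset_support {α : Type} {T : Finset α} {m : ℕ} {A : Finset α}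
    (h : A ∈ (uniformSubset T m).support) :
    A ⊆ T ∧ A.card ≤ m ∧ (m ≤ T.card → A.card = m) := by
  rw [uniformSubset] at h
  split_ifs at h with hm
  · rw [PMF.mem_support_uniformOfFinset_iff, Finset.mem_powersetCard] at h
    exact ⟨h.1, h.2.le, fun _ => h.2⟩
  · rw [PMF.mem_support_pure_iff] at h
    subst h
    simp [hm]

/-- The receiver served first cannot form his sets. -/
def Draws.Abort₁ {n : ℕ} (d : Draws n) (s left : ℕ) : Prop :=
  d.Eᶜ.card < s ∨ d.E.card < s + left

/-- The other receiver cannot form his sets. -/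
def Draws.Abort₂ {n : ℕ} (d : Draws n) (s : ℕ) : Prop :=
  (d.E'ᶜ ∩ d.L).card < s ∨ (d.E' ∩ d.L).card < s

/-- The relations between the draws that hold with probability one. -/
structure Draws.Valid {n : ℕ} (d : Draws n) (s left s' : ℕ) : Prop where
  A_sub : d.A ⊆ d.Eᶜ
  A'_sub : d.A' ⊆ d.E
  L_sub : d.L ⊆ d.E \ d.A'
  D_sub : d.D ⊆ d.E'ᶜ ∩ d.L
  D'_sub : d.D' ⊆ d.E' ∩ d.L
  A_le : d.A.card ≤ s
  A'_le : d.A'.card ≤ s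
  L_le : d.L.card ≤ left
  D_le : d.D.card ≤ s'
  D'_le : d.D'.card ≤ s'
  A_card : ¬d.Abort₁ s left → d.A.card = s
  A'_card : ¬d.Abort₁ s left → d.A'.card = s
  L_card : ¬d.Abort₁ s left → d.L.card = left
  D_card : ¬d.Abort₂ s' → d.D.card = s'
  D'_card : ¬d.Abort₂ s' → d.D'.card = s'

theorem drawsLaw_valid {p : Fin 2 → unitInterval} {f : Fin 2} {B : Sizes} {d : Draws B.n}
    (h : d ∈ (drawsLaw p f B).support) : d.Valid (B.s f) B.left (B.s (other f)) := by
  simp only [drawsLaw, PMF.mem_support_bind_iff, PMF.mem_support_pure_iff] at h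
  obtain ⟨E, -, E', -, A, hA, A', hA', L, hL, D, hD, D', hD', rfl⟩ := h
  have h1 := uniformSubset_support hA
  have h2 := uniformSubset_support hA'
  have h3 := uniformSubset_support hD
  have h4 := uniformSubset_support hD'
  have h5 : L ⊆ E \ A' ∧ L.card ≤ B.left ∧
      (¬(Eᶜ.card < B.s f ∨ E.card < B.s f + B.left) → L.card = B.left) := by
    split_ifs at hL with hab
    · rw [PMF.mem_support_pure_iff] at hL
      subst hL
      simp [hab]
    · have h6 := uniformSubset_support hL
      refine ⟨h6.1, h6.2.1, fun _ => h6.2.2 ?_⟩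
      rw [Finset.card_sdiff_of_subset h2.1, h2.2.2 (by omega)]
      omega
  exact
    { A_sub := h1.1
      A'_sub := h2.1
      L_sub := h5.1
      D_sub := h3.1
      D'_sub := h4.1
      A_le := h1.2.1
      A'_le := h2.2.1
      L_le := h5.2.1
      D_le := h3.2.1
      D'_le := h4.2.1
      A_card := fun h => h1.2.2 (by simp only [Draws.Abort₁] at h; omega)
      A'_card := fun h => h2.2.2 (by simp only [Draws.Abort₁] at h; omega)
      L_card := h5.2.2
      D_card := fun h => h3.2.2 (by simp only [Draws.Abort₂] at h; omega)
      D'_card := fun h => h4.2.2 (by simp only [Draws.Abort₂] at h; omega) }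

theorem baseLaw_valid {H : (s k : ℕ) → TwoUniversal s k} {p : Fin 2 → unitInterval} {f : Fin 2}
    {B : Sizes} {a : Base B} (h : a ∈ (baseLaw H p f B).support) :
    a.2.2.2.Valid (B.s f) B.left (B.s (other f)) := by
  simp only [baseLaw, PMF.mem_support_bind_iff, PMF.mem_support_pure_iff] at h
  obtain ⟨msg, -, hash, -, x, -, d, hd, rfl⟩ := h
  exact drawsLaw_valid hd

theorem outcomeLaw_support {H : (s k : ℕ) → TwoUniversal s k} {p : Fin 2 → unitInterval}
    {P : Shared} {ω : BaseOutcome P} (h : ω ∈ (outcomeLaw H p P).support) :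
    ω.2.1 ∈ (baseLaw H p 0 P.a).support ∧ ω.2.2 ∈ (baseLaw H p 1 P.b).support := by
  simp only [outcomeLaw, PMF.mem_support_bind_iff, PMF.mem_support_pure_iff] at h
  obtain ⟨z, -, a, ha, b, hb, rfl⟩ := h
  exact ⟨ha, hb⟩

theorem abort₁_mkRun {B : Sizes} (f : Fin 2) (z : Fin 2 → Bool) (a : Base B) :
    (mkRun f z a).Abort₁ f ↔ a.2.2.2.Abort₁ (B.s f) B.left := by
  simp [Run.Abort₁, mkRun, Draws.Abort₁, Draws.pattern, erased_observe, received_observe]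

theorem abort₂_mkRun {B : Sizes} (f : Fin 2) (z : Fin 2 → Bool) (a : Base B) :
    (mkRun f z a).Abort₂ f ↔ a.2.2.2.Abort₂ (B.s (other f)) := by
  simp [Run.Abort₂, mkRun, Draws.Abort₂, Draws.pattern, erased_observe, received_observe,
    other_ne]

theorem Draws.Valid.sel_subset {n : ℕ} {d : Draws n} {s left s' : ℕ} (h : d.Valid s left s')
    (f : Fin 2) (z : Fin 2 → Bool) (i : Fin 2) : d.sel f z i (z i) ⊆ (d.pattern f i)ᶜ := by
  by_cases hi : i = f
  · simpa [Draws.sel, Draws.pattern, hi] using h.A_sub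
  · simpa [Draws.sel, Draws.pattern, hi] using h.D_sub.trans Finset.inter_subset_left

theorem Draws.Valid.sel_not_subset {n : ℕ} {d : Draws n} {s left s' : ℕ} (h : d.Valid s left s')
    (f : Fin 2) (z : Fin 2 → Bool) (i : Fin 2) : d.sel f z i (!z i) ⊆ d.pattern f i := by
  by_cases hi : i = f
  · simpa [Draws.sel, Draws.pattern, hi] using h.A'_sub
  · simpa [Draws.sel, Draws.pattern, hi] using h.D'_sub.trans Finset.inter_subset_left

/-- `A` lies outside `E`, `A'` inside `E`, and `L` inside `E` but off `A'`; `D` and `D'` lie in `L`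
and are separated by `E'`. Hence the four keys read different input bits. -/
theorem Draws.Valid.sel_disjoint {n : ℕ} {d : Draws n} {s left s' : ℕ} (h : d.Valid s left s')
    (f : Fin 2) (z : Fin 2 → Bool) {i i' : Fin 2} {b b' : Bool} (hne : (i, b) ≠ (i', b')) :
    Disjoint (d.sel f z i b) (d.sel f z i' b') := by
  have hA := h.A_sub
  have hA' := h.A'_sub
  have hL := h.L_sub
  have hD := h.D_sub
  have hD' := h.D'_sub
  have q : ∀ l, (l ∈ d.A → l ∉ d.E) ∧ (l ∈ d.A' → l ∈ d.E) ∧ (l ∈ d.L → l ∈ d.E ∧ l ∉ d.A') ∧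
      (l ∈ d.D → l ∉ d.E' ∧ l ∈ d.L) ∧ (l ∈ d.D' → l ∈ d.E' ∧ l ∈ d.L) := fun l =>
    ⟨fun h => by simpa using hA h, fun h => hA' h, fun h => by simpa using hL h,
      fun h => by simpa using hD h, fun h => by simpa using hD' h⟩
  rw [Finset.disjoint_left]
  intro l h1 h2
  have q := q l
  simp only [Draws.sel] at h1 h2
  by_cases hi : i = f <;> by_cases hi' : i' = f <;> simp only [hi, hi', if_true, if_false] at h1 h2
  · subst hi; subst hi'
    split_ifs at h1 h2 with c1 c2
    · exact hne (by rw [c1, c2])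
    · tauto
    · tauto
    · rename_i c2
      exact hne (by rw [Bool.eq_not.2 c1, Bool.eq_not.2 c2])
  · split_ifs at h1 h2 <;> tauto
  · split_ifs at h1 h2 <;> tauto
  · have e1 := eq_other_of_ne hi
    have e2 := eq_other_of_ne hi'
    subst e1; subst e2
    split_ifs at h1 h2 with c1 c2
    · exact hne (by rw [c1, c2])
    · tauto
    · tauto
    · rename_i c2
      exact hne (by rw [Bool.eq_not.2 c1, Bool.eq_not.2 c2])

/-! ### Dependence of the views on the run -/

theorem subword_congr {n : ℕ} {x x' : Fin n → Bool} {A : Finset (Fin n)} (s : ℕ)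
    (h : ∀ l ∈ A, x l = x' l) : subword x A s = subword x' A s := by
  funext j
  simp only [subword]
  split_ifs with hj
  · exact h _ (Finset.orderEmbOfFin_mem A rfl ⟨j, hj⟩)
  · rfl

theorem subword_injOn {n : ℕ} {x x' : Fin n → Bool} {A : Finset (Fin n)} {s : ℕ}
    (hs : A.card ≤ s) (h : subword x A s = subword x' A s) : ∀ l ∈ A, x l = x' l := by
  intro l hl
  have : l ∈ Set.range (A.orderEmbOfFin rfl) := by simpa using hl
  obtain ⟨j, rfl⟩ := this
  have := congrFun h ⟨j, j.2.trans_le hs⟩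
  simpa [subword] using this

theorem transcript_congr {B : Sizes} (f : Fin 2) {ω ω' : Run B} (hsel : ω.sel = ω'.sel)
    (hleft : ω.left = ω'.left) (hhash : ω.hash = ω'.hash)
    (hcipher : ω.cipher = ω'.cipher) (hr : ∀ j, received (ω.y j) = received (ω'.y j))
    (he : ∀ j, erased (ω.y j) = erased (ω'.y j)) : ω.transcript f = ω'.transcript f := by
  have h1 : ω.Abort₁ f ↔ ω'.Abort₁ f := by simp [Run.Abort₁, hr, he]
  have h2 : ω.Abort₂ f ↔ ω'.Abort₂ f := by simp [Run.Abort₂, hr, he, hleft]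
  by_cases c1 : ω.Abort₁ f
  · simp [Run.transcript, c1, h1.1 c1]
  · by_cases c2 : ω.Abort₂ f
    · simp [Run.transcript, c1, mt h1.2 c1, c2, h2.1 c2, Run.publicPart, hsel, hhash, hcipher,
        hleft]
    · simp [Run.transcript, c1, mt h1.2 c1, c2, mt h2.2 c2, Run.publicPart, hsel, hhash, hcipher,
        hleft]

theorem bobView_congr {B : Sizes} (f i : Fin 2) {ω ω' : Run B} (hsel : ω.sel = ω'.sel)
    (hleft : ω.left = ω'.left) (hhash : ω.hash = ω'.hash)
    (hcipher : ω.cipher = ω'.cipher) (hr : ∀ j, received (ω.y j) = received (ω'.y j))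
    (he : ∀ j, erased (ω.y j) = erased (ω'.y j)) (hy : ω.y i = ω'.y i) :
    ω.bobView f i = ω'.bobView f i := by
  simp only [Run.bobView, transcript_congr f hsel hleft hhash hcipher hr he, hsel, hleft, hy]

/-- The positions that carry the key `κ_{ib}(x|_{S_{ib}})` and are erased for the other
receiver. -/
def Draws.hidden {n : ℕ} (d : Draws n) (f : Fin 2) (z : Fin 2 → Bool) (i : Fin 2) (b : Bool) :
    Finset (Fin n) :=
  d.sel f z i b ∩ d.pattern f (other i)

/-- The second phase takes place inside `L`, all of which is erased for the receiver served first,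
so nothing is lost by intersecting with his pattern. -/
theorem Draws.Valid.hidden_other {n : ℕ} {d : Draws n} {s left s' : ℕ} (h : d.Valid s left s')
    (f : Fin 2) (z : Fin 2 → Bool) (b : Bool) :
    d.hidden f z (other f) b = if b = z (other f) then d.D else d.D' := by
  have hL : d.L ⊆ d.E := h.L_sub.trans Finset.sdiff_subset
  simp only [Draws.hidden, Draws.sel, Draws.pattern, other_other, if_neg (other_ne f), if_true]
  rw [Finset.inter_eq_left]
  split_ifs
  · exact h.D_sub.trans (Finset.inter_subset_right.trans hL)
  · exact h.D'_sub.trans (Finset.inter_subset_right.trans hL)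

theorem Draws.hidden_first {n : ℕ} (d : Draws n) (f : Fin 2) (z : Fin 2 → Bool) (b : Bool) :
    d.hidden f z f b = (if b = z f then d.A else d.A') ∩ d.E' := by
  simp [Draws.hidden, Draws.sel, Draws.pattern, other_ne]

/-! ### Marginals and resampling -/

theorem expect_baseLaw (H : (s k : ℕ) → TwoUniversal s k) (p : Fin 2 → unitInterval) (f : Fin 2)
    (B : Sizes) (F : Base B → ℝ) :
    expect (baseLaw H p f B) F =
      expect (PMF.uniformOfFintype (Strings B.k)) fun msg =>
      expect (PMF.uniformOfFinset (hashFinset H B) (hashFinset_nonempty H B)) fun hash =>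
      expect (PMF.uniformOfFintype (Fin B.n → Bool)) fun x =>
      expect (drawsLaw p f B) fun d => F (msg, hash, x, d) := by
  simp only [baseLaw, expect_bind, expect_pure]

theorem expect_baseLaw_draws (H : (s k : ℕ) → TwoUniversal s k) (p : Fin 2 → unitInterval)
    (f : Fin 2) (B : Sizes) (F : Draws B.n → ℝ) :
    (expect (baseLaw H p f B) fun a => F a.2.2.2) = expect (drawsLaw p f B) F := by
  simp only [expect_baseLaw, expect_const]

theorem expect_baseLaw_msg (H : (s k : ℕ) → TwoUniversal s k) (p : Fin 2 → unitInterval)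
    (f : Fin 2) (B : Sizes) (F : Strings B.k → ℝ) :
    (expect (baseLaw H p f B) fun a => F a.1) =
      expect (PMF.uniformOfFintype (Strings B.k)) F := by
  simp only [expect_baseLaw, expect_const]

theorem expect_update_piFinset {ι : Type} [Fintype ι] [DecidableEq ι] {δ : ι → Type}
    [∀ i, Fintype (δ i)] (s : ∀ i, Finset (δ i)) (hs : ∀ i, (s i).Nonempty) (i : ι)
    (G : (∀ i, δ i) → ℝ) :
    (expect (PMF.uniformOfFinset (Fintype.piFinset s) (Fintype.piFinset_nonempty.2 hs)) fun g =>
      expect (PMF.uniformOfFinset (s i) (hs i)) fun a => G (Function.update g i a)) =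
    expect (PMF.uniformOfFinset (Fintype.piFinset s) (Fintype.piFinset_nonempty.2 hs)) G := by
  simp only [expect_uniformOfFinset]
  congr 1
  rw [← Finset.sum_div, div_eq_iff (by exact_mod_cast (Finset.card_pos.2 (hs i)).ne'),
    ← Finset.sum_product']
  have : (∑ g ∈ Fintype.piFinset s, G g) * ((s i).card : ℝ) =
      ∑ x ∈ Fintype.piFinset s ×ˢ s i, G x.1 := by
    rw [Finset.sum_product, Finset.sum_mul]
    exact Finset.sum_congr rfl fun g _ => by simp [mul_comm]
  rw [this]
  -- Interchanging the `i`-th coordinate with the fresh sample is an involution of the pairs.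
  refine Finset.sum_nbij' (fun x => (Function.update x.1 i x.2, x.1 i))
    (fun x => (Function.update x.1 i x.2, x.1 i)) ?_ ?_ ?_ ?_ ?_
  · rintro ⟨g, a⟩ h
    simp only [Finset.mem_product, Fintype.mem_piFinset] at h ⊢
    refine ⟨fun j => ?_, h.1 i⟩
    by_cases hj : j = i
    · subst hj; simpa using h.2
    · simpa [hj] using h.1 j
  · rintro ⟨g, a⟩ h
    simp only [Finset.mem_product, Fintype.mem_piFinset] at h ⊢
    refine ⟨fun j => ?_, h.1 i⟩
    by_cases hj : j = i
    · subst hj; simpa using h.2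
    · simpa [hj] using h.1 j
  · rintro ⟨g, a⟩ _
    simp
  · rintro ⟨g, a⟩ _
    simp
  · rintro ⟨g, a⟩ _
    rfl

/-- Replaces one entry of a doubly indexed family. -/
def setEntry {δ : Fin 2 → Type} (g : ∀ i, Bool → δ i) (i : Fin 2) (b : Bool) (a : δ i) :
    ∀ i, Bool → δ i :=
  Function.update g i (Function.update (g i) b a)

theorem setEntry_same {δ : Fin 2 → Type} (g : ∀ i, Bool → δ i) (i : Fin 2) (b : Bool) (a : δ i) :
    setEntry g i b a i b = a := by simp [setEntry]

theorem setEntry_ne {δ : Fin 2 → Type} (g : ∀ i, Bool → δ i) {i i' : Fin 2} {b b' : Bool}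
    (h : (i, b) ≠ (i', b')) (a : δ i) : setEntry g i b a i' b' = g i' b' := by
  by_cases hi : i' = i
  · subst hi
    have hb : b' ≠ b := fun hb => h (by rw [hb])
    simp [setEntry, hb]
  · simp [setEntry, hi]

theorem setEntry_setEntry {δ : Fin 2 → Type} (g : ∀ i, Bool → δ i) (i : Fin 2) (b : Bool)
    (a a' : δ i) : setEntry (setEntry g i b a) i b a' = setEntry g i b a' := by
  simp [setEntry]

theorem expect_setEntry {δ : Fin 2 → Type} [∀ i, Fintype (δ i)] (s : ∀ i, Finset (δ i))
    (hs : ∀ i, (s i).Nonempty)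
    (hs' : (Fintype.piFinset fun i => Fintype.piFinset fun _ : Bool => s i).Nonempty)
    (i : Fin 2) (b : Bool) (G : (∀ i, Bool → δ i) → ℝ) :
    (expect (PMF.uniformOfFinset _ hs') fun g =>
      expect (PMF.uniformOfFinset (s i) (hs i)) fun a => G (setEntry g i b a)) =
    expect (PMF.uniformOfFinset _ hs') G := by
  have h1 : ∀ i, (Fintype.piFinset fun _ : Bool => s i).Nonempty := fun i =>
    Fintype.piFinset_nonempty.2 fun _ => hs i
  rw [← expect_update_piFinset (fun i => Fintype.piFinset fun _ : Bool => s i) h1 i G]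
  have h2 := fun g => expect_update_piFinset (fun _ : Bool => s i) (fun _ => hs i) b
    fun r => G (Function.update g i r)
  rw [← expect_update_piFinset (fun i => Fintype.piFinset fun _ : Bool => s i) h1 i fun g =>
    expect (PMF.uniformOfFinset (s i) (hs i)) fun a => G (setEntry g i b a)]
  simp only [← h2, setEntry, Function.update_self, Function.update_idem]

theorem expect_setEntry_msg (k : Fin 2 → ℕ) (i : Fin 2) (b : Bool) (G : Strings k → ℝ) :
    (expect (PMF.uniformOfFintype (Strings k)) fun g =>
      expect (PMF.uniformOfFintype (Fin (k i) → Bool)) fun a => G (setEntry g i b a)) =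
    expect (PMF.uniformOfFintype (Strings k)) G := by
  have e : (Finset.univ : Finset (Strings k)) =
      Fintype.piFinset fun i => Fintype.piFinset fun _ : Bool => Finset.univ := by simp
  have key := expect_setEntry (fun i => (Finset.univ : Finset (Fin (k i) → Bool)))
    (fun _ => Finset.univ_nonempty) (by rw [← e]; exact Finset.univ_nonempty) i b G
  simp only [← e] at key
  exact key

theorem pr_msg (k : Fin 2 → ℕ) (i : Fin 2) (b : Bool) (m : Fin (k i) → Bool) :
    (expect (PMF.uniformOfFintype (Strings k)) fun g => ind (g i b = m)) = 1 / 2 ^ (k i) := by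
  rw [← expect_setEntry_msg k i b]
  simp only [setEntry_same, expect_ind_eq, uniformOfFintype_toReal, expect_const]
  simp

/-- The draws of the receiver served first. -/
def firstDraws (p : Fin 2 → unitInterval) (f : Fin 2) (B : Sizes) :
    PMF (Finset (Fin B.n) × Finset (Fin B.n) × Finset (Fin B.n) × Finset (Fin B.n)) :=
  (erasureLaw (p f) B.n).bind fun E =>
  (uniformSubset Eᶜ (B.s f)).bind fun A =>
  (uniformSubset E (B.s f)).bind fun A' =>
  (if Eᶜ.card < B.s f ∨ E.card < B.s f + B.left then PMF.pure ∅
    else uniformSubset (E \ A') B.left).bind fun L => PMF.pure (E, A, A', L)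

/-- The receiver served first never looks at `E'`, so `E'` may be drawn after all of his sets. -/
theorem drawsLaw_eq (p : Fin 2 → unitInterval) (f : Fin 2) (B : Sizes) :
    drawsLaw p f B = (firstDraws p f B).bind fun q =>
      (erasureLaw (p (other f)) B.n).bind fun E' =>
      (uniformSubset (E'ᶜ ∩ q.2.2.2) (B.s (other f))).bind fun D =>
      (uniformSubset (E' ∩ q.2.2.2) (B.s (other f))).bind fun D' =>
      PMF.pure ⟨q.1, E', q.2.1, q.2.2.1, q.2.2.2, D, D'⟩ := by
  simp only [drawsLaw, firstDraws, PMF.bind_bind, PMF.pure_bind]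
  congr 1
  funext E
  rw [PMF.bind_comm]
  congr 1
  funext A
  rw [PMF.bind_comm]
  congr 1
  funext A'
  rw [PMF.bind_comm]

/-- The part of the draws made by the receiver served first. -/
def Draws.first {n : ℕ} (d : Draws n) :
    Finset (Fin n) × Finset (Fin n) × Finset (Fin n) × Finset (Fin n) :=
  (d.E, d.A, d.A', d.L)

theorem expect_drawsLaw (p : Fin 2 → unitInterval) (f : Fin 2) (B : Sizes)
    (F : Finset (Fin B.n) × Finset (Fin B.n) × Finset (Fin B.n) × Finset (Fin B.n) →
      Finset (Fin B.n) → ℝ) :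
    (expect (drawsLaw p f B) fun d => F d.first d.E') =
      expect (firstDraws p f B) fun q =>
        expect (erasureLaw (p (other f)) B.n) fun E' => F q E' := by
  simp only [drawsLaw_eq, expect_bind, expect_pure, Draws.first, expect_const]

/-- The erasures of the receiver served last are independent of the first draws. -/
theorem expect_drawsLaw_indep (p : Fin 2 → unitInterval) (f : Fin 2) (B : Sizes)
    (F : Finset (Fin B.n) × Finset (Fin B.n) × Finset (Fin B.n) × Finset (Fin B.n) →
      Finset (Fin B.n) → ℝ) :
    (expect (drawsLaw p f B) fun d => F d.first d.E') =
      expect (drawsLaw p f B) fun d =>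
        expect (erasureLaw (p (other f)) B.n) fun E' => F d.first E' := by
  rw [expect_drawsLaw, expect_drawsLaw p f B fun q _ =>
    expect (erasureLaw (p (other f)) B.n) fun E' => F q E']
  simp only [expect_const]

theorem expect_drawsLaw_E (p : Fin 2 → unitInterval) (f : Fin 2) (B : Sizes)
    (F : Finset (Fin B.n) → ℝ) :
    (expect (drawsLaw p f B) fun d => F d.E) = expect (erasureLaw (p f) B.n) F := by
  simp only [drawsLaw, expect_bind, expect_pure, expect_const]

theorem expect_mem_erasureLaw (p : unitInterval) {n : ℕ} (l : Fin n) :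
    (expect (erasureLaw p n) fun E => ind (l ∈ E)) = p := by
  -- The product with a zero factor for `l` not erased is the indicator of `l ∈ E`.
  have h := expect_erasureLaw_prod p n (fun _ => 1) (fun l' => if l' = l then 0 else 1)
  rw [Finset.prod_eq_single l (fun l' _ hl' => by simp [hl']) (by simp)] at h
  simp only [if_true, mul_one, mul_zero, add_zero] at h
  rw [← h]
  refine expect_congr_on fun E _ => ?_
  by_cases hl : l ∈ E
  · rw [ind_of hl, Finset.prod_eq_one]
    intro l' _
    split_ifs with h1 h2
    · rfl
    · exact absurd (h2 ▸ hl) h1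
    · rfl
  · rw [ind_of_not hl, Finset.prod_eq_zero (Finset.mem_univ l) (by simp [hl])]

theorem expect_card_inter (p : unitInterval) {n : ℕ} (S : Finset (Fin n)) :
    (expect (erasureLaw p n) fun E => ((S ∩ E).card : ℝ)) = p * S.card := by
  have : ∀ E : Finset (Fin n), ((S ∩ E).card : ℝ) = ∑ l ∈ S, ind (l ∈ E) := by
    intro E
    simp only [ind_eq_ite, Finset.sum_ite_mem]
    simp
  simp only [this, expect_sum, expect_mem_erasureLaw]
  simp [mul_comm]

theorem expect_card_compl_inter (p : unitInterval) {n : ℕ} (S : Finset (Fin n)) :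
    (expect (erasureLaw p n) fun E => ((Eᶜ ∩ S).card : ℝ)) = (1 - p) * S.card := by
  have : ∀ E : Finset (Fin n), ((Eᶜ ∩ S).card : ℝ) = S.card - (S ∩ E).card := by
    intro E
    rw [Finset.inter_comm, ← Finset.sdiff_eq_inter_compl, Finset.inter_comm S E,
      Finset.card_sdiff, Nat.cast_sub (Finset.card_le_card Finset.inter_subset_right)]
  simp only [this, expect_sub, expect_const, expect_card_inter]
  ring

/-- The joint law of the choice bits and the data behind one run. -/
def runBaseLaw (H : (s k : ℕ) → TwoUniversal s k) (p : Fin 2 → unitInterval) (f : Fin 2)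
    (B : Sizes) : PMF ((Fin 2 → Bool) × Base B) :=
  (PMF.uniformOfFintype (Fin 2 → Bool)).bind fun z =>
    (baseLaw H p f B).bind fun a => PMF.pure (z, a)

theorem outcomeLaw_map_a (H : (s k : ℕ) → TwoUniversal s k) (p : Fin 2 → unitInterval)
    (P : Shared) :
    (outcomeLaw H p P).map (fun ω => (ω.1, ω.2.1)) = runBaseLaw H p 0 P.a := by
  simp [outcomeLaw, runBaseLaw, PMF.map_bind, PMF.pure_map]

theorem outcomeLaw_map_b (H : (s k : ℕ) → TwoUniversal s k) (p : Fin 2 → unitInterval)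
    (P : Shared) :
    (outcomeLaw H p P).map (fun ω => (ω.1, ω.2.2)) = runBaseLaw H p 1 P.b := by
  simp [outcomeLaw, runBaseLaw, PMF.map_bind, PMF.pure_map]

/-! ### What the two receivers jointly know -/

section Marginal

set_option linter.unusedSectionVars false

variable {H : (s k : ℕ) → TwoUniversal s k} {p : Fin 2 → unitInterval} {f : Fin 2} {B : Sizes}
  {Ω γ : Type} [Fintype Ω] [Fintype γ] {μ : PMF Ω} {R : Ω → (Fin 2 → Bool) × Base B}

theorem mem_support_of_map (hR : μ.map R = runBaseLaw H p f B) {ω : Ω} (h : ω ∈ μ.support) :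
    (R ω).2 ∈ (baseLaw H p f B).support := by
  have : R ω ∈ (runBaseLaw H p f B).support := by
    rw [← hR, PMF.mem_support_map_iff]
    exact ⟨ω, h, rfl⟩
  simp only [runBaseLaw, PMF.mem_support_bind_iff, PMF.mem_support_pure_iff] at this
  obtain ⟨z, -, a, ha, e⟩ := this
  rw [e]
  exact ha

theorem expect_of_map (hR : μ.map R = runBaseLaw H p f B) (F : (Fin 2 → Bool) × Base B → ℝ) :
    (expect μ fun ω => F (R ω)) = expect (PMF.uniformOfFintype (Fin 2 → Bool)) fun z =>
      expect (baseLaw H p f B) fun a => F (z, a) := by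
  rw [← expect_map μ R F, hR]
  simp only [runBaseLaw, expect_bind, expect_pure]

theorem expect_draws_of_map (hR : μ.map R = runBaseLaw H p f B) (F : Draws B.n → ℝ) :
    (expect μ fun ω => F (R ω).2.2.2.2) = expect (drawsLaw p f B) F := by
  rw [expect_of_map hR fun x => F x.2.2.2.2]
  simp only [expect_baseLaw_draws, expect_const]

theorem ent_msg (hR : μ.map R = runBaseLaw H p f B) (i : Fin 2) (β : (Fin 2 → Bool) → Bool) :
    ent μ (fun ω => (R ω).2.1 i (β (R ω).1)) = B.k i := by
  refine ent_of_uniform fun ω _ => ?_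
  rw [pr_eq_expect, expect_of_map hR fun x => ind (x.2.1 i (β x.1) = (R ω).2.1 i (β (R ω).1))]
  have h := fun z => expect_baseLaw_msg H p f B
    fun g => ind (g i (β z) = (R ω).2.1 i (β (R ω).1))
  simp only [h, pr_msg, expect_const]
  simp

/-- A run is aborted. -/
def Draws.Abort {n : ℕ} (d : Draws n) (s left s' : ℕ) : Prop := d.Abort₁ s left ∨ d.Abort₂ s'

theorem msg_eq_cipher (ω : Run B) (i : Fin 2) (b : Bool) :
    ω.msg i b = fun j => xor (ω.cipher i b j)
      (ω.hash i b (subword ω.x (ω.sel i b) (B.s i)) j) := by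
  funext j
  simp [Run.cipher]

theorem publicPart_eq_of_transcript {ω ω' : Run B} (h1 : ¬ω.Abort₁ f) (h2 : ¬ω.Abort₂ f)
    (h : ω.transcript f = ω'.transcript f) (i : Fin 2) : ω.publicPart i = ω'.publicPart i := by
  by_cases h1' : ω'.Abort₁ f
  · simp [Run.transcript, h1, h1'] at h
  · by_cases h2' : ω'.Abort₂ f
    · simp [Run.transcript, h1, h1', h2, h2'] at h
    · simp only [Run.transcript, h1, h1', h2, h2', if_false, Option.some.injEq,
        Prod.mk.injEq] at h
      rcases eq_or_eq_other f i with rfl | rfl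
      · exact h.1.2
      · exact h.2

/-- Cipher and hash function are public, so the unchosen string is a function of the input at its
positions. All of these that are not erased for the other receiver are in his view, which leaves
only the hidden bits free. Without the assumption of no abort the cipher might not have been
published. -/
theorem ncard_msg_le (i : Fin 2) (V : Ω → γ)
    (hV : ∀ ω ∈ μ.support, ∀ ω' ∈ μ.support, V ω' = V ω → (R ω').1 = (R ω).1 ∧
      ∀ j, (mkRun f (R ω').1 (R ω').2).bobView f j = (mkRun f (R ω).1 (R ω).2).bobView f j)
    {ω : Ω} (hω : ω ∈ μ.support)
    (hab : ¬(R ω).2.2.2.2.Abort (B.s f) B.left (B.s (other f))) :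
    Set.ncard {m | ∃ ω' ∈ μ.support, (R ω').2.1 i (!(R ω').1 i) = m ∧ V ω' = V ω} ≤
      2 ^ ((R ω).2.2.2.2.hidden f (R ω).1 i (!(R ω).1 i)).card := by
  classical
  set z := (R ω).1
  set a := (R ω).2
  set b := !z i
  set Q := a.2.2.2.hidden f z i b
  -- Decodes the cipher with a guess `u` of the hidden bits.
  let φ : (Q → Bool) → (Fin (B.k i) → Bool) := fun u j =>
    xor ((mkRun f z a).cipher i b j) (a.2.1 i b (subword
      (fun l => if h : l ∈ Q then u ⟨l, h⟩ else a.2.2.1 l) (a.2.2.2.sel f z i b) (B.s i)) j)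
  have hsub : {m | ∃ ω' ∈ μ.support, (R ω').2.1 i (!(R ω').1 i) = m ∧ V ω' = V ω} ⊆
      Set.range φ := by
    rintro m ⟨ω', hω', rfl, hVV⟩
    obtain ⟨hz, hview⟩ := hV ω hω ω' hω' hVV
    have hz' : (R ω').1 = z := hz
    set a' := (R ω').2
    rw [hz'] at hview ⊢
    have h1 : ¬(mkRun f z a).Abort₁ f := by
      rw [abort₁_mkRun]; exact fun h => hab (Or.inl h)
    have h2 : ¬(mkRun f z a).Abort₂ f := by
      rw [abort₂_mkRun]; exact fun h => hab (Or.inr h)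
    have htr : (mkRun f z a').transcript f = (mkRun f z a).transcript f :=
      congrArg (fun v => v.2.2) (hview i)
    have hpub := publicPart_eq_of_transcript h1 h2 htr.symm i
    have hy : (mkRun f z a').y (other i) = (mkRun f z a).y (other i) :=
      congrArg (fun v => v.2.1) (hview (other i))
    have hE : a'.2.2.2.pattern f (other i) = a.2.2.2.pattern f (other i) := by
      have := congrArg erased hy
      simpa [mkRun, erased_observe] using this
    have hsel : (mkRun f z a).sel i = (mkRun f z a').sel i := congrArg (fun v => v.1) hpub
    have hhash : (mkRun f z a).hash i = (mkRun f z a').hash i := congrArg (fun v => v.2.1) hpub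
    have hcip : (mkRun f z a).cipher i = (mkRun f z a').cipher i :=
      congrArg (fun v => v.2.2) hpub
    refine ⟨fun l => a'.2.2.1 l, ?_⟩
    have := msg_eq_cipher (mkRun f z a') i b
    change _ = (mkRun f z a').msg i b
    rw [this]
    funext j
    simp only [φ]
    rw [← hcip, ← hhash, ← hsel]
    congr 1
    refine congrFun (congrArg ((mkRun f z a).hash i b) ?_) j
    refine subword_congr _ fun l hl => ?_
    by_cases hq : l ∈ Q
    · simp [hq, mkRun]
    · have hl' : l ∉ a.2.2.2.pattern f (other i) := fun h =>
        hq (Finset.mem_inter.2 ⟨hl, h⟩)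
      have := congrFun hy l
      simp only [mkRun, observe, hE, hl', if_false, Option.some.injEq] at this
      simp [hq, mkRun, this]
  calc _ ≤ (Set.range φ).ncard := Set.ncard_le_ncard hsub (Set.toFinite _)
    _ ≤ Nat.card (Q → Bool) := by
      rw [← Set.image_univ]
      exact (Set.ncard_image_le Set.finite_univ).trans_eq (Set.ncard_univ _)
    _ = 2 ^ Q.card := by simp

/-- The string has `B.k i` bits of entropy, and observers of both views can narrow it down to the
hidden bits: what is not hidden must have leaked. Applied with the joint view of the colluding
receivers. -/
theorem length_le_of_mutualInfo (hR : μ.map R = runBaseLaw H p f B) (i : Fin 2) (V : Ω → γ)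
    (hV : ∀ ω ∈ μ.support, ∀ ω' ∈ μ.support, V ω' = V ω → (R ω').1 = (R ω).1 ∧
      ∀ j, (mkRun f (R ω').1 (R ω').2).bobView f j = (mkRun f (R ω).1 (R ω).2).bobView f j) :
    (1 - expect (drawsLaw p f B) fun d => ind (d.Abort (B.s f) B.left (B.s (other f)))) * B.k i ≤
      (expect μ fun ω => (((R ω).2.2.2.2.hidden f (R ω).1 i (!(R ω).1 i)).card : ℝ)) +
      mutualInfo μ (fun ω => (R ω).2.1 i (!(R ω).1 i)) V := by
  classical
  have h := ent_sub_le_mutualInfo (μ := μ) (fun ω => (R ω).2.1 i (!(R ω).1 i)) V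
    -- One bound for both cases: after an abort the trivial count of all strings, otherwise the
    -- count from `ncard_msg_le`.
    (fun ω => (2 : ℝ) ^ ((B.k i : ℝ) * ind ((R ω).2.2.2.2.Abort (B.s f) B.left (B.s (other f))) +
      ((R ω).2.2.2.2.hidden f (R ω).1 i (!(R ω).1 i)).card)) (by
    intro ω hω
    by_cases hab : (R ω).2.2.2.2.Abort (B.s f) B.left (B.s (other f))
    · rw [ind_of hab, mul_one, Real.rpow_add two_pos, Real.rpow_natCast, Real.rpow_natCast]
      have h1 : Set.ncard {m | ∃ ω' ∈ μ.support, (R ω').2.1 i (!(R ω').1 i) = m ∧ V ω' = V ω} ≤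
          2 ^ B.k i := by
        refine (Set.ncard_le_ncard (Set.subset_univ _)).trans_eq ?_
        rw [Set.ncard_univ]
        simp
      calc _ ≤ ((2 ^ B.k i : ℕ) : ℝ) := by exact_mod_cast h1
        _ = (2 : ℝ) ^ B.k i * 1 := by simp
        _ ≤ _ := mul_le_mul_of_nonneg_left (one_le_pow₀ one_le_two) (by positivity)
    · rw [ind_of_not hab, mul_zero, zero_add, Real.rpow_natCast]
      exact_mod_cast ncard_msg_le i V hV hω hab)
  rw [ent_msg hR i fun z => !z i] at h
  simp only [Real.log_rpow two_pos] at h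
  rw [expect_mul_right, mul_div_cancel_right₀ _ log_two_pos.ne', expect_add, expect_mul_left,
    expect_draws_of_map hR fun d => ind (d.Abort (B.s f) B.left (B.s (other f)))] at h
  linarith

/-- The set `A'` is independent of `E'`, so on average a fraction p_o of it is hidden. -/
theorem expect_hidden_first_le (hR : μ.map R = runBaseLaw H p f B) :
    (expect μ fun ω => (((R ω).2.2.2.2.hidden f (R ω).1 f (!(R ω).1 f)).card : ℝ)) ≤
      p (other f) * B.s f := by
  have h1 : ∀ ω, (((R ω).2.2.2.2.hidden f (R ω).1 f (!(R ω).1 f)).card : ℝ) =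
      ((R ω).2.2.2.2.A' ∩ (R ω).2.2.2.2.E').card := fun ω => by
    rw [Draws.hidden_first]
    simp
  simp only [h1]
  rw [expect_draws_of_map hR fun d => ((d.A' ∩ d.E').card : ℝ)]
  refine (expect_drawsLaw_indep p f B fun q E' => ((q.2.2.1 ∩ E').card : ℝ)).trans_le ?_
  simp only [expect_card_inter, expect_mul_left]
  refine mul_le_mul_of_nonneg_left ?_ (p (other f)).2.1
  exact expect_le_of_le fun d hd => by exact_mod_cast (drawsLaw_valid hd).A'_le

theorem expect_hidden_other_le (hR : μ.map R = runBaseLaw H p f B) :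
    (expect μ fun ω => (((R ω).2.2.2.2.hidden f (R ω).1 (other f) (!(R ω).1 (other f))).card : ℝ))
      ≤ B.s (other f) := by
  refine expect_le_of_le fun ω hω => ?_
  have hv := baseLaw_valid (mem_support_of_map hR hω)
  rw [hv.hidden_other]
  simp only [Bool.not_eq_self, if_false]
  exact_mod_cast hv.D'_le

end Marginal

/-- In a completed run the sets fit among the available positions; taking expectations replaces the
numbers of available positions by (bounds for) their means. The last two bounds use that `E'` is
independent of `L`. -/
theorem size_bounds (p : Fin 2 → unitInterval) (f : Fin 2) (B : Sizes) :
    let q := 1 - expect (drawsLaw p f B) fun d => ind (d.Abort (B.s f) B.left (B.s (other f)))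
    q * B.s f ≤ (1 - p f) * B.n ∧ q * (B.s f + B.left) ≤ p f * B.n ∧
      q * B.s (other f) ≤ (1 - p (other f)) * B.left ∧
      q * B.s (other f) ≤ p (other f) * B.left := by
  intro q
  have hq : ∀ c : ℝ, q * c = expect (drawsLaw p f B) fun d =>
      (1 - ind (d.Abort (B.s f) B.left (B.s (other f)))) * c := fun c => by
    rw [expect_mul_right, expect_sub, expect_const]
  have hpt : ∀ (d : Draws B.n) (c x : ℝ), 0 ≤ x →
      (¬d.Abort (B.s f) B.left (B.s (other f)) → c ≤ x) →
      (1 - ind (d.Abort (B.s f) B.left (B.s (other f)))) * c ≤ x := by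
    intro d c x hx h
    by_cases hab : d.Abort (B.s f) B.left (B.s (other f))
    · simpa [ind_of hab] using hx
    · simpa [ind_of_not hab] using h hab
  have hEc : (expect (drawsLaw p f B) fun d => ((d.Eᶜ).card : ℝ)) = (1 - p f) * B.n := by
    rw [expect_drawsLaw_E p f B fun E => ((Eᶜ).card : ℝ)]
    simpa using expect_card_compl_inter (p f) (Finset.univ : Finset (Fin B.n))
  have hE : (expect (drawsLaw p f B) fun d => ((d.E).card : ℝ)) = p f * B.n := by
    rw [expect_drawsLaw_E p f B fun E => (E.card : ℝ)]
    simpa using expect_card_inter (p f) (Finset.univ : Finset (Fin B.n))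
  have hLle : (expect (drawsLaw p f B) fun d => (d.L.card : ℝ)) ≤ B.left :=
    expect_le_of_le fun d hd => by exact_mod_cast (drawsLaw_valid hd).L_le
  have hLc : (expect (drawsLaw p f B) fun d => ((d.E'ᶜ ∩ d.L).card : ℝ)) ≤
      (1 - p (other f)) * B.left := by
    refine (expect_drawsLaw_indep p f B fun q E' => ((E'ᶜ ∩ q.2.2.2).card : ℝ)).trans_le ?_
    simp only [expect_card_compl_inter, expect_mul_left]
    exact mul_le_mul_of_nonneg_left hLle (sub_nonneg.2 (p (other f)).2.2)
  have hL : (expect (drawsLaw p f B) fun d => ((d.E' ∩ d.L).card : ℝ)) ≤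
      p (other f) * B.left := by
    refine (expect_drawsLaw_indep p f B fun q E' => ((E' ∩ q.2.2.2).card : ℝ)).trans_le ?_
    simp only [Finset.inter_comm _ (Draws.first _).2.2.2, expect_card_inter, expect_mul_left]
    exact mul_le_mul_of_nonneg_left hLle (p (other f)).2.1
  refine ⟨?_, ?_, ?_, ?_⟩
  · rw [hq, ← hEc]
    refine expect_mono fun d => hpt d _ _ (Nat.cast_nonneg _) fun h => ?_
    simp only [Draws.Abort, Draws.Abort₁] at h
    exact_mod_cast (by omega : B.s f ≤ (d.Eᶜ).card)
  · rw [hq, ← hE]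
    refine expect_mono fun d => hpt d _ _ (Nat.cast_nonneg _) fun h => ?_
    simp only [Draws.Abort, Draws.Abort₁] at h
    exact_mod_cast (by omega : B.s f + B.left ≤ d.E.card)
  · rw [hq]
    refine le_trans (expect_mono fun d => hpt d _ _ (Nat.cast_nonneg _) fun h => ?_) hLc
    simp only [Draws.Abort, Draws.Abort₂] at h
    exact_mod_cast (by omega : B.s (other f) ≤ (d.E'ᶜ ∩ d.L).card)
  · rw [hq]
    refine le_trans (expect_mono fun d => hpt d _ _ (Nat.cast_nonneg _) fun h => ?_) hL
    simp only [Draws.Abort, Draws.Abort₂] at h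
    exact_mod_cast (by omega : B.s (other f) ≤ (d.E' ∩ d.L).card)

/-! ### The outer region -/

/-- Here `q` stands for the completion probability. Bounding `ko` passes from `ko` to `so`, from
`so` to `l` and from `l` to `n`, each time at the cost of a factor `q`; this gives the cube. For the
sum, bounding `so` by `po * l` leads to `po * (sf + l)`, hence to `pf * po`, and bounding it by `(1
- po) * l` leads to `1 - pf * po`. -/
theorem run_rate_bounds {pf po n sf so l kf ko q I : ℝ} (hpf1 : pf ≤ 1)
    (hpo0 : 0 ≤ po) (hpo1 : po ≤ 1) (hq0 : 0 ≤ q) (hq1 : q ≤ 1)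
    (hsf : 0 ≤ sf) (hl : 0 ≤ l) (hI : 0 ≤ I)
    (hkf : q * kf ≤ po * sf + I) (hko : q * ko ≤ so + I)
    (h1 : q * sf ≤ (1 - pf) * n) (h2 : q * (sf + l) ≤ pf * n)
    (h3 : q * so ≤ (1 - po) * l) (h4 : q * so ≤ po * l) :
    q ^ 3 * kf ≤ po * min pf (1 - pf) * n + I ∧
    q ^ 3 * ko ≤ pf * min po (1 - po) * n + I ∧
    q ^ 3 * (kf + ko) ≤ min (pf * po) (1 - pf * po) * n + 2 * I := by
  have hqI : q * I ≤ I := mul_le_of_le_one_left hI hq1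
  have hqI2 : q * (q * I) ≤ I := (mul_le_of_le_one_left (mul_nonneg hq0 hI) hq1).trans hqI
  have hS0 : 0 ≤ q * sf := mul_nonneg hq0 hsf
  have hL0 : 0 ≤ q * l := mul_nonneg hq0 hl
  have a1 : q ^ 2 * kf ≤ po * (q * sf) + q * I := by
    have := mul_le_mul_of_nonneg_left hkf hq0
    nlinarith
  have a2 : q ^ 3 * kf ≤ po * (q * sf) + I := by
    have h := mul_le_mul_of_nonneg_left a1 hq0
    have h' : q * (po * (q * sf)) ≤ po * (q * sf) :=
      mul_le_of_le_one_left (mul_nonneg hpo0 hS0) hq1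
    nlinarith
  have b1 : ∀ c, q * so ≤ c * l → q ^ 3 * ko ≤ c * (q * l) + I := by
    intro c hc
    have t1 := mul_le_mul_of_nonneg_left hko hq0
    have t2 : q * (q * ko) ≤ c * l + q * I := by linarith
    have t3 := mul_le_mul_of_nonneg_left t2 hq0
    nlinarith
  have b3 := b1 _ h3
  have b4 := b1 _ h4
  have hn : 0 ≤ n := by nlinarith
  refine ⟨?_, ?_, ?_⟩
  · have : q * sf ≤ min pf (1 - pf) * n := by
      rcases min_cases pf (1 - pf) with ⟨h, -⟩ | ⟨h, -⟩ <;> rw [h] <;> linarith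
    have := mul_le_mul_of_nonneg_left this hpo0
    linarith
  · have hm : q ^ 3 * ko ≤ min po (1 - po) * (q * l) + I := by
      rcases min_cases po (1 - po) with ⟨h, -⟩ | ⟨h, -⟩ <;> rw [h] <;> linarith
    have hm0 : 0 ≤ min po (1 - po) := le_min hpo0 (by linarith)
    have : q * l ≤ pf * n := by linarith
    have := mul_le_mul_of_nonneg_left this hm0
    linarith
  · have c1 : q ^ 3 * (kf + ko) ≤ pf * po * n + 2 * I := by
      have := mul_le_mul_of_nonneg_left h2 hpo0
      linarith
    have c2 : q ^ 3 * (kf + ko) ≤ (1 - pf * po) * n + 2 * I := by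
      have e1 : q * l ≤ pf * n - q * sf := by linarith
      have e2 := mul_le_mul_of_nonneg_left e1 (by linarith : 0 ≤ 1 - po)
      -- Estimating `q * sf` by `(1 - pf) * n` in the first term and by 0 in the second leaves the
      -- slack `(1 - po) * (1 - pf) * n`.
      have e3 : po * (q * sf) + (1 - po) * (pf * n - q * sf) ≤ (1 - pf * po) * n := by
        have e4 : 0 ≤ (1 - po) * (1 - pf) * n :=
          mul_nonneg (mul_nonneg (by linarith) (by linarith)) hn
        have e5 := mul_le_mul_of_nonneg_left h1 hpo0
        have e6 := mul_nonneg (by linarith : 0 ≤ 1 - po) hS0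
        have e7 : 0 ≤ po * (1 - pf) * n := mul_nonneg (mul_nonneg hpo0 (by linarith)) hn
        nlinarith
      linarith
    rcases min_cases (pf * po) (1 - pf * po) with ⟨h, -⟩ | ⟨h, -⟩ <;> rw [h] <;> assumption

theorem prob_Err (H : (s k : ℕ) → TwoUniversal s k) (p : Fin 2 → unitInterval) (P : Shared)
    (i : Fin 2) :
    prob (P.law H p) (Shared.Err i) =
      expect (outcomeLaw H p P) fun ω => ind (mkOutcome ω ∈ Shared.Err i) := by
  rw [law_eq, prob_map, prob_eq_expect]
  rfl

/-- Any abort is an error of the receiver served last, whichever receiver aborts. So his error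
probability controls the whole abort probability of that run. -/
theorem estimate_eq_none {B : Sizes} {f : Fin 2} {z : Fin 2 → Bool} {a : Base B}
    (h : a.2.2.2.Abort (B.s f) B.left (B.s (other f))) (b : Bool) :
    (mkRun f z a).estimate f (other f) b = none := by
  rw [Run.estimate, if_pos]
  rcases h with h | h
  · exact Or.inl ((abort₁_mkRun f z a).2 h)
  · exact Or.inr ⟨other_ne f, (abort₂_mkRun f z a).2 h⟩

theorem expect_abort_a_le (H : (s k : ℕ) → TwoUniversal s k) (p : Fin 2 → unitInterval)
    (P : Shared) :
    (expect (drawsLaw p 0 P.a) fun d => ind (d.Abort (P.a.s 0) P.a.left (P.a.s (other 0)))) ≤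
      prob (P.law H p) (Shared.Err 1) := by
  rw [prob_Err, ← expect_draws_of_map (outcomeLaw_map_a H p P)
    fun d => ind (d.Abort (P.a.s 0) P.a.left (P.a.s (other 0)))]
  refine expect_mono fun ω => ind_mono fun h => ?_
  have := estimate_eq_none (z := ω.1) h (ω.1 1)
  rintro ⟨h1, -⟩
  change (mkRun 0 ω.1 ω.2.1).estimate 0 (other 0) (ω.1 1) = _ at h1
  rw [this] at h1
  cases h1

theorem expect_abort_b_le (H : (s k : ℕ) → TwoUniversal s k) (p : Fin 2 → unitInterval)
    (P : Shared) :
    (expect (drawsLaw p 1 P.b) fun d => ind (d.Abort (P.b.s 1) P.b.left (P.b.s (other 1)))) ≤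
      prob (P.law H p) (Shared.Err 0) := by
  rw [prob_Err, ← expect_draws_of_map (outcomeLaw_map_b H p P)
    fun d => ind (d.Abort (P.b.s 1) P.b.left (P.b.s (other 1)))]
  refine expect_mono fun ω => ind_mono fun h => ?_
  have := estimate_eq_none (z := ω.1) h (ω.1 0)
  rintro ⟨-, h1⟩
  change (mkRun 1 ω.1 ω.2.2).estimate 1 (other 1) (ω.1 0) = _ at h1
  rw [this] at h1
  cases h1

/-- Data processing in the first argument. -/
theorem mutualInfo_le_of_factor_left {Ω α β γ : Type} [Fintype Ω] {μ : PMF Ω} [Fintype α]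
    [Fintype β] [Fintype γ] (A : Ω → α) {V : Ω → β} {W : Ω → γ}
    (h : ∀ ω ∈ μ.support, ∀ ω' ∈ μ.support, V ω = V ω' → W ω = W ω') :
    mutualInfo μ W A ≤ mutualInfo μ V A := by
  rw [mutualInfo_comm, mutualInfo_comm V]
  exact mutualInfo_le_of_factor A h

/-- The information of both receivers about the strings that they did not choose. -/
def unchosenInfo (H : (s k : ℕ) → TwoUniversal s k) (p : Fin 2 → unitInterval) (P : Shared) : ℝ :=
  mutualInfo (P.law H p) (fun ω => (Shared.Munchosen 0 ω, Shared.Munchosen 1 ω))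
    fun ω => (Shared.V 0 ω, Shared.V 1 ω)

theorem unchosenInfo_eq (H : (s k : ℕ) → TwoUniversal s k) (p : Fin 2 → unitInterval)
    (P : Shared) :
    unchosenInfo H p P = mutualInfo (outcomeLaw H p P)
      (fun ω => (Shared.Munchosen 0 (mkOutcome ω), Shared.Munchosen 1 (mkOutcome ω)))
      fun ω => (Shared.V 0 (mkOutcome ω), Shared.V 1 (mkOutcome ω)) := by
  rw [unchosenInfo, law_eq, mutualInfo_map]

theorem choice_eq_of_V {P : Shared} {ω ω' : BaseOutcome P}
    (h : (Shared.V 0 (mkOutcome ω'), Shared.V 1 (mkOutcome ω')) =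
      (Shared.V 0 (mkOutcome ω), Shared.V 1 (mkOutcome ω))) : ω'.1 = ω.1 := by
  simp only [Shared.V, Shared.Z, mkOutcome, Prod.mk.injEq] at h
  funext j
  fin_cases j
  · exact h.1.1
  · exact h.2.1

theorem length_bounds_a (H : (s k : ℕ) → TwoUniversal s k) (p : Fin 2 → unitInterval)
    (P : Shared) (i : Fin 2) :
    (1 - expect (drawsLaw p 0 P.a) fun d =>
        ind (d.Abort (P.a.s 0) P.a.left (P.a.s (other 0)))) * P.a.k i ≤
      (expect (outcomeLaw H p P) fun ω =>
        ((ω.2.1.2.2.2.hidden 0 ω.1 i (!ω.1 i)).card : ℝ)) + unchosenInfo H p P := by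
  refine (length_le_of_mutualInfo (outcomeLaw_map_a H p P) i
    (fun ω => (Shared.V 0 (mkOutcome ω), Shared.V 1 (mkOutcome ω))) ?_).trans ?_
  · intro ω _ ω' _ h
    refine ⟨choice_eq_of_V h, fun j => ?_⟩
    simp only [Shared.V, Prod.mk.injEq] at h
    fin_cases j
    · exact h.1.2.1
    · exact h.2.2.1
  · rw [unchosenInfo_eq]
    refine add_le_add_right (mutualInfo_le_of_factor_left _ fun ω _ ω' _ h => ?_) _
    simp only [Shared.Munchosen, Shared.M, Prod.mk.injEq] at h
    fin_cases i
    · exact h.1.1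
    · exact h.2.1

theorem length_bounds_b (H : (s k : ℕ) → TwoUniversal s k) (p : Fin 2 → unitInterval)
    (P : Shared) (i : Fin 2) :
    (1 - expect (drawsLaw p 1 P.b) fun d =>
        ind (d.Abort (P.b.s 1) P.b.left (P.b.s (other 1)))) * P.b.k i ≤
      (expect (outcomeLaw H p P) fun ω =>
        ((ω.2.2.2.2.2.hidden 1 ω.1 i (!ω.1 i)).card : ℝ)) + unchosenInfo H p P := by
  refine (length_le_of_mutualInfo (outcomeLaw_map_b H p P) i
    (fun ω => (Shared.V 0 (mkOutcome ω), Shared.V 1 (mkOutcome ω))) ?_).trans ?_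
  · intro ω _ ω' _ h
    refine ⟨choice_eq_of_V h, fun j => ?_⟩
    simp only [Shared.V, Prod.mk.injEq] at h
    fin_cases j
    · exact h.1.2.2
    · exact h.2.2.2
  · rw [unchosenInfo_eq]
    refine add_le_add_right (mutualInfo_le_of_factor_left _ fun ω _ ω' _ h => ?_) _
    simp only [Shared.Munchosen, Shared.M, Prod.mk.injEq] at h
    fin_cases i
    · exact h.1.2
    · exact h.2.2

/-- Nonasymptotic outer bounds for a run, with `q` a lower bound for the probability of
completion. -/
theorem run_bounds {p : Fin 2 → unitInterval} {f : Fin 2} {B : Sizes} {q I hf ho : ℝ}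
    (hq0 : 0 ≤ q) (hq1 : q ≤ 1) (hI : 0 ≤ I)
    (hq : q ≤ 1 - expect (drawsLaw p f B) fun d => ind (d.Abort (B.s f) B.left (B.s (other f))))
    (hkf : (1 - expect (drawsLaw p f B) fun d =>
      ind (d.Abort (B.s f) B.left (B.s (other f)))) * B.k f ≤ hf + I)
    (hko : (1 - expect (drawsLaw p f B) fun d =>
      ind (d.Abort (B.s f) B.left (B.s (other f)))) * B.k (other f) ≤ ho + I)
    (hhf : hf ≤ p (other f) * B.s f) (hho : ho ≤ B.s (other f)) :
    q ^ 3 * B.k f ≤ p (other f) * min (p f : ℝ) (1 - p f) * B.n + I ∧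
    q ^ 3 * B.k (other f) ≤ p f * min (p (other f) : ℝ) (1 - p (other f)) * B.n + I ∧
    q ^ 3 * (B.k f + B.k (other f)) ≤
      min (p f * p (other f) : ℝ) (1 - p f * p (other f)) * B.n + 2 * I := by
  obtain ⟨h1, h2, h3, h4⟩ := size_bounds p f B
  have key : ∀ {c x : ℝ}, 0 ≤ c → (1 - expect (drawsLaw p f B) fun d =>
      ind (d.Abort (B.s f) B.left (B.s (other f)))) * c ≤ x → q * c ≤ x := fun hc h =>
    (mul_le_mul_of_nonneg_right hq hc).trans h
  exact run_rate_bounds (p f).2.2 (p (other f)).2.1 (p (other f)).2.2 hq0 hq1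
    (Nat.cast_nonneg _) (Nat.cast_nonneg B.left) hI
    ((key (Nat.cast_nonneg _) hkf).trans (by linarith))
    ((key (Nat.cast_nonneg _) hko).trans (by linarith)) (key (Nat.cast_nonneg _) h1)
    (key (by positivity) h2) (key (Nat.cast_nonneg _) h3) (key (Nat.cast_nonneg _) h4)

/-- The bounds of `run_bounds` have the same coefficients in both orders once the receivers are
renamed, and are linear in the number of uses, so they add up over the two runs. -/
theorem shared_bounds (H : (s k : ℕ) → TwoUniversal s k) (p : Fin 2 → unitInterval) (P : Shared)
    {q I : ℝ} (hI : unchosenInfo H p P = I)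
    (hq : q = 1 - (prob (P.law H p) (Shared.Err 0) + prob (P.law H p) (Shared.Err 1)))
    (hq0 : 0 ≤ q) :
    q ^ 3 * P.len 0 ≤ p 1 * min (p 0 : ℝ) (1 - p 0) * P.uses + 2 * I ∧
    q ^ 3 * P.len 1 ≤ p 0 * min (p 1 : ℝ) (1 - p 1) * P.uses + 2 * I ∧
    q ^ 3 * (P.len 0 + P.len 1) ≤ min (p 0 * p 1 : ℝ) (1 - p 0 * p 1) * P.uses + 4 * I := by
  have he : ∀ i, 0 ≤ prob (P.law H p) (Shared.Err i) := fun i => ENNReal.toReal_nonneg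
  have e0 := he 0
  have e1 := he 1
  have hI0 : 0 ≤ I := by
    rw [← hI, unchosenInfo_eq]
    exact mutualInfo_nonneg _ _
  have qa := expect_abort_a_le H p P
  have qb := expect_abort_b_le H p P
  have la := length_bounds_a H p P
  have lb := length_bounds_b H p P
  rw [hI] at la lb
  have ha1 := expect_hidden_first_le (outcomeLaw_map_a H p P)
  have ha2 := expect_hidden_other_le (outcomeLaw_map_a H p P)
  have hb1 := expect_hidden_first_le (outcomeLaw_map_b H p P)
  have hb2 := expect_hidden_other_le (outcomeLaw_map_b H p P)
  dsimp only at ha1 ha2 hb1 hb2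
  obtain ⟨a1, a2, a3⟩ := run_bounds (p := p) (f := 0) (B := P.a) (q := q) hq0 (by linarith) hI0
    (by linarith) (la 0) (la (other 0)) ha1 ha2
  obtain ⟨b1, b2, b3⟩ := run_bounds (p := p) (f := 1) (B := P.b) (q := q) hq0 (by linarith) hI0
    (by linarith) (lb 1) (lb (other 1)) hb1 hb2
  have o0 : other 0 = 1 := rfl
  have o1 : other 1 = 0 := rfl
  rw [o0] at a1 a2 a3
  rw [o1] at b1 b2 b3
  rw [mul_comm (p 1 : ℝ) (p 0 : ℝ)] at b3
  simp only [Shared.len, Shared.uses, Nat.cast_add]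
  clear la lb qa qb he e0 e1
  generalize (P.a.k 0 : ℝ) = ka0 at *
  generalize (P.a.k 1 : ℝ) = ka1 at *
  generalize (P.b.k 0 : ℝ) = kb0 at *
  generalize (P.b.k 1 : ℝ) = kb1 at *
  generalize (P.a.n : ℝ) = na at *
  generalize (P.b.n : ℝ) = nb at *
  generalize min (p 0 * p 1 : ℝ) (1 - p 0 * p 1) = c at *
  generalize min (p 0 : ℝ) (1 - p 0) = c0 at *
  generalize min (p 1 : ℝ) (1 - p 1) = c1 at *
  refine ⟨?_, ?_, ?_⟩
  · linarith
  · linarith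
  · linarith

-- Only correctness and the secrecy of the unchosen strings are needed: divide `shared_bounds` by
-- the number of uses and pass to the limit.
open Filter Topology in
theorem freeSizesRegion_subset (H : (s k : ℕ) → TwoUniversal s k) (p : Fin 2 → unitInterval) :
    freeSizesRegion H p ⊆ outerRegion (p 0) (p 1) := by
  rintro ⟨R₁, R₂⟩ ⟨hR1, hR2, P, hP, h1, h2, hsec⟩
  simp only at hR1 hR2 h1 h2
  set q : ℕ → ℝ := fun n =>
    1 - (prob ((P n).law H p) (Shared.Err 0) + prob ((P n).law H p) (Shared.Err 1)) with hq
  have hqlim : Tendsto q atTop (𝓝 1) := by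
    have := ((hsec.correct 0).add (hsec.correct 1)).const_sub 1
    simpa using this
  set I : ℕ → ℝ := fun n => unchosenInfo H p (P n) with hI
  have hIlim : Tendsto I atTop (𝓝 0) := hsec.unchosen_hidden
  have hIn : ∀ c : ℝ, Tendsto (fun n : ℕ => c * I n / n) atTop (𝓝 0) := fun c =>
    (hIlim.const_mul c).div_atTop tendsto_natCast_atTop_atTop
  have hev : ∀ᶠ n in atTop, 0 ≤ q n ∧ 0 < n :=
    (hqlim.eventually (lt_mem_nhds one_pos)).and (eventually_gt_atTop 0) |>.mono
      fun n h => ⟨h.1.le, h.2⟩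
  have hbd : ∀ᶠ n : ℕ in atTop,
      q n ^ 3 * (((P n).len 0 : ℝ) / n) ≤ p 1 * min (p 0 : ℝ) (1 - p 0) + 2 * I n / n ∧
      q n ^ 3 * (((P n).len 1 : ℝ) / n) ≤ p 0 * min (p 1 : ℝ) (1 - p 1) + 2 * I n / n ∧
      q n ^ 3 * (((P n).len 0 : ℝ) / n + ((P n).len 1 : ℝ) / n) ≤
        min (p 0 * p 1 : ℝ) (1 - p 0 * p 1) + 4 * I n / n := by
    filter_upwards [hev] with n hn
    obtain ⟨b1, b2, b3⟩ := shared_bounds H p (P n) (q := q n) (I := I n) rfl rfl hn.1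
    rw [(hP n).2] at b1 b2 b3
    have hn0 : (0 : ℝ) < n := by exact_mod_cast hn.2
    have aux : ∀ {x y c : ℝ}, x ≤ y * n + c → x / n ≤ y + c / n := fun {x y c} h => by
      rw [div_le_iff₀ hn0, add_mul, div_mul_cancel₀ _ hn0.ne']
      exact h
    refine ⟨?_, ?_, ?_⟩
    · rw [← mul_div_assoc]; exact aux b1
    · rw [← mul_div_assoc]; exact aux b2
    · rw [← add_div, ← mul_div_assoc]; exact aux b3
  have hq3 : Tendsto (fun n => q n ^ 3) atTop (𝓝 1) := by simpa using hqlim.pow 3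
  refine ⟨hR1, hR2, ?_, ?_, ?_⟩
  · have hl := hq3.mul h1
    have hr := (hIn 2).const_add (p 1 * min (p 0 : ℝ) (1 - p 0))
    simpa using le_of_tendsto_of_tendsto hl hr (hbd.mono fun n h => h.1)
  · have hl := hq3.mul h2
    have hr := (hIn 2).const_add (p 0 * min (p 1 : ℝ) (1 - p 1))
    simpa using le_of_tendsto_of_tendsto hl hr (hbd.mono fun n h => h.2.1)
  · have hl := hq3.mul (h1.add h2)
    have hr := (hIn 4).const_add (min (p 0 * p 1 : ℝ) (1 - p 0 * p 1))
    simpa only [one_mul, add_zero] using le_of_tendsto_of_tendsto hl hr (hbd.mono fun n h => h.2.2)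

theorem rateRegion_subset_freeSizesRegion (H : (s k : ℕ) → TwoUniversal s k)
    (p : Fin 2 → unitInterval) : rateRegion H p ⊆ freeSizesRegion H p := by
  rintro R ⟨h1, h2, P, hP, h⟩
  exact ⟨h1, h2, P, fun n => ⟨trivial, (hP n).2⟩, h⟩

/-! ### Exchanging the two index sets of a receiver -/

theorem expect_ind_mul {α : Type} [Fintype α] (μ : PMF α) (b : α) (g : α → ℝ) :
    (expect μ fun a => ind (a = b) * g a) = (μ b).toReal * g b := by
  rw [expect, Finset.sum_eq_single b]
  · rw [ind_of rfl, one_mul]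
  · intro a _ ha
    rw [ind_of_not ha, zero_mul, mul_zero]
  · simp

/-- The explicit product allows the factors to be compared one by one before and after an exchange.
-/
theorem drawsLaw_toReal (p : Fin 2 → unitInterval) (f : Fin 2) (B : Sizes) (d : Draws B.n) :
    (drawsLaw p f B d).toReal =
      (erasureLaw (p f) B.n d.E).toReal * ((erasureLaw (p (other f)) B.n d.E').toReal *
      ((uniformSubset d.Eᶜ (B.s f) d.A).toReal * ((uniformSubset d.E (B.s f) d.A').toReal *
      (((if d.Eᶜ.card < B.s f ∨ d.E.card < B.s f + B.left then PMF.pure ∅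
        else uniformSubset (d.E \ d.A') B.left) d.L).toReal *
      ((uniformSubset (d.E'ᶜ ∩ d.L) (B.s (other f)) d.D).toReal *
      (uniformSubset (d.E' ∩ d.L) (B.s (other f)) d.D').toReal))))) := by
  have h : ∀ E E' A A' L D D', ind ((⟨E, E', A, A', L, D, D'⟩ : Draws B.n) = d) =
      ind (E = d.E) * (ind (E' = d.E') * (ind (A = d.A) * (ind (A' = d.A') * (ind (L = d.L) *
        (ind (D = d.D) * ind (D' = d.D')))))) := by
    intro E E' A A' L D D'
    obtain ⟨e, e', a, a', l, c, c'⟩ := d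
    simp only [ind_eq_ite, Draws.mk.injEq]
    split_ifs <;> simp_all
  simp only [drawsLaw, toReal_bind, toReal_pure, h, expect_mul_left, expect_ind_eq,
    expect_ind_mul]

theorem uniformSubset_congr {α : Type} {T T' A A' : Finset α} {m : ℕ}
    (hA : A ∈ T.powersetCard m) (hA' : A' ∈ T'.powersetCard m) (h : T.card = T'.card) :
    uniformSubset T m A = uniformSubset T' m A' := by
  have h1 : m ≤ T.card := by
    rw [Finset.mem_powersetCard] at hA
    exact hA.2 ▸ Finset.card_le_card hA.1
  rw [uniformSubset, uniformSubset, dif_pos h1, dif_pos (h ▸ h1),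
    PMF.uniformOfFinset_apply_of_mem _ hA, PMF.uniformOfFinset_apply_of_mem _ hA',
    Finset.card_powersetCard, Finset.card_powersetCard, h]

section Exchange

variable {n : ℕ} {E X Y : Finset (Fin n)}

theorem exchange_sdiff (hX : X ⊆ Eᶜ) : ((E \ Y) ∪ X) \ X = E \ Y := by
  ext l
  have := @hX l
  simp only [Finset.mem_compl] at this
  simp only [Finset.mem_sdiff, Finset.mem_union]
  tauto

/-- Equally many positions enter and leave the pattern inside `L`. The receiver served last
exchanges inside his `L`; for the other one `L` is the whole set. -/
theorem exchange_card_inter (hX : X ⊆ Eᶜ) (hY : Y ⊆ E) (h : X.card = Y.card) (L : Finset (Fin n))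
    (hXL : X ⊆ L) (hYL : Y ⊆ L) : (((E \ Y) ∪ X) ∩ L).card = (E ∩ L).card := by
  have e1 : ((E \ Y) ∪ X) ∩ L = ((E ∩ L) \ Y) ∪ X := by
    ext l
    have := @hXL l
    simp only [Finset.mem_inter, Finset.mem_sdiff, Finset.mem_union]
    tauto
  have hYE : Y ⊆ E ∩ L := Finset.subset_inter hY hYL
  rw [e1, Finset.card_union_of_disjoint, Finset.card_sdiff_of_subset hYE, h,
    Nat.sub_add_cancel (Finset.card_le_card hYE)]
  rw [Finset.disjoint_left]
  intro l hl hx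
  have := hX hx
  simp only [Finset.mem_inter, Finset.mem_sdiff, Finset.mem_compl] at hl this
  tauto

theorem card_compl_inter (E L : Finset (Fin n)) : (Eᶜ ∩ L).card = L.card - (E ∩ L).card := by
  rw [Finset.inter_comm, ← Finset.sdiff_eq_inter_compl, Finset.card_sdiff]

theorem exchange_card_compl_inter (hX : X ⊆ Eᶜ) (hY : Y ⊆ E) (h : X.card = Y.card)
    (L : Finset (Fin n)) (hXL : X ⊆ L) (hYL : Y ⊆ L) :
    (((E \ Y) ∪ X)ᶜ ∩ L).card = (Eᶜ ∩ L).card := by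
  rw [card_compl_inter, card_compl_inter, exchange_card_inter hX hY h L hXL hYL]

theorem exchange_card (hX : X ⊆ Eᶜ) (hY : Y ⊆ E) (h : X.card = Y.card) :
    ((E \ Y) ∪ X).card = E.card := by
  simpa using exchange_card_inter hX hY h Finset.univ (Finset.subset_univ _) (Finset.subset_univ _)

theorem exchange_card_compl (hX : X ⊆ Eᶜ) (hY : Y ⊆ E) (h : X.card = Y.card) :
    ((E \ Y) ∪ X)ᶜ.card = Eᶜ.card := by
  rw [Finset.card_compl, Finset.card_compl, exchange_card hX hY h]

theorem subset_exchange_compl (hX : X ⊆ Eᶜ) (hY : Y ⊆ E) : Y ⊆ ((E \ Y) ∪ X)ᶜ := by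
  intro l hl
  have h1 := @hX l
  have h2 := hY hl
  simp only [Finset.mem_compl, Finset.mem_union, Finset.mem_sdiff] at *
  tauto

end Exchange

open Classical in
/-- The receiver served first exchanges his two sets, erasing the received one and vice versa. -/
def Draws.swap₁ {n : ℕ} (s : ℕ) (d : Draws n) : Draws n :=
  if d.A ∈ d.Eᶜ.powersetCard s ∧ d.A' ∈ d.E.powersetCard s then
    { d with E := (d.E \ d.A') ∪ d.A, A := d.A', A' := d.A }
  else d

open Classical in
/-- The receiver served last exchanges his two sets, erasing the received one and vice versa. -/
def Draws.swap₂ {n : ℕ} (s : ℕ) (d : Draws n) : Draws n :=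
  if d.D ∈ (d.E'ᶜ ∩ d.L).powersetCard s ∧ d.D' ∈ (d.E' ∩ d.L).powersetCard s then
    { d with E' := (d.E' \ d.D') ∪ d.D, D := d.D', D' := d.D }
  else d

/-- The guard holds again after an exchange, with the two sets in interchanged roles; where it fails
nothing is changed. -/
theorem Draws.swap₁_swap₁ {n : ℕ} (s : ℕ) (d : Draws n) : (d.swap₁ s).swap₁ s = d := by
  by_cases h : d.A ∈ d.Eᶜ.powersetCard s ∧ d.A' ∈ d.E.powersetCard s
  · obtain ⟨⟨hA, hAc⟩, ⟨hA', hAc'⟩⟩ :=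
      And.imp Finset.mem_powersetCard.1 Finset.mem_powersetCard.1 h
    rw [Draws.swap₁, Draws.swap₁, if_pos h, if_pos]
    · simp only [exchange_sdiff hA, Finset.sdiff_union_of_subset hA']
    · simp only [Finset.mem_powersetCard]
      exact ⟨⟨subset_exchange_compl hA hA', hAc'⟩, ⟨Finset.subset_union_right, hAc⟩⟩
  · rw [Draws.swap₁, Draws.swap₁, if_neg h, if_neg h]

theorem Draws.swap₂_swap₂ {n : ℕ} (s : ℕ) (d : Draws n) : (d.swap₂ s).swap₂ s = d := by
  by_cases h : d.D ∈ (d.E'ᶜ ∩ d.L).powersetCard s ∧ d.D' ∈ (d.E' ∩ d.L).powersetCard s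
  · obtain ⟨⟨hA, hAc⟩, ⟨hA', hAc'⟩⟩ :=
      And.imp Finset.mem_powersetCard.1 Finset.mem_powersetCard.1 h
    rw [Finset.subset_inter_iff] at hA hA'
    rw [Draws.swap₂, Draws.swap₂, if_pos h, if_pos]
    · simp only [exchange_sdiff hA.1, Finset.sdiff_union_of_subset hA'.1]
    · simp only [Finset.mem_powersetCard, Finset.subset_inter_iff]
      exact ⟨⟨⟨subset_exchange_compl hA.1 hA'.1, hA'.2⟩, hAc'⟩,
        ⟨⟨Finset.subset_union_right, hA.2⟩, hAc⟩⟩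
  · rw [Draws.swap₂, Draws.swap₂, if_neg h, if_neg h]

/-- The exchange keeps the number of erasures, and by `exchange_sdiff` also the set of further
erased positions from which `L` is drawn. -/
theorem drawsLaw_swap₁ (p : Fin 2 → unitInterval) (f : Fin 2) (B : Sizes) (d : Draws B.n) :
    (drawsLaw p f B (d.swap₁ (B.s f))).toReal = (drawsLaw p f B d).toReal := by
  by_cases h : d.A ∈ d.Eᶜ.powersetCard (B.s f) ∧ d.A' ∈ d.E.powersetCard (B.s f)
  · obtain ⟨⟨hA, hAc⟩, ⟨hA', hAc'⟩⟩ :=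
      And.imp Finset.mem_powersetCard.1 Finset.mem_powersetCard.1 h
    have hc : d.A.card = d.A'.card := by rw [hAc, hAc']
    rw [Draws.swap₁, if_pos h, drawsLaw_toReal, drawsLaw_toReal]
    simp only [exchange_card hA hA' hc, exchange_card_compl hA hA' hc, exchange_sdiff hA]
    rw [erasureLaw_congr_card (p f) B.n (exchange_card hA hA' hc),
      uniformSubset_congr (A' := d.A) (T' := d.Eᶜ) _ h.1 (exchange_card_compl hA hA' hc),
      uniformSubset_congr (A' := d.A') (T' := d.E) _ h.2 (exchange_card hA hA' hc)]
    · exact Finset.mem_powersetCard.2 ⟨Finset.subset_union_right, hAc⟩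
    · exact Finset.mem_powersetCard.2 ⟨subset_exchange_compl hA hA', hAc'⟩
  · rw [Draws.swap₁, if_neg h]

theorem drawsLaw_swap₂ (p : Fin 2 → unitInterval) (f : Fin 2) (B : Sizes) (d : Draws B.n) :
    (drawsLaw p f B (d.swap₂ (B.s (other f)))).toReal = (drawsLaw p f B d).toReal := by
  by_cases h : d.D ∈ (d.E'ᶜ ∩ d.L).powersetCard (B.s (other f)) ∧
      d.D' ∈ (d.E' ∩ d.L).powersetCard (B.s (other f))
  · obtain ⟨⟨hA, hAc⟩, ⟨hA', hAc'⟩⟩ :=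
      And.imp Finset.mem_powersetCard.1 Finset.mem_powersetCard.1 h
    rw [Finset.subset_inter_iff] at hA hA'
    have hc : d.D.card = d.D'.card := by rw [hAc, hAc']
    have c1 := exchange_card_inter hA.1 hA'.1 hc d.L hA.2 hA'.2
    have c2 := exchange_card_compl_inter hA.1 hA'.1 hc d.L hA.2 hA'.2
    rw [Draws.swap₂, if_pos h, drawsLaw_toReal, drawsLaw_toReal]
    simp only
    rw [erasureLaw_congr_card (p (other f)) B.n (exchange_card hA.1 hA'.1 hc),
      uniformSubset_congr (A' := d.D) (T' := d.E'ᶜ ∩ d.L) _ h.1 c2,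
      uniformSubset_congr (A' := d.D') (T' := d.E' ∩ d.L) _ h.2 c1]
    · exact Finset.mem_powersetCard.2
        ⟨Finset.subset_inter Finset.subset_union_right hA.2, hAc⟩
    · exact Finset.mem_powersetCard.2
        ⟨Finset.subset_inter (subset_exchange_compl hA.1 hA'.1) hA'.2, hAc'⟩
  · rw [Draws.swap₂, if_neg h]

theorem expect_comp_of_involutive {α : Type} [Fintype α] {μ : PMF α} {σ : α → α}
    (hσ : Function.Involutive σ) (h : ∀ a, (μ (σ a)).toReal = (μ a).toReal) (F : α → ℝ) :
    (expect μ fun a => F (σ a)) = expect μ F := by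
  rw [expect, expect, ← Equiv.sum_comp hσ.toPerm]
  refine Finset.sum_congr rfl fun a _ => ?_
  rw [Function.Involutive.coe_toPerm, hσ a, h]

/-- Receiver `i` exchanges his two sets. -/
def Base.swap {B : Sizes} (f i : Fin 2) (a : Base B) : Base B :=
  (a.1, a.2.1, a.2.2.1,
    if i = f then a.2.2.2.swap₁ (B.s f) else a.2.2.2.swap₂ (B.s (other f)))

theorem expect_baseLaw_swap (H : (s k : ℕ) → TwoUniversal s k) (p : Fin 2 → unitInterval)
    (f i : Fin 2) (B : Sizes) (F : Base B → ℝ) :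
    (expect (baseLaw H p f B) fun a => F (Base.swap f i a)) = expect (baseLaw H p f B) F := by
  by_cases hi : i = f
  · simp only [expect_baseLaw, Base.swap, if_pos hi]
    have := fun (m : Strings B.k) (h : Hashes B) (x : Fin B.n → Bool) =>
      expect_comp_of_involutive (fun d => Draws.swap₁_swap₁ (B.s f) d) (drawsLaw_swap₁ p f B)
        fun d => F (m, h, x, d)
    simp only [this]
  · simp only [expect_baseLaw, Base.swap, if_neg hi]
    have := fun (m : Strings B.k) (h : Hashes B) (x : Fin B.n → Bool) =>
      expect_comp_of_involutive (fun d => Draws.swap₂_swap₂ (B.s (other f)) d)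
        (drawsLaw_swap₂ p f B) fun d => F (m, h, x, d)
    simp only [this]

/-- The choice bits with bit `i` complemented. -/
def flip (i : Fin 2) (z : Fin 2 → Bool) : Fin 2 → Bool := Function.update z i (!z i)

theorem flip_same (i : Fin 2) (z : Fin 2 → Bool) : flip i z i = !z i := by simp [flip]

theorem flip_ne {i j : Fin 2} (h : j ≠ i) (z : Fin 2 → Bool) : flip i z j = z j := by
  simp [flip, h]

theorem flip_flip (i : Fin 2) (z : Fin 2 → Bool) : flip i (flip i z) = z := by
  simp [flip]

/-- Receiver `i` complements his choice bit and exchanges his two sets in both runs. -/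
def swapOutcome {P : Shared} (i : Fin 2) (ω : BaseOutcome P) : BaseOutcome P :=
  (flip i ω.1, Base.swap 0 i ω.2.1, Base.swap 1 i ω.2.2)

theorem expect_outcomeLaw (H : (s k : ℕ) → TwoUniversal s k) (p : Fin 2 → unitInterval)
    (P : Shared) (F : BaseOutcome P → ℝ) :
    expect (outcomeLaw H p P) F = expect (PMF.uniformOfFintype (Fin 2 → Bool)) fun z =>
      expect (baseLaw H p 0 P.a) fun a => expect (baseLaw H p 1 P.b) fun b => F (z, a, b) := by
  simp only [outcomeLaw, expect_bind, expect_pure]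

theorem expect_swapOutcome (H : (s k : ℕ) → TwoUniversal s k) (p : Fin 2 → unitInterval)
    (P : Shared) (i : Fin 2) (F : BaseOutcome P → ℝ) :
    (expect (outcomeLaw H p P) fun ω => F (swapOutcome i ω)) = expect (outcomeLaw H p P) F := by
  simp only [expect_outcomeLaw, swapOutcome]
  have h1 := fun z a => expect_baseLaw_swap H p 1 i P.b fun b => F (z, a, b)
  have h0 := fun z => expect_baseLaw_swap H p 0 i P.a
    fun a => expect (baseLaw H p 1 P.b) fun b => F (z, a, b)
  simp only [h1, h0]
  exact expect_comp_of_involutive (σ := flip i) (flip_flip i) (fun z => by simp)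
    fun z => expect (baseLaw H p 0 P.a) fun a => expect (baseLaw H p 1 P.b) fun b => F (z, a, b)

/-! ### Invariance of the views -/

theorem transcript_congr_of {B : Sizes} {f : Fin 2} {ω ω' : Run B}
    (h1 : ω.Abort₁ f ↔ ω'.Abort₁ f) (h2 : ω.Abort₂ f ↔ ω'.Abort₂ f) (hl : ω.left = ω'.left)
    (hf : ¬ω.Abort₁ f → ω.publicPart f = ω'.publicPart f)
    (ho : ¬ω.Abort₁ f → ¬ω.Abort₂ f → ω.publicPart (other f) = ω'.publicPart (other f)) :
    ω.transcript f = ω'.transcript f := by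
  by_cases c1 : ω.Abort₁ f
  · simp [Run.transcript, c1, h1.1 c1]
  · by_cases c2 : ω.Abort₂ f
    · simp [Run.transcript, c1, mt h1.2 c1, c2, h2.1 c2, hl, hf c1]
    · simp [Run.transcript, c1, mt h1.2 c1, c2, mt h2.2 c2, hl, hf c1, ho c1 c2]

theorem publicPart_congr {B : Sizes} {j : Fin 2} {ω ω' : Run B} (hm : ω.msg = ω'.msg)
    (hh : ω.hash = ω'.hash) (hx : ω.x = ω'.x) (hs : ω.sel j = ω'.sel j) :
    ω.publicPart j = ω'.publicPart j := by
  simp only [Run.publicPart, Prod.mk.injEq]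
  refine ⟨hs, by rw [hh], ?_⟩
  funext b l
  simp only [Run.cipher, hm, hh, hx, hs]

/-- Labels follow the choice bit, so complementing it and exchanging the sets leaves the announced
pair as it was, and the input is not touched. The guard of the exchange can fail only in an aborted
run, where these sets are not announced. -/
theorem swap_first_views {B : Sizes} (f : Fin 2) (z : Fin 2 → Bool) {a : Base B}
    (hv : a.2.2.2.Valid (B.s f) B.left (B.s (other f))) :
    (mkRun f (flip f z) (Base.swap f f a)).aliceView f = (mkRun f z a).aliceView f ∧
    (mkRun f (flip f z) (Base.swap f f a)).bobView f (other f) =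
      (mkRun f z a).bobView f (other f) := by
  obtain ⟨m, hsh, x, d⟩ := a
  simp only at hv
  have hzo : flip f z (other f) = z (other f) := flip_ne (other_ne f) z
  set ω := mkRun f z (m, hsh, x, d) with hω
  set ω' := mkRun f (flip f z) (Base.swap f f (m, hsh, x, d)) with hω'
  have key : ω'.left = ω.left ∧ ω'.y (other f) = ω.y (other f) ∧
      ω'.sel (other f) = ω.sel (other f) ∧ (ω'.Abort₁ f ↔ ω.Abort₁ f) ∧
      (ω'.Abort₂ f ↔ ω.Abort₂ f) ∧ (¬ω'.Abort₁ f → ω'.sel f = ω.sel f) := by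
    rw [hω, hω', abort₁_mkRun, abort₁_mkRun, abort₂_mkRun, abort₂_mkRun]
    by_cases h : d.A ∈ d.Eᶜ.powersetCard (B.s f) ∧ d.A' ∈ d.E.powersetCard (B.s f)
    · obtain ⟨⟨hA, hAc⟩, ⟨hA', hAc'⟩⟩ :=
        And.imp Finset.mem_powersetCard.1 Finset.mem_powersetCard.1 h
      have hc : d.A.card = d.A'.card := by rw [hAc, hAc']
      have hd : (Base.swap f f (m, hsh, x, d)).2.2.2 =
          { d with E := (d.E \ d.A') ∪ d.A, A := d.A', A' := d.A } := by
        simp [Base.swap, Draws.swap₁, h]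
      simp only [mkRun, hd, Draws.Abort₁, Draws.Abort₂, exchange_card hA hA' hc,
        exchange_card_compl hA hA' hc, Draws.pattern, if_neg (other_ne f), iff_self, true_and]
      refine ⟨?_, ?_, fun _ => ?_⟩
      · simp [Base.swap]
      · funext b
        simp [Draws.sel, other_ne, hzo]
      · funext b
        simp only [Draws.sel, if_true, flip_same]
        cases b <;> cases z f <;> simp
    · have hd : Base.swap f f (m, hsh, x, d) = (m, hsh, x, d) := by
        simp only [Base.swap, if_true, Draws.swap₁, if_neg h]
      rw [hd]
      refine ⟨rfl, rfl, ?_, Iff.rfl, Iff.rfl, fun hab => absurd ?_ h⟩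
      · funext b
        simp [mkRun, Draws.sel, other_ne, hzo]
      · exact ⟨Finset.mem_powersetCard.2 ⟨hv.A_sub, hv.A_card hab⟩,
          Finset.mem_powersetCard.2 ⟨hv.A'_sub, hv.A'_card hab⟩⟩
  obtain ⟨hl, hy, hso, h1, h2, hsf⟩ := key
  have htr : ω'.transcript f = ω.transcript f :=
    transcript_congr_of h1 h2 hl (fun h => publicPart_congr rfl rfl rfl (hsf h))
      fun _ _ => publicPart_congr rfl rfl rfl hso
  exact ⟨by simp only [Run.aliceView, htr]; rfl,
    by simp only [Run.bobView, htr, hso, hy, hl]⟩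

theorem swap_other_views {B : Sizes} (f : Fin 2) (z : Fin 2 → Bool) {a : Base B}
    (hv : a.2.2.2.Valid (B.s f) B.left (B.s (other f))) :
    (mkRun f (flip (other f) z) (Base.swap f (other f) a)).aliceView f =
      (mkRun f z a).aliceView f ∧
    (mkRun f (flip (other f) z) (Base.swap f (other f) a)).bobView f f =
      (mkRun f z a).bobView f f := by
  obtain ⟨m, hsh, x, d⟩ := a
  simp only at hv
  have hzo : flip (other f) z f = z f := flip_ne (other_ne f).symm z
  set ω := mkRun f z (m, hsh, x, d) with hω
  set ω' := mkRun f (flip (other f) z) (Base.swap f (other f) (m, hsh, x, d)) with hω'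
  have key : ω'.left = ω.left ∧ ω'.y f = ω.y f ∧
      ω'.sel f = ω.sel f ∧ (ω'.Abort₁ f ↔ ω.Abort₁ f) ∧
      (ω'.Abort₂ f ↔ ω.Abort₂ f) ∧ (¬ω'.Abort₂ f → ω'.sel (other f) = ω.sel (other f)) := by
    rw [hω, hω', abort₁_mkRun, abort₁_mkRun, abort₂_mkRun, abort₂_mkRun]
    by_cases h : d.D ∈ (d.E'ᶜ ∩ d.L).powersetCard (B.s (other f)) ∧
      d.D' ∈ (d.E' ∩ d.L).powersetCard (B.s (other f))
    · obtain ⟨⟨hA, hAc⟩, ⟨hA', hAc'⟩⟩ :=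
        And.imp Finset.mem_powersetCard.1 Finset.mem_powersetCard.1 h
      rw [Finset.subset_inter_iff] at hA hA'
      have hc : d.D.card = d.D'.card := by rw [hAc, hAc']
      have hd : (Base.swap f (other f) (m, hsh, x, d)).2.2.2 =
          { d with E' := (d.E' \ d.D') ∪ d.D, D := d.D', D' := d.D } := by
        simp only [Base.swap, if_neg (other_ne f), Draws.swap₂, if_pos h]
      simp only [mkRun, hd, Draws.Abort₁, Draws.Abort₂,
        exchange_card_inter hA.1 hA'.1 hc d.L hA.2 hA'.2,
        exchange_card_compl_inter hA.1 hA'.1 hc d.L hA.2 hA'.2, Draws.pattern, if_true,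
        iff_self, true_and]
      refine ⟨?_, ?_, fun _ => ?_⟩
      · simp [Base.swap]
      · funext b
        simp [Draws.sel, hzo]
      · funext b
        simp only [Draws.sel, if_neg (other_ne f), flip_same]
        cases b <;> cases z (other f) <;> simp
    · have hd : Base.swap f (other f) (m, hsh, x, d) = (m, hsh, x, d) := by
        simp only [Base.swap, if_neg (other_ne f), Draws.swap₂, if_neg h]
      rw [hd]
      refine ⟨rfl, rfl, ?_, Iff.rfl, Iff.rfl, fun hab => absurd ?_ h⟩
      · funext b
        simp [mkRun, Draws.sel, hzo]
      · exact ⟨Finset.mem_powersetCard.2 ⟨hv.D_sub, hv.D_card hab⟩,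
          Finset.mem_powersetCard.2 ⟨hv.D'_sub, hv.D'_card hab⟩⟩
  obtain ⟨hl, hy, hsf, h1, h2, hso⟩ := key
  have htr : ω'.transcript f = ω.transcript f :=
    transcript_congr_of h1 h2 hl (fun _ => publicPart_congr rfl rfl rfl hsf)
      fun _ h => publicPart_congr rfl rfl rfl (hso h)
  exact ⟨by simp only [Run.aliceView, htr]; rfl,
    by simp only [Run.bobView, htr, hsf, hy, hl]⟩

theorem swap_views {B : Sizes} (f i : Fin 2) (z : Fin 2 → Bool) {a : Base B}
    (hv : a.2.2.2.Valid (B.s f) B.left (B.s (other f))) :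
    (mkRun f (flip i z) (Base.swap f i a)).aliceView f = (mkRun f z a).aliceView f ∧
    (mkRun f (flip i z) (Base.swap f i a)).bobView f (other i) =
      (mkRun f z a).bobView f (other i) := by
  rcases eq_or_eq_other f i with rfl | rfl
  · exact swap_first_views i z hv
  · rw [other_other]
    exact swap_other_views f z hv

theorem swapOutcome_views {H : (s k : ℕ) → TwoUniversal s k} {p : Fin 2 → unitInterval}
    {P : Shared} (i : Fin 2) {ω : BaseOutcome P} (hω : ω ∈ (outcomeLaw H p P).support) :
    Shared.U (mkOutcome (swapOutcome i ω)) = Shared.U (mkOutcome ω) ∧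
      Shared.V (other i) (mkOutcome (swapOutcome i ω)) = Shared.V (other i) (mkOutcome ω) := by
  have hs := outcomeLaw_support hω
  have ha := swap_views 0 i ω.1 (baseLaw_valid hs.1)
  have hb := swap_views 1 i ω.1 (baseLaw_valid hs.2)
  simp only [Shared.U, Shared.V, Shared.Z, mkOutcome, swapOutcome, ha.1, hb.1, ha.2, hb.2,
    flip_ne (other_ne i), and_self]

theorem pr_swapOutcome {H : (s k : ℕ) → TwoUniversal s k} {p : Fin 2 → unitInterval}
    {P : Shared} (i : Fin 2) {α : Type} (A A' : BaseOutcome P → α)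
    (h : ∀ ω ∈ (outcomeLaw H p P).support, A' (swapOutcome i ω) = A ω) (c : α) :
    pr (outcomeLaw H p P) A' c = pr (outcomeLaw H p P) A c := by
  rw [pr_eq_expect, pr_eq_expect, ← expect_swapOutcome H p P i]
  exact expect_congr_on fun ω hω => by rw [h ω hω]

/-- The exchange preserves the law, fixes the observation and complements the bit, so both values of
the bit are equally likely together with each observation. -/
theorem choice_independent (H : (s k : ℕ) → TwoUniversal s k) (p : Fin 2 → unitInterval)
    (P : Shared) (i : Fin 2) {γ : Type} [Fintype γ] (W : BaseOutcome P → γ)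
    (hW : ∀ ω ∈ (outcomeLaw H p P).support, W (swapOutcome i ω) = W ω) :
    mutualInfo (outcomeLaw H p P) (fun ω => ω.1 i) W = 0 := by
  refine mutualInfo_eq_zero_of_forall _ _ fun b b' w => ?_
  have key : ∀ b, pr (outcomeLaw H p P) (fun ω => (ω.1 i, W ω)) (!b, w) =
      pr (outcomeLaw H p P) (fun ω => (ω.1 i, W ω)) (b, w) := by
    intro b
    rw [pr_swapOutcome i (fun ω => (!ω.1 i, W ω)) (fun ω => (ω.1 i, W ω))]
    · exact pr_congr fun ω _ => by simp
    · intro ω hω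
      rw [hW ω hω]
      simp [swapOutcome, flip_same]
  have k1 := key false
  simp only [Bool.not_false] at k1
  cases b <;> cases b' <;> simp only [k1]

/-- The exchanges of the two receivers connect all four pairs of bits. -/
theorem choices_independent (H : (s k : ℕ) → TwoUniversal s k) (p : Fin 2 → unitInterval)
    (P : Shared) {γ : Type} [Fintype γ] (W : BaseOutcome P → γ)
    (hW : ∀ i, ∀ ω ∈ (outcomeLaw H p P).support, W (swapOutcome i ω) = W ω) :
    mutualInfo (outcomeLaw H p P) (fun ω => (ω.1 0, ω.1 1)) W = 0 := by
  refine mutualInfo_eq_zero_of_forall _ _ fun b b' w => ?_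
  have key0 : ∀ b c, pr (outcomeLaw H p P) (fun ω => ((ω.1 0, ω.1 1), W ω)) ((!b, c), w) =
      pr (outcomeLaw H p P) (fun ω => ((ω.1 0, ω.1 1), W ω)) ((b, c), w) := by
    intro b c
    rw [pr_swapOutcome 0 (fun ω => ((!ω.1 0, ω.1 1), W ω)) (fun ω => ((ω.1 0, ω.1 1), W ω))]
    · exact pr_congr fun ω _ => by simp
    · intro ω hω
      rw [hW 0 ω hω]
      simp [swapOutcome, flip_same, flip_ne]
  have key1 : ∀ b c, pr (outcomeLaw H p P) (fun ω => ((ω.1 0, ω.1 1), W ω)) ((b, !c), w) =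
      pr (outcomeLaw H p P) (fun ω => ((ω.1 0, ω.1 1), W ω)) ((b, c), w) := by
    intro b c
    rw [pr_swapOutcome 1 (fun ω => ((ω.1 0, !ω.1 1), W ω)) (fun ω => ((ω.1 0, ω.1 1), W ω))]
    · exact pr_congr fun ω _ => by simp
    · intro ω hω
      rw [hW 1 ω hω]
      simp [swapOutcome, flip_same, flip_ne]
  have e : ∀ b : Bool × Bool,
      pr (outcomeLaw H p P) (fun ω => ((ω.1 0, ω.1 1), W ω)) (b, w) =
      pr (outcomeLaw H p P) (fun ω => ((ω.1 0, ω.1 1), W ω)) ((false, false), w) := by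
    rintro ⟨b, c⟩
    have k1 := key0 false
    have k2 := key1 false false
    simp only [Bool.not_false] at k1 k2
    cases b <;> cases c <;> simp [k1, k2]
  rw [e b, e b']

/-- Alice and the other receiver together learn nothing about a choice bit. -/
theorem choice_hidden_eq_zero (H : (s k : ℕ) → TwoUniversal s k) (p : Fin 2 → unitInterval)
    (P : Shared) (i : Fin 2) :
    mutualInfo (P.law H p) (Shared.Z i) (fun ω => (Shared.U ω, Shared.V (other i) ω)) = 0 := by
  rw [law_eq, mutualInfo_map]
  exact choice_independent H p P i _ fun ω hω => by
    rw [(swapOutcome_views i hω).1, (swapOutcome_views i hω).2]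

/-- Alice learns nothing about the choice bits. -/
theorem choices_hidden_eq_zero (H : (s k : ℕ) → TwoUniversal s k) (p : Fin 2 → unitInterval)
    (P : Shared) :
    mutualInfo (P.law H p) (fun ω => (Shared.Z 0 ω, Shared.Z 1 ω)) Shared.U = 0 := by
  rw [law_eq, mutualInfo_map]
  exact choices_independent H p P _ fun i ω hω => (swapOutcome_views i hω).1

/-! ### Privacy amplification -/

theorem pmf_ext_expect {α : Type} [Fintype α] {μ ν : PMF α}
    (h : ∀ F : α → ℝ, expect μ F = expect ν F) : μ = ν :=
  pmf_ext_toReal fun a => by rw [← expect_ind_eq, ← expect_ind_eq, h]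

/-- The word that agrees with `v` on `Q` and with `x` elsewhere. -/
def mix {n : ℕ} (x v : Fin n → Bool) (Q : Finset (Fin n)) : Fin n → Bool :=
  fun l => if l ∈ Q then v l else x l

theorem expect_mix {n : ℕ} (Q : Finset (Fin n)) (F : (Fin n → Bool) → ℝ) :
    (expect (PMF.uniformOfFintype (Fin n → Bool)) fun x =>
      expect (PMF.uniformOfFintype (Fin n → Bool)) fun v => F (mix x v Q)) =
    expect (PMF.uniformOfFintype (Fin n → Bool)) F := by
  have h : ∑ x : (Fin n → Bool) × (Fin n → Bool), F (mix x.1 x.2 Q) =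
      ∑ x : (Fin n → Bool) × (Fin n → Bool), F x.1 := by
    -- Interchanging two words on `Q` is an involution of the pairs of words.
    refine Finset.sum_nbij' (fun x => (mix x.1 x.2 Q, mix x.2 x.1 Q))
      (fun x => (mix x.1 x.2 Q, mix x.2 x.1 Q)) (by simp) (by simp) ?_ ?_ (by simp)
    · rintro ⟨x, v⟩ _
      ext l <;> by_cases hl : l ∈ Q <;> simp [mix, hl]
    · rintro ⟨x, v⟩ _
      ext l <;> by_cases hl : l ∈ Q <;> simp [mix, hl]
  simp only [Fintype.sum_prod_type] at h
  simp only [expect_uniformOfFintype, ← Finset.sum_div, h]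
  have h0 : (Fintype.card (Fin n → Bool) : ℝ) ≠ 0 := by simp
  rw [div_left_inj' h0, div_eq_iff h0, Finset.sum_mul]
  exact Finset.sum_congr rfl fun x _ => by simp [mul_comm]

theorem prob_agree {n : ℕ} (Q : Finset (Fin n)) (v : Fin n → Bool) :
    (expect (PMF.uniformOfFintype (Fin n → Bool)) fun v' => ind (∀ l ∈ Q, v' l = v l)) =
      1 / 2 ^ Q.card := by
  have h : ∀ v' : Fin n → Bool, ind (∀ l ∈ Q, v' l = v l) =
      ∏ l, if l ∈ Q then ind (v' l = v l) else 1 := by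
    intro v'
    by_cases hv : ∀ l ∈ Q, v' l = v l
    · rw [ind_of hv, Finset.prod_eq_one]
      intro l _
      split_ifs with hl
      · exact ind_of (hv l hl)
      · rfl
    · rw [ind_of_not hv]
      push Not at hv
      obtain ⟨l, hl, hne⟩ := hv
      rw [Finset.prod_eq_zero (Finset.mem_univ l)]
      rw [if_pos hl, ind_of_not hne]
  rw [expect_uniformOfFintype]
  simp only [h]
  rw [← Fintype.prod_sum fun l b => if l ∈ Q then ind (b = v l) else 1]
  have h2 : ∀ l, (∑ b : Bool, if l ∈ Q then ind (b = v l) else 1) = if l ∈ Q then 1 else 2 := by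
    intro l
    split_ifs
    · cases v l <;> simp [ind_eq_ite]
    · simp
  simp only [h2]
  have h3 : (∏ l : Fin n, if l ∈ Q then (1 : ℝ) else 2) * 2 ^ Q.card = 2 ^ n := by
    have : (2 : ℝ) ^ Q.card = ∏ l : Fin n, if l ∈ Q then (2 : ℝ) else 1 := by simp
    rw [this, ← Finset.prod_mul_distrib]
    have : ∀ l : Fin n, ((if l ∈ Q then (1 : ℝ) else 2) * if l ∈ Q then (2 : ℝ) else 1) = 2 := by
      intro l; split_ifs <;> norm_num
    simp [this]
  rw [div_eq_div_iff (by simp) (by positivity), h3]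
  simp

/-- The amount of information about a `k`-bit string that may leak when it is masked with a key
extracted from a word with `q` unknown bits. -/
def leakBound (k q : ℕ) : ℝ := min (k : ℝ) (2 ^ k / 2 ^ q / Real.log 2)

theorem collision_le {s k : ℕ} (F : TwoUniversal s k) (w w' : Fin s → Bool) :
    (expect (PMF.uniformOfFinset F.funs F.nonempty) fun h => ind (h w = h w')) ≤
      1 / 2 ^ k + ind (w = w') := by
  by_cases hw : w = w'
  · rw [ind_of hw]
    have : (expect (PMF.uniformOfFinset F.funs F.nonempty) fun h => ind (h w = h w')) ≤ 1 :=
      expect_le_of_le fun _ _ => ind_le_one _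
    have : (0 : ℝ) ≤ 1 / 2 ^ k := by positivity
    linarith
  · rw [ind_of_not hw, add_zero, expect_uniformOfFinset]
    have h := F.collision w w' hw
    rw [one_div_pow] at h
    refine le_trans (le_of_eq ?_) h
    congr 1
    simp [ind_eq_ite, Finset.sum_boole]

section Leak

variable {τ : Type} [Fintype τ] {n s k : ℕ}

/-- The key extracted from the word `mix x v Q` at the positions `S`. -/
def mixedKey (s : ℕ) (S Q : Finset (Fin n)) (x v : Fin n → Bool) (h : HashFun s k) :
    Fin k → Bool :=
  h (subword (mix x v Q) S s)

/-- The joint law of side information, hash function, unknown word and secret string. -/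
def leakLaw (ν : PMF τ) (F : TwoUniversal s k) (n : ℕ) :
    PMF (τ × HashFun s k × (Fin n → Bool) × (Fin k → Bool)) :=
  ν.bind fun t => (PMF.uniformOfFinset F.funs F.nonempty).bind fun h =>
    (PMF.uniformOfFintype (Fin n → Bool)).bind fun v =>
      (PMF.uniformOfFintype (Fin k → Bool)).bind fun m => PMF.pure (t, h, v, m)

theorem expect_leakLaw (ν : PMF τ) (F : TwoUniversal s k)
    (G : τ × HashFun s k × (Fin n → Bool) × (Fin k → Bool) → ℝ) :
    expect (leakLaw ν F n) G = expect ν fun t =>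
      expect (PMF.uniformOfFinset F.funs F.nonempty) fun h =>
      expect (PMF.uniformOfFintype (Fin n → Bool)) fun v =>
      expect (PMF.uniformOfFintype (Fin k → Bool)) fun m => G (t, h, v, m) := by
  simp only [leakLaw, expect_bind, expect_pure]

/-- The left-hand side is the mean divergence of the key from the uniform distribution, in natural
units. It is trivially at most k log 2; by log t ≤ t - 1 it is also at most 2^k times the collision
probability of the key, minus 1. -/
theorem expect_log_key_le (F : TwoUniversal s k) (S Q : Finset (Fin n)) (x : Fin n → Bool)
    (hQ : Q ⊆ S) (hS : S.card ≤ s) :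
    (expect (PMF.uniformOfFinset F.funs F.nonempty) fun h =>
      expect (PMF.uniformOfFintype (Fin n → Bool)) fun v =>
        Real.log (2 ^ k * expect (PMF.uniformOfFintype (Fin n → Bool)) fun v' =>
          ind (mixedKey s S Q x v' h = mixedKey s S Q x v h))) ≤
      leakBound k Q.card * Real.log 2 := by
  have hpos : ∀ h v, 0 < (expect (PMF.uniformOfFintype (Fin n → Bool)) fun v' =>
      ind (mixedKey (k := k) s S Q x v' h = mixedKey s S Q x v h)) := by
    intro h v
    have := pr_pos (μ := PMF.uniformOfFintype (Fin n → Bool)) (fun v' => mixedKey s S Q x v' h)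
      (PMF.mem_support_uniformOfFintype v)
    rwa [pr_eq_expect] at this
  have h2 := log_two_pos
  rw [leakBound, min_mul_of_nonneg _ _ h2.le, div_mul_cancel₀ _ h2.ne']
  refine le_min ?_ ?_
  · refine expect_le_of_le fun h _ => expect_le_of_le fun v _ => ?_
    rw [← Real.log_pow]
    refine Real.log_le_log (mul_pos (by positivity) (hpos h v)) ?_
    exact mul_le_of_le_one_right (by positivity) (expect_le_of_le fun _ _ => ind_le_one _)
  · have h1 : ∀ h v, Real.log (2 ^ k * expect (PMF.uniformOfFintype (Fin n → Bool)) fun v' =>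
          ind (mixedKey s S Q x v' h = mixedKey s S Q x v h)) ≤
        2 ^ k * (expect (PMF.uniformOfFintype (Fin n → Bool)) fun v' =>
          ind (mixedKey (k := k) s S Q x v' h = mixedKey s S Q x v h)) - 1 := fun h v =>
      Real.log_le_sub_one_of_pos (mul_pos (by positivity) (hpos h v))
    refine (expect_mono fun h => expect_mono fun v => h1 h v).trans ?_
    simp only [expect_sub, expect_mul_left, expect_const]
    rw [expect_comm]
    -- Two keys collide by two-universality with probability at most 2^(-k), or because the two
    -- words agree on `Q`, which has probability 2^(-|Q|).
    have h3 : (expect (PMF.uniformOfFintype (Fin n → Bool)) fun v =>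
        expect (PMF.uniformOfFinset F.funs F.nonempty) fun h =>
        expect (PMF.uniformOfFintype (Fin n → Bool)) fun v' =>
          ind (mixedKey s S Q x v' h = mixedKey s S Q x v h)) ≤ 1 / 2 ^ k + 1 / 2 ^ Q.card := by
      refine expect_le_of_le fun v _ => ?_
      rw [expect_comm]
      refine (expect_mono fun v' => collision_le F _ _).trans ?_
      rw [expect_add, expect_const, ← prob_agree Q v]
      refine add_le_add_right (expect_mono fun v' => ind_mono fun h l hl => ?_) _
      have := subword_injOn hS h l (hQ hl)
      simpa [mix, hl] using this
    have h4 := mul_le_mul_of_nonneg_left h3 (by positivity : (0 : ℝ) ≤ 2 ^ k)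
    have h5 : (2 : ℝ) ^ k * (1 / 2 ^ k + 1 / 2 ^ Q.card) = 1 + 2 ^ k / 2 ^ Q.card := by
      field_simp
    linarith

/-- Leftover hashing: a string masked with the hash value of a word with `|Q|` unknown bits. -/
theorem mutualInfo_leak_le (ν : PMF τ) (F : TwoUniversal s k) (S Q : τ → Finset (Fin n))
    (x : τ → Fin n → Bool) (hQ : ∀ t, Q t ⊆ S t) (hS : ∀ t ∈ ν.support, (S t).card ≤ s) :
    mutualInfo (leakLaw ν F n) (fun ω => ω.2.2.2) (fun ω => (ω.1, ω.2.1, fun j =>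
      xor (ω.2.2.2 j) (mixedKey s (S ω.1) (Q ω.1) (x ω.1) ω.2.2.1 ω.2.1 j))) ≤
    expect ν fun t => leakBound k (Q t).card := by
  set u : HashFun s k → ℝ := fun h => (PMF.uniformOfFinset F.funs F.nonempty h).toReal
  set A : τ × HashFun s k × (Fin n → Bool) × (Fin k → Bool) → (Fin k → Bool) :=
    fun ω => ω.2.2.2 with hA
  set W : τ × HashFun s k × (Fin n → Bool) × (Fin k → Bool) → τ × HashFun s k × (Fin k → Bool) :=
    fun ω => (ω.1, ω.2.1, fun j =>
      xor (ω.2.2.2 j) (mixedKey s (S ω.1) (Q ω.1) (x ω.1) ω.2.2.1 ω.2.1 j)) with hW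
  set c : ℝ := 1 / 2 ^ k with hc
  have hunif : ∀ m : Fin k → Bool,
      (expect (PMF.uniformOfFintype (Fin k → Bool)) fun m' => ind (m' = m)) = c := by
    intro m
    rw [expect_ind_eq, uniformOfFintype_toReal]
    simp [hc]
  have prA : ∀ m, pr (leakLaw ν F n) A m = c := by
    intro m
    rw [pr_eq_expect, expect_leakLaw]
    simp only [hA, hunif, expect_const]
  have hxor : ∀ m κ e : Fin k → Bool, (fun j => xor (m j) (κ j)) = e ↔
      m = fun j => xor (e j) (κ j) := by
    intro m κ e
    constructor
    · rintro rfl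
      simp
    · rintro rfl
      simp
  -- The cipher alone is uniform because the string acts as a one-time pad.
  have prW : ∀ t h e, pr (leakLaw ν F n) W (t, h, e) = (ν t).toReal * (u h * c) := by
    intro t h e
    have hsplit : ∀ ω, ind (W ω = (t, h, e)) = ind (ω.1 = t) * (ind (ω.2.1 = h) *
        ind (ω.2.2.2 = fun j =>
          xor (e j) (mixedKey s (S ω.1) (Q ω.1) (x ω.1) ω.2.2.1 ω.2.1 j))) := by
      intro ω
      classical
      simp only [hW, Prod.mk.injEq, hxor, ind_eq_ite]
      split_ifs <;> simp_all
    rw [pr_eq_expect, expect_leakLaw]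
    simp only [hsplit, expect_mul_left, hunif, expect_const, expect_ind_mul]
    rfl
  have prAW : ∀ m t h e, pr (leakLaw ν F n) (fun ω => (A ω, W ω)) (m, t, h, e) =
      (ν t).toReal * (u h * (c * expect (PMF.uniformOfFintype (Fin n → Bool)) fun v' =>
        ind (mixedKey s (S t) (Q t) (x t) v' h = fun j => xor (m j) (e j)))) := by
    intro m t h e
    have hsplit : ∀ ω, ind ((A ω, W ω) = (m, t, h, e)) = ind (ω.1 = t) * (ind (ω.2.1 = h) *
        (ind (ω.2.2.2 = m) * ind (mixedKey s (S ω.1) (Q ω.1) (x ω.1) ω.2.2.1 ω.2.1 =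
          fun j => xor (m j) (e j)))) := by
      intro ω
      classical
      have : ∀ κ : Fin k → Bool, (fun j => xor (m j) (κ j)) = e ↔
          κ = fun j => xor (m j) (e j) := by
        intro κ
        constructor
        · rintro rfl
          simp
        · rintro rfl
          simp
      simp only [hA, hW, Prod.mk.injEq, ind_eq_ite, ← this]
      split_ifs <;> simp_all
    rw [pr_eq_expect, expect_leakLaw]
    simp only [hsplit, expect_mul_left, expect_mul_right, hunif, expect_ind_mul]
    rfl
  have h2 := log_two_pos
  rw [mutualInfo_eq_ent, ent, ent, ent, ← add_div, ← sub_div, ← expect_add, ← expect_sub,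
    div_le_iff₀ h2]
  -- The information density is the logarithm of the key's conditional probability relative to the
  -- uniform one.
  have hpt : ∀ ω ∈ (leakLaw ν F n).support,
      -Real.log (pr (leakLaw ν F n) A (A ω)) + -Real.log (pr (leakLaw ν F n) W (W ω)) -
        -Real.log (pr (leakLaw ν F n) (fun ω => (A ω, W ω)) (A ω, W ω)) =
      Real.log (2 ^ k * expect (PMF.uniformOfFintype (Fin n → Bool)) fun v' =>
          ind (mixedKey s (S ω.1) (Q ω.1) (x ω.1) v' ω.2.1 =
            mixedKey s (S ω.1) (Q ω.1) (x ω.1) ω.2.2.1 ω.2.1)) := by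
    intro ω hω
    have p1 := pr_pos A hω
    have p2 := pr_pos W hω
    have p3 := pr_pos (fun ω => (A ω, W ω)) hω
    have e1 : (fun j => xor (A ω j) ((W ω).2.2 j)) =
        mixedKey s (S ω.1) (Q ω.1) (x ω.1) ω.2.2.1 ω.2.1 := by
      funext j
      simp [hA, hW]
    have e2 : pr (leakLaw ν F n) (fun ω => (A ω, W ω)) (A ω, W ω) =
        pr (leakLaw ν F n) A (A ω) * pr (leakLaw ν F n) W (W ω) *
        (2 ^ k * expect (PMF.uniformOfFintype (Fin n → Bool)) fun v' =>
          ind (mixedKey s (S ω.1) (Q ω.1) (x ω.1) v' ω.2.1 =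
            mixedKey s (S ω.1) (Q ω.1) (x ω.1) ω.2.2.1 ω.2.1)) := by
      have w : W ω = (ω.1, ω.2.1, (W ω).2.2) := rfl
      rw [← e1, w, prAW, prW, prA, hc]
      field_simp
    have p4 : 0 < (2 : ℝ) ^ k * expect (PMF.uniformOfFintype (Fin n → Bool)) fun v' =>
          ind (mixedKey s (S ω.1) (Q ω.1) (x ω.1) v' ω.2.1 =
            mixedKey s (S ω.1) (Q ω.1) (x ω.1) ω.2.2.1 ω.2.1) := by
      have : 0 < pr (leakLaw ν F n) (fun ω => (A ω, W ω)) (A ω, W ω) := p3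
      rw [e2] at this
      exact pos_of_mul_pos_right this (mul_pos p1 p2).le
    rw [e2, Real.log_mul (mul_pos p1 p2).ne' p4.ne', Real.log_mul p1.ne' p2.ne']
    ring
  rw [expect_congr_on hpt, expect_leakLaw, ← expect_mul_right]
  simp only [expect_const]
  exact expect_mono_on fun t ht => expect_log_key_le F (S t) (Q t) (x t) (hQ t) (hS t ht)

end Leak

/-! ### Leakage in a run -/

/-- The value of the key `κ_{ib}` computed from the word `y`. -/
def Base.key {B : Sizes} (f : Fin 2) (z : Fin 2 → Bool) (i : Fin 2) (b : Bool) (a : Base B)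
    (y : Fin B.n → Bool) : Fin (B.k i) → Bool :=
  a.2.1 i b (subword y (a.2.2.2.sel f z i b) (B.s i))

/-- Replaces the channel input by `y` and changes the string `m_{ib}` such that its cipher stays
the same. -/
def Base.remask {B : Sizes} (f : Fin 2) (z : Fin 2 → Bool) (i : Fin 2) (b : Bool) (a : Base B)
    (y : Fin B.n → Bool) : Base B :=
  (setEntry (δ := fun i => Fin (B.k i) → Bool) a.1 i b
    (fun j => xor (xor (a.1 i b j) (a.key f z i b a.2.2.1 j)) (a.key f z i b y j)),
    a.2.1, y, a.2.2.2)

section Resample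

variable (H : (s k : ℕ) → TwoUniversal s k) (p : Fin 2 → unitInterval) (f : Fin 2) (B : Sizes)

theorem expect_baseLaw_setMsg (i : Fin 2) (b : Bool) (F : Base B → ℝ) :
    (expect (baseLaw H p f B) fun a =>
      expect (PMF.uniformOfFintype (Fin (B.k i) → Bool)) fun m =>
        F (setEntry (δ := fun i => Fin (B.k i) → Bool) a.1 i b m, a.2)) =
    expect (baseLaw H p f B) F := by
  simp only [expect_baseLaw]
  simp only [expect_comm (drawsLaw p f B) (PMF.uniformOfFintype (Fin (B.k i) → Bool)),
    expect_comm (PMF.uniformOfFintype (Fin B.n → Bool))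
      (PMF.uniformOfFintype (Fin (B.k i) → Bool)),
    expect_comm (PMF.uniformOfFinset (hashFinset H B) (hashFinset_nonempty H B))
      (PMF.uniformOfFintype (Fin (B.k i) → Bool))]
  exact expect_setEntry_msg B.k i b fun msg =>
      expect (PMF.uniformOfFinset (hashFinset H B) (hashFinset_nonempty H B)) fun hash =>
      expect (PMF.uniformOfFintype (Fin B.n → Bool)) fun x =>
      expect (drawsLaw p f B) fun d => F (msg, hash, x, d)

theorem expect_baseLaw_setHash (i : Fin 2) (b : Bool) (F : Base B → ℝ) :
    (expect (baseLaw H p f B) fun a =>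
      expect (PMF.uniformOfFinset (H (B.s i) (B.k i)).funs (H (B.s i) (B.k i)).nonempty) fun h =>
        F (a.1, setEntry (δ := fun i => HashFun (B.s i) (B.k i)) a.2.1 i b h, a.2.2)) =
    expect (baseLaw H p f B) F := by
  simp only [expect_baseLaw]
  congr 1
  funext msg
  simp only [expect_comm (drawsLaw p f B)
      (PMF.uniformOfFinset (H (B.s i) (B.k i)).funs (H (B.s i) (B.k i)).nonempty),
    expect_comm (PMF.uniformOfFintype (Fin B.n → Bool))
      (PMF.uniformOfFinset (H (B.s i) (B.k i)).funs (H (B.s i) (B.k i)).nonempty)]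
  exact expect_setEntry (fun i => (H (B.s i) (B.k i)).funs) (fun i => (H (B.s i) (B.k i)).nonempty)
    (hashFinset_nonempty H B) i b fun hash =>
      expect (PMF.uniformOfFintype (Fin B.n → Bool)) fun x =>
      expect (drawsLaw p f B) fun d => F (msg, hash, x, d)

theorem expect_baseLaw_mix (Q : Draws B.n → Finset (Fin B.n)) (F : Base B → ℝ) :
    (expect (baseLaw H p f B) fun a =>
      expect (PMF.uniformOfFintype (Fin B.n → Bool)) fun v =>
        F (a.1, a.2.1, mix a.2.2.1 v (Q a.2.2.2), a.2.2.2)) =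
    expect (baseLaw H p f B) F := by
  simp only [expect_baseLaw]
  congr 1
  funext msg
  congr 1
  funext hash
  rw [expect_comm, expect_comm _ (drawsLaw p f B)]
  congr 1
  funext d
  exact expect_mix (Q d) fun x => F (msg, hash, x, d)

/-- All data of a run are resampled that determine one key and one string. -/
theorem expect_baseLaw_resample (i : Fin 2) (b : Bool) (Q : Draws B.n → Finset (Fin B.n))
    (F : Base B → ℝ) :
    (expect (baseLaw H p f B) fun a =>
      expect (PMF.uniformOfFinset (H (B.s i) (B.k i)).funs (H (B.s i) (B.k i)).nonempty) fun h =>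
      expect (PMF.uniformOfFintype (Fin B.n → Bool)) fun v =>
      expect (PMF.uniformOfFintype (Fin (B.k i) → Bool)) fun m =>
        F (setEntry (δ := fun i => Fin (B.k i) → Bool) a.1 i b m,
          setEntry (δ := fun i => HashFun (B.s i) (B.k i)) a.2.1 i b h,
          mix a.2.2.1 v (Q a.2.2.2), a.2.2.2)) =
    expect (baseLaw H p f B) F := by
  have h1 := expect_baseLaw_setMsg H p f B i b F
  have h2 := expect_baseLaw_mix H p f B Q fun a =>
    expect (PMF.uniformOfFintype (Fin (B.k i) → Bool)) fun m =>
      F (setEntry (δ := fun i => Fin (B.k i) → Bool) a.1 i b m, a.2)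
  exact (expect_baseLaw_setHash H p f B i b fun a =>
    expect (PMF.uniformOfFintype (Fin B.n → Bool)) fun v =>
    expect (PMF.uniformOfFintype (Fin (B.k i) → Bool)) fun m =>
      F (setEntry (δ := fun i => Fin (B.k i) → Bool) a.1 i b m, a.2.1,
        mix a.2.2.1 v (Q a.2.2.2), a.2.2.2)).trans (h2.trans h1)

end Resample

theorem Draws.Valid.sel_card_le {n : ℕ} {d : Draws n} {s : Fin 2 → ℕ} {left : ℕ} {f : Fin 2}
    (h : d.Valid (s f) left (s (other f))) (z : Fin 2 → Bool) (i : Fin 2) (b : Bool) :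
    (d.sel f z i b).card ≤ s i := by
  rcases eq_or_eq_other f i with rfl | rfl
  · simp only [Draws.sel, if_true]
    split_ifs
    · exact h.A_le
    · exact h.A'_le
  · simp only [Draws.sel, if_neg (other_ne f)]
    split_ifs
    · exact h.D_le
    · exact h.D'_le

/-- Leakage about a string in a run that takes place in an independent environment `e`. -/
theorem mutualInfo_env_le (H : (s k : ℕ) → TwoUniversal s k) (p : Fin 2 → unitInterval)
    (f : Fin 2) (B : Sizes) {ε γ : Type} [Fintype ε] [Fintype γ] (ν : PMF ε)
    (z : ε → Fin 2 → Bool) (i : Fin 2) (β : ε → Bool) (W : ε × Base B → γ)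
    (hW : ∀ e a y, a.2.2.2.Valid (B.s f) B.left (B.s (other f)) →
      (∀ l ∉ a.2.2.2.hidden f (z e) i (β e), y l = a.2.2.1 l) →
      W (e, a.remask f (z e) i (β e) y) = W (e, a)) :
    mutualInfo (ν.bind fun e => (baseLaw H p f B).bind fun a => PMF.pure (e, a))
      (fun ω => ω.2.1 i (β ω.1)) W ≤
    expect (ν.bind fun e => (baseLaw H p f B).bind fun a => PMF.pure (e, a)) fun ω =>
      leakBound (B.k i) (ω.2.2.2.2.hidden f (z ω.1) i (β ω.1)).card := by
  set μ : PMF (ε × Base B) := ν.bind fun e => (baseLaw H p f B).bind fun a => PMF.pure (e, a)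
    with hμ
  let S : ε × Base B → Finset (Fin B.n) := fun t => t.2.2.2.2.sel f (z t.1) i (β t.1)
  let Q : ε × Base B → Finset (Fin B.n) := fun t => t.2.2.2.2.hidden f (z t.1) i (β t.1)
  let Φ : (ε × Base B) × HashFun (B.s i) (B.k i) × (Fin B.n → Bool) × (Fin (B.k i) → Bool) →
      ε × Base B := fun q =>
    (q.1.1, setEntry (δ := fun i => Fin (B.k i) → Bool) q.1.2.1 i (β q.1.1) q.2.2.2,
      setEntry (δ := fun i => HashFun (B.s i) (B.k i)) q.1.2.2.1 i (β q.1.1) q.2.1,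
      mix q.1.2.2.2.1 q.2.2.1 (Q q.1), q.1.2.2.2.2)
  have hsupp : ∀ t ∈ μ.support, t.2.2.2.2.Valid (B.s f) B.left (B.s (other f)) := by
    intro t ht
    simp only [hμ, PMF.mem_support_bind_iff, PMF.mem_support_pure_iff] at ht
    obtain ⟨e, -, a, ha, rfl⟩ := ht
    exact baseLaw_valid ha
  -- Replacing the hash function, the hidden input bits and the string by fresh independent ones
  -- does not change the law, which brings the run into the form of `mutualInfo_leak_le`.
  have hmap : μ = (leakLaw μ (H (B.s i) (B.k i)) B.n).map Φ := by
    refine pmf_ext_expect fun F => ?_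
    rw [expect_map, expect_leakLaw, hμ]
    simp only [expect_bind, expect_pure]
    congr 1
    funext e
    exact (expect_baseLaw_resample H p f B i (β e) (fun d => d.hidden f (z e) i (β e))
      fun a => F (e, a)).symm
  have key := mutualInfo_leak_le μ (H (B.s i) (B.k i)) S Q (fun t => t.2.2.2.1)
    (fun t => Finset.inter_subset_left) fun t ht => (hsupp t ht).sel_card_le _ _ _
  rw [hmap, mutualInfo_map, ← hmap]
  refine le_trans ?_ key
  have hA : (fun q => (Φ q).2.1 i (β (Φ q).1)) = fun q => q.2.2.2 := by
    funext q
    exact setEntry_same _ _ _ _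
  rw [hA]
  refine mutualInfo_le_of_factor _ fun q hq q' hq' h => ?_
  -- Remasking back to the word before the fresh bits were mixed in does not alter `W`. In the
  -- resulting expression the fresh string and bits occur only through the cipher, so `W` is a
  -- function of side information, hash function and cipher.
  have hcanon : ∀ q ∈ (leakLaw μ (H (B.s i) (B.k i)) B.n).support, W (Φ q) =
      W (q.1.1, setEntry (δ := fun i => Fin (B.k i) → Bool) q.1.2.1 i (β q.1.1)
          (fun j => xor (xor (q.2.2.2 j)
            (mixedKey (B.s i) (S q.1) (Q q.1) q.1.2.2.2.1 q.2.2.1 q.2.1 j))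
            (q.2.1 (subword q.1.2.2.2.1 (S q.1) (B.s i)) j)),
        setEntry (δ := fun i => HashFun (B.s i) (B.k i)) q.1.2.2.1 i (β q.1.1) q.2.1,
        q.1.2.2.2.1, q.1.2.2.2.2) := by
    intro q hq
    have hq1 : q.1 ∈ μ.support := by
      simp only [leakLaw, PMF.mem_support_bind_iff, PMF.mem_support_pure_iff] at hq
      obtain ⟨t, ht, _, _, _, _, _, _, rfl⟩ := hq
      exact ht
    have h1 := hW (Φ q).1 (Φ q).2 q.1.2.2.2.1 (hsupp q.1 hq1) (fun l hl => by
      have hl' : l ∉ Q q.1 := hl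
      simp [Φ, mix, hl'])
    rw [← show W ((Φ q).1, (Φ q).2) = W (Φ q) from rfl, ← h1]
    simp only [Base.remask, Base.key, Φ, setEntry_same, setEntry_setEntry]
    rfl
  rw [hcanon q hq, hcanon q' hq']
  simp only [Prod.mk.injEq] at h
  obtain ⟨h1, h2, h3⟩ := h
  have h3' := fun j => congrFun h3 j
  simp only [h3']
  rw [h1, h2]

/-! ### Invariance of views under remasking -/

/-- The cipher with label `(i, b)` is kept by construction, and the others read disjoint positions.
The input changes only at positions erased for `j`: if `j` is the other receiver by the definition
of `hidden`, and if `j` is `i` because the set with the unchosen label consists of his erasures. -/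
theorem remask_views {B : Sizes} {f : Fin 2} {z : Fin 2 → Bool} {i : Fin 2} {b : Bool}
    {a : Base B} {y : Fin B.n → Bool} (hv : a.2.2.2.Valid (B.s f) B.left (B.s (other f)))
    (hy : ∀ l ∉ a.2.2.2.hidden f z i b, y l = a.2.2.1 l) (j : Fin 2)
    (hj : j = other i ∨ b = !z i) :
    (mkRun f z (a.remask f z i b y)).bobView f j = (mkRun f z a).bobView f j := by
  refine bobView_congr f j rfl rfl rfl ?_ ?_ ?_ ?_
  · funext i' b'
    by_cases h : (i, b) = (i', b')
    · simp only [Prod.mk.injEq] at h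
      obtain ⟨rfl, rfl⟩ := h
      funext l
      simp [Run.cipher, mkRun, Base.remask, setEntry_same, Base.key]
    · have hs : subword y (a.2.2.2.sel f z i' b') (B.s i') =
          subword a.2.2.1 (a.2.2.2.sel f z i' b') (B.s i') := by
        refine subword_congr _ fun l hl => hy l fun hl' => ?_
        exact Finset.disjoint_left.1 (hv.sel_disjoint f z h) (Finset.mem_inter.1 hl').1 hl
      funext l
      have hm := setEntry_ne (δ := fun i => Fin (B.k i) → Bool) a.1 h
        (fun j => xor (xor (a.1 i b j) (a.key f z i b a.2.2.1 j)) (a.key f z i b y j))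
      simp only [Run.cipher, mkRun, Base.remask, hm, hs]
  · intro j
    simp [mkRun, Base.remask, received_observe]
  · intro j
    simp [mkRun, Base.remask, erased_observe]
  · have hsub : a.2.2.2.hidden f z i b ⊆ a.2.2.2.pattern f j := by
      rcases eq_or_eq_other i j with rfl | rfl
      · have hb : b = !z j := hj.resolve_left (other_ne j).symm
        rw [hb]
        exact Finset.inter_subset_left.trans (hv.sel_not_subset f z j)
      · exact Finset.inter_subset_right
    exact observe_congr fun l hl => hy l fun h => hl (hsub h)

/-! ### Security of the shared protocol -/

/-- A bound for the information about any string that leaks in a run. -/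
def runLeak (p : Fin 2 → unitInterval) (f : Fin 2) (B : Sizes) : ℝ :=
  expect (drawsLaw p f B) fun d =>
    leakBound (B.k f) (d.A ∩ d.E').card + leakBound (B.k f) (d.A' ∩ d.E').card +
    (leakBound (B.k (other f)) d.D.card + leakBound (B.k (other f)) d.D'.card)

/-- The probability that a run is aborted. -/
def abortProb (p : Fin 2 → unitInterval) (f : Fin 2) (B : Sizes) : ℝ :=
  expect (drawsLaw p f B) fun d => ind (d.Abort (B.s f) B.left (B.s (other f)))

theorem leakBound_nonneg (k q : ℕ) : 0 ≤ leakBound k q :=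
  le_min (Nat.cast_nonneg _) (div_nonneg (by positivity) log_two_pos.le)

theorem runLeak_nonneg (p : Fin 2 → unitInterval) (f : Fin 2) (B : Sizes) : 0 ≤ runLeak p f B :=
  expect_nonneg fun _ => add_nonneg (add_nonneg (leakBound_nonneg _ _) (leakBound_nonneg _ _))
    (add_nonneg (leakBound_nonneg _ _) (leakBound_nonneg _ _))

theorem abortProb_nonneg (p : Fin 2 → unitInterval) (f : Fin 2) (B : Sizes) :
    0 ≤ abortProb p f B :=
  expect_nonneg fun _ => ind_nonneg _

theorem leakBound_hidden_le {B : Sizes} {f : Fin 2} {d : Draws B.n}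
    (hv : d.Valid (B.s f) B.left (B.s (other f))) (z : Fin 2 → Bool) (i : Fin 2) (b : Bool) :
    leakBound (B.k i) (d.hidden f z i b).card ≤
      leakBound (B.k f) (d.A ∩ d.E').card + leakBound (B.k f) (d.A' ∩ d.E').card +
      (leakBound (B.k (other f)) d.D.card + leakBound (B.k (other f)) d.D'.card) := by
  have h1 := leakBound_nonneg (B.k f) (d.A ∩ d.E').card
  have h2 := leakBound_nonneg (B.k f) (d.A' ∩ d.E').card
  have h3 := leakBound_nonneg (B.k (other f)) d.D.card
  have h4 := leakBound_nonneg (B.k (other f)) d.D'.card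
  rcases eq_or_eq_other f i with rfl | rfl
  · rw [Draws.hidden_first]
    split_ifs <;> linarith
  · rw [hv.hidden_other]
    split_ifs <;> linarith

section Shared

variable {H : (s k : ℕ) → TwoUniversal s k} {p : Fin 2 → unitInterval} {P : Shared}

theorem expect_leakBound_le {Ω : Type} [Fintype Ω] {μ : PMF Ω} {f : Fin 2} {B : Sizes}
    {R : Ω → (Fin 2 → Bool) × Base B} (hR : μ.map R = runBaseLaw H p f B) (i : Fin 2)
    (β : (Fin 2 → Bool) → Bool) :
    (expect μ fun ω => leakBound (B.k i)
      ((R ω).2.2.2.2.hidden f (R ω).1 i (β (R ω).1)).card) ≤ runLeak p f B := by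
  rw [runLeak, ← expect_draws_of_map hR fun d =>
    leakBound (B.k f) (d.A ∩ d.E').card + leakBound (B.k f) (d.A' ∩ d.E').card +
    (leakBound (B.k (other f)) d.D.card + leakBound (B.k (other f)) d.D'.card)]
  exact expect_mono_on fun ω hω =>
    leakBound_hidden_le (baseLaw_valid (mem_support_of_map hR hω)) _ _ _

/-- Remasking in the first run. -/
def remaskA (i : Fin 2) (b : Bool) (y : Fin P.a.n → Bool) (ω : BaseOutcome P) : BaseOutcome P :=
  (ω.1, ω.2.1.remask 0 ω.1 i b y, ω.2.2)

/-- Remasking in the second run. -/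
def remaskB (i : Fin 2) (b : Bool) (y : Fin P.b.n → Bool) (ω : BaseOutcome P) : BaseOutcome P :=
  (ω.1, ω.2.1, ω.2.2.remask 1 ω.1 i b y)

/-- The observation `W` is compatible with any remasking of the key `κ_{ib}`, where `b` is
determined by the choice bits. -/
structure Blind (i : Fin 2) (β : (Fin 2 → Bool) → Bool) {γ : Type} (W : BaseOutcome P → γ) :
    Prop where
  a : ∀ ω y, ω.2.1.2.2.2.Valid (P.a.s 0) P.a.left (P.a.s (other 0)) →
    (∀ l ∉ ω.2.1.2.2.2.hidden 0 ω.1 i (β ω.1), y l = ω.2.1.2.2.1 l) →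
    W (remaskA i (β ω.1) y ω) = W ω
  b : ∀ ω y, ω.2.2.2.2.2.Valid (P.b.s 1) P.b.left (P.b.s (other 1)) →
    (∀ l ∉ ω.2.2.2.2.2.hidden 1 ω.1 i (β ω.1), y l = ω.2.2.2.2.1 l) →
    W (remaskB i (β ω.1) y ω) = W ω

theorem Blind.prod {i : Fin 2} {β : (Fin 2 → Bool) → Bool} {γ δ : Type}
    {W : BaseOutcome P → γ} {W' : BaseOutcome P → δ} (h : Blind i β W) (h' : Blind i β W') :
    Blind i β fun ω => (W ω, W' ω) where
  a ω y hv hy := by rw [h.a ω y hv hy, h'.a ω y hv hy]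
  b ω y hv hy := by rw [h.b ω y hv hy, h'.b ω y hv hy]

theorem blind_V (i : Fin 2) (β : (Fin 2 → Bool) → Bool) (j : Fin 2)
    (hj : j = other i ∨ ∀ z, β z = !z i) :
    Blind i β fun ω : BaseOutcome P => Shared.V j (mkOutcome ω) where
  a ω y hv hy := by
    have := remask_views hv hy j (hj.imp_right fun h => h ω.1)
    simp only [Shared.V, Shared.Z, mkOutcome, remaskA, this]
  b ω y hv hy := by
    have := remask_views hv hy j (hj.imp_right fun h => h ω.1)
    simp only [Shared.V, Shared.Z, mkOutcome, remaskB, this]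

theorem blind_M (i : Fin 2) (β : (Fin 2 → Bool) → Bool) (j : Fin 2) (β' : (Fin 2 → Bool) → Bool)
    (h : ∀ z, (i, β z) ≠ (j, β' z)) :
    Blind i β fun ω : BaseOutcome P => Shared.M j (β' ω.1) (mkOutcome ω) where
  a ω y _ _ := by
    simp only [Shared.M, mkOutcome, remaskA, mkRun, Base.remask]
    rw [setEntry_ne (δ := fun i => Fin (P.a.k i) → Bool) _ (h ω.1)]
  b ω y _ _ := by
    simp only [Shared.M, mkOutcome, remaskB, mkRun, Base.remask]
    rw [setEntry_ne (δ := fun i => Fin (P.b.k i) → Bool) _ (h ω.1)]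

theorem blind_Z (i : Fin 2) (β : (Fin 2 → Bool) → Bool) (j : Fin 2) :
    Blind i β fun ω : BaseOutcome P => ω.1 j where
  a _ _ _ _ := rfl
  b _ _ _ _ := rfl

/-- The choice bits and the second run form the independent environment that `mutualInfo_env_le`
requires. -/
theorem outcomeLaw_eq_map_a (H : (s k : ℕ) → TwoUniversal s k) (p : Fin 2 → unitInterval)
    (P : Shared) :
    outcomeLaw H p P =
      ((((PMF.uniformOfFintype (Fin 2 → Bool)).bind fun z => (baseLaw H p 1 P.b).bind fun b =>
        PMF.pure (z, b)).bind fun e => (baseLaw H p 0 P.a).bind fun a => PMF.pure (e, a)).map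
          fun q => (q.1.1, q.2, q.1.2)) := by
  simp only [outcomeLaw, PMF.map_bind, PMF.bind_bind, PMF.pure_bind, PMF.pure_map]
  congr 1
  funext z
  rw [PMF.bind_comm]

theorem outcomeLaw_eq_map_b (H : (s k : ℕ) → TwoUniversal s k) (p : Fin 2 → unitInterval)
    (P : Shared) :
    outcomeLaw H p P =
      ((((PMF.uniformOfFintype (Fin 2 → Bool)).bind fun z => (baseLaw H p 0 P.a).bind fun a =>
        PMF.pure (z, a)).bind fun e => (baseLaw H p 1 P.b).bind fun b => PMF.pure (e, b)).map
          fun q => (q.1.1, q.1.2, q.2)) := by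
  simp only [outcomeLaw, PMF.map_bind, PMF.bind_bind, PMF.pure_bind, PMF.pure_map]

theorem mutualInfo_msg_a_le (H : (s k : ℕ) → TwoUniversal s k) (p : Fin 2 → unitInterval)
    (P : Shared) (i : Fin 2) (β : (Fin 2 → Bool) → Bool) {γ : Type} [Fintype γ]
    (W : BaseOutcome P → γ)
    (hW : ∀ ω y, ω.2.1.2.2.2.Valid (P.a.s 0) P.a.left (P.a.s (other 0)) →
      (∀ l ∉ ω.2.1.2.2.2.hidden 0 ω.1 i (β ω.1), y l = ω.2.1.2.2.1 l) →
      W (remaskA i (β ω.1) y ω) = W ω) :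
    mutualInfo (outcomeLaw H p P) (fun ω => ω.2.1.1 i (β ω.1)) W ≤ runLeak p 0 P.a := by
  have h1 := expect_leakBound_le (outcomeLaw_map_a H p P) i β
  dsimp only at h1
  rw [outcomeLaw_eq_map_a, expect_map] at h1
  have h2 := mutualInfo_env_le H p 0 P.a ((PMF.uniformOfFintype (Fin 2 → Bool)).bind fun z =>
    (baseLaw H p 1 P.b).bind fun e => PMF.pure (z, e)) (fun e => e.1) i (fun e => β e.1)
    (fun q => W (q.1.1, q.2, q.1.2)) fun e a y hv hy => hW (e.1, a, e.2) y hv hy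
  rw [outcomeLaw_eq_map_a, mutualInfo_map]
  exact h2.trans h1

theorem mutualInfo_msg_b_le (H : (s k : ℕ) → TwoUniversal s k) (p : Fin 2 → unitInterval)
    (P : Shared) (i : Fin 2) (β : (Fin 2 → Bool) → Bool) {γ : Type} [Fintype γ]
    (W : BaseOutcome P → γ)
    (hW : ∀ ω y, ω.2.2.2.2.2.Valid (P.b.s 1) P.b.left (P.b.s (other 1)) →
      (∀ l ∉ ω.2.2.2.2.2.hidden 1 ω.1 i (β ω.1), y l = ω.2.2.2.2.1 l) →
      W (remaskB i (β ω.1) y ω) = W ω) :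
    mutualInfo (outcomeLaw H p P) (fun ω => ω.2.2.1 i (β ω.1)) W ≤ runLeak p 1 P.b := by
  have h1 := expect_leakBound_le (outcomeLaw_map_b H p P) i β
  dsimp only at h1
  rw [outcomeLaw_eq_map_b, expect_map] at h1
  have h2 := mutualInfo_env_le H p 1 P.b ((PMF.uniformOfFintype (Fin 2 → Bool)).bind fun z =>
    (baseLaw H p 0 P.a).bind fun e => PMF.pure (z, e)) (fun e => e.1) i (fun e => β e.1)
    (fun q => W (q.1.1, q.1.2, q.2)) fun e a y hv hy => hW (e.1, e.2, a) y hv hy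
  rw [outcomeLaw_eq_map_b, mutualInfo_map]
  exact h2.trans h1

/-- Whoever is blind for the key of a string learns little about the string. -/
theorem mutualInfo_M_le (H : (s k : ℕ) → TwoUniversal s k) (p : Fin 2 → unitInterval)
    (P : Shared) {i : Fin 2} {β : (Fin 2 → Bool) → Bool} {γ : Type} [Fintype γ]
    {W : BaseOutcome P → γ} (hW : Blind i β W) :
    mutualInfo (outcomeLaw H p P) (fun ω => Shared.M i (β ω.1) (mkOutcome ω)) W ≤
      runLeak p 0 P.a + runLeak p 1 P.b := by
  -- The string has a piece in each run. Each piece is treated with the other one added to the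
  -- observation, which remasking in the opposite run does not affect.
  refine (mutualInfo_pair_le (μ := outcomeLaw H p P) (fun ω => ω.2.1.1 i (β ω.1))
    (fun ω => ω.2.2.1 i (β ω.1)) W).trans (add_le_add ?_ ?_)
  · exact mutualInfo_msg_a_le H p P i β _ fun ω y hv hy => by rw [hW.a ω y hv hy]; rfl
  · exact mutualInfo_msg_b_le H p P i β _ fun ω y hv hy => by rw [hW.b ω y hv hy]; rfl

theorem unchosen_hidden_le (H : (s k : ℕ) → TwoUniversal s k) (p : Fin 2 → unitInterval)
    (P : Shared) :
    mutualInfo (P.law H p) (fun ω => (Shared.Munchosen 0 ω, Shared.Munchosen 1 ω))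
      (fun ω => (Shared.V 0 ω, Shared.V 1 ω)) ≤ 2 * (runLeak p 0 P.a + runLeak p 1 P.b) := by
  rw [law_eq, mutualInfo_map]
  refine (mutualInfo_pair_le _ _ _).trans ?_
  have hV : ∀ i, Blind i (fun z => !z i) fun ω : BaseOutcome P =>
      (Shared.V 0 (mkOutcome ω), Shared.V 1 (mkOutcome ω)) := fun i =>
    (blind_V i _ 0 (Or.inr fun _ => rfl)).prod (blind_V i _ 1 (Or.inr fun _ => rfl))
  have h0 := mutualInfo_M_le H p P ((hV 0).prod (blind_M 0 _ 1 (fun z => !z 1) (by simp)))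
  have h1 := mutualInfo_M_le H p P ((hV 1).prod (blind_M 1 _ 0 (fun z => !z 0) (by simp)))
  rw [two_mul]
  exact add_le_add h0 h1

/-- The four variables are split off one at a time. Each of the three strings costs one pair of run
leakages, since the rest is blind for its key; the choice bit costs nothing by the exchange
symmetry. -/
theorem receivers_separated_le (H : (s k : ℕ) → TwoUniversal s k) (p : Fin 2 → unitInterval)
    (P : Shared) (i : Fin 2) :
    mutualInfo (P.law H p) (fun ω => (Shared.M i false ω, Shared.M i true ω,
      Shared.Munchosen (other i) ω, Shared.Z i ω)) (Shared.V (other i)) ≤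
      3 * (runLeak p 0 P.a + runLeak p 1 P.b) := by
  rw [law_eq, mutualInfo_map]
  have s1 := mutualInfo_pair_le (μ := outcomeLaw H p P)
    (fun ω => Shared.M i false (mkOutcome ω))
    (fun ω => (Shared.M i true (mkOutcome ω), Shared.Munchosen (other i) (mkOutcome ω),
      Shared.Z i (mkOutcome ω))) (fun ω => Shared.V (other i) (mkOutcome ω))
  have s2 := mutualInfo_pair_le (μ := outcomeLaw H p P)
    (fun ω => Shared.M i true (mkOutcome ω))
    (fun ω => (Shared.Munchosen (other i) (mkOutcome ω), Shared.Z i (mkOutcome ω)))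
    (fun ω => (Shared.V (other i) (mkOutcome ω), Shared.M i false (mkOutcome ω)))
  have s3 := mutualInfo_pair_le' (μ := outcomeLaw H p P)
    (fun ω => Shared.Munchosen (other i) (mkOutcome ω)) (fun ω => Shared.Z i (mkOutcome ω))
    (fun ω => ((Shared.V (other i) (mkOutcome ω), Shared.M i false (mkOutcome ω)),
      Shared.M i true (mkOutcome ω)))
  have s4 : mutualInfo (outcomeLaw H p P) (fun ω => Shared.Z i (mkOutcome ω))
      (fun ω => ((Shared.V (other i) (mkOutcome ω), Shared.M i false (mkOutcome ω)),
        Shared.M i true (mkOutcome ω))) = 0 :=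
    choice_independent H p P i _ fun ω hω => by
      rw [(swapOutcome_views i hω).2]
      rfl
  have bV : ∀ b, Blind i (fun _ => b) fun ω : BaseOutcome P =>
      Shared.V (other i) (mkOutcome ω) := fun b => blind_V i _ (other i) (Or.inl rfl)
  have bU : ∀ b, Blind i (fun _ => b) fun ω : BaseOutcome P =>
      Shared.Munchosen (other i) (mkOutcome ω) := fun b =>
    blind_M i _ (other i) (fun z => !z (other i)) fun z h =>
      other_ne i (Prod.ext_iff.1 h).1.symm
  have t1 := mutualInfo_M_le H p P ((bV false).prod
    ((blind_M i _ i (fun _ => true) (by simp)).prod ((bU false).prod (blind_Z i _ i))))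
  have t2 := mutualInfo_M_le H p P (((bV true).prod (blind_M i _ i (fun _ => false) (by simp))).prod
    ((bU true).prod (blind_Z i _ i)))
  have bM : ∀ b, Blind (other i) (fun z => !z (other i)) fun ω : BaseOutcome P =>
      Shared.M i b (mkOutcome ω) := fun b =>
    blind_M (other i) _ i (fun _ => b) fun z h => other_ne i (Prod.ext_iff.1 h).1
  have t3 := mutualInfo_M_le H p P ((((blind_V (other i) (fun z => !z (other i)) (other i)
    (Or.inr fun _ => rfl)).prod (bM false)).prod (bM true)).prod (blind_Z _ _ i))
  have e1 := s1.trans (add_le_add t1 s2)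
  have e3 := s3.trans (add_le_add t3 s4.le)
  have e2 := e1.trans (add_le_add_right (add_le_add t2 e3) _)
  exact e2.trans_eq (by ring)

/-- The set with the chosen label was received in full, so the receiver computes the same hash value
as Alice: aborts are the only errors. -/
theorem estimate_eq {B : Sizes} {f : Fin 2} {z : Fin 2 → Bool} {a : Base B}
    (hv : a.2.2.2.Valid (B.s f) B.left (B.s (other f)))
    (h : ¬a.2.2.2.Abort (B.s f) B.left (B.s (other f))) (i : Fin 2) :
    (mkRun f z a).estimate f i (z i) = some (a.1 i (z i)) := by
  have h1 : ¬(mkRun f z a).Abort₁ f := fun c => h (Or.inl ((abort₁_mkRun f z a).1 c))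
  have h2 : ¬(mkRun f z a).Abort₂ f := fun c => h (Or.inr ((abort₂_mkRun f z a).1 c))
  rw [Run.estimate, if_neg (by tauto)]
  have hs : subword (fun l => ((mkRun f z a).y i l).getD false) ((mkRun f z a).sel i (z i))
      (B.s i) = subword (mkRun f z a).x ((mkRun f z a).sel i (z i)) (B.s i) := by
    refine subword_congr _ fun l hl => ?_
    have : l ∉ a.2.2.2.pattern f i := by simpa using hv.sel_subset f z i hl
    simp [mkRun, observe, this]
  rw [hs]
  congr 1
  exact (msg_eq_cipher (mkRun f z a) i (z i)).symm

theorem prob_Err_le (H : (s k : ℕ) → TwoUniversal s k) (p : Fin 2 → unitInterval)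
    (P : Shared) (i : Fin 2) :
    prob (P.law H p) (Shared.Err i) ≤ abortProb p 0 P.a + abortProb p 1 P.b := by
  rw [prob_Err, abortProb, abortProb, ← expect_draws_of_map (outcomeLaw_map_a H p P)
    fun d => ind (d.Abort (P.a.s 0) P.a.left (P.a.s (other 0))),
    ← expect_draws_of_map (outcomeLaw_map_b H p P)
    fun d => ind (d.Abort (P.b.s 1) P.b.left (P.b.s (other 1))), ← expect_add]
  refine expect_mono_on fun ω hω => le_trans (ind_mono fun h => ?_) (ind_or_le _ _)
  by_contra hc
  push Not at hc
  have hs := outcomeLaw_support hω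
  exact h ⟨estimate_eq (baseLaw_valid hs.1) hc.1 i, estimate_eq (baseLaw_valid hs.2) hc.2 i⟩

open Filter Topology in
theorem secure_of_tendsto (H : (s k : ℕ) → TwoUniversal s k) (p : Fin 2 → unitInterval)
    (P : ℕ → Shared)
    (habort : Tendsto (fun n => abortProb p 0 (P n).a + abortProb p 1 (P n).b) atTop (𝓝 0))
    (hleak : Tendsto (fun n => runLeak p 0 (P n).a + runLeak p 1 (P n).b) atTop (𝓝 0)) :
    SecureColluding H p P where
  correct i := squeeze_zero (fun _ => ENNReal.toReal_nonneg) (fun n => prob_Err_le H p (P n) i)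
    habort
  unchosen_hidden := squeeze_zero
    (fun n => by rw [law_eq, mutualInfo_map]; exact mutualInfo_nonneg _ _)
    (fun n => unchosen_hidden_le H p (P n)) (by simpa using hleak.const_mul 2)
  choice_hidden_collusion i := by
    simp only [choice_hidden_eq_zero]
    exact tendsto_const_nhds
  choices_hidden := by
    simp only [choices_hidden_eq_zero]
    exact tendsto_const_nhds
  receivers_separated i := squeeze_zero
    (fun n => by rw [law_eq, mutualInfo_map]; exact mutualInfo_nonneg _ _)
    (fun n => receivers_separated_le H p (P n) i) (by simpa using hleak.const_mul 3)

end Shared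

/-! ### Concentration -/

/-- The exponentially small tail probability used throughout. -/
def tail (δ : ℝ) (n : ℕ) : ℝ := Real.exp (-(δ ^ 2 / 4 * n))

theorem tail_nonneg (δ : ℝ) (n : ℕ) : 0 ≤ tail δ n := (Real.exp_pos _).le

/-- Uses exp(-t) ≤ 1 - t + t² on the unit interval and 1 + u ≤ exp u. -/
theorem one_add_mul_exp_le {p t : ℝ} (hp0 : 0 ≤ p) (hp1 : p ≤ 1) (ht0 : 0 ≤ t) (ht1 : t ≤ 1) :
    p * Real.exp (-t) + (1 - p) ≤ Real.exp (-(t * p) + t ^ 2) := by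
  have h1 := Real.abs_exp_sub_one_sub_id_le (x := -t) (by rwa [abs_neg, abs_of_nonneg ht0])
  have h2 := (abs_le.1 h1).2
  have h3 := Real.add_one_le_exp (-(t * p) + t ^ 2)
  nlinarith [mul_le_mul_of_nonneg_left h2 hp0, sq_nonneg t,
    mul_le_of_le_one_left (sq_nonneg t) hp1]

/-- Chernoff's bound for a count with a moment generating function of product form. -/
theorem chernoff {n : ℕ} {μ : PMF (Finset (Fin n))} {X : Finset (Fin n) → ℕ} {m : ℕ} {c r δ : ℝ}
    (hr0 : 0 ≤ r) (hr1 : r ≤ 1) (hδ0 : 0 ≤ δ) (hδ1 : δ ≤ 1) (hm : m ≤ n)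
    (hc : c ≤ 0 ∨ c ≤ r * m - δ * n)
    (hX : ∀ t : ℝ, (expect μ fun E => Real.exp (-t) ^ X E) = (r * Real.exp (-t) + (1 - r)) ^ m) :
    (expect μ fun E => ind ((X E : ℝ) < c)) ≤ tail δ n := by
  rcases hc with hc | hc
  · simp only [ind_of_not (not_lt.2 (hc.trans (Nat.cast_nonneg _))), expect_const]
    exact tail_nonneg δ n
  -- Markov's inequality with t = δ/2. The exponent becomes -δ²n/2 + δ²m/4, which `m ≤ n` turns into
  -- that of `tail`.
  have hpt : ∀ E, ind ((X E : ℝ) < c) ≤ Real.exp (δ / 2 * (r * m - δ * n)) *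
      Real.exp (-(δ / 2)) ^ X E := by
    intro E
    by_cases h : (X E : ℝ) < c
    · rw [ind_of h, ← Real.exp_nat_mul, ← Real.exp_add]
      exact Real.one_le_exp (by nlinarith)
    · rw [ind_of_not h]
      positivity
  refine (expect_mono hpt).trans ?_
  rw [expect_mul_left, hX]
  have hb := one_add_mul_exp_le hr0 hr1 (by linarith : 0 ≤ δ / 2) (by linarith : δ / 2 ≤ 1)
  have h0 : 0 ≤ r * Real.exp (-(δ / 2)) + (1 - r) :=
    add_nonneg (mul_nonneg hr0 (Real.exp_pos _).le) (by linarith)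
  refine (mul_le_mul_of_nonneg_left (pow_le_pow_left₀ h0 hb m) (Real.exp_pos _).le).trans ?_
  rw [← Real.exp_nat_mul, ← Real.exp_add, tail]
  refine Real.exp_le_exp.2 ?_
  have : (m : ℝ) ≤ n := by exact_mod_cast hm
  nlinarith [mul_le_mul_of_nonneg_left this (sq_nonneg δ)]

theorem expect_pow_card_inter (p : unitInterval) {n : ℕ} (S : Finset (Fin n)) (c : ℝ) :
    (expect (erasureLaw p n) fun E => c ^ (S ∩ E).card) = (p * c + (1 - p)) ^ S.card := by
  have h := expect_erasureLaw_prod p n (fun l => if l ∈ S then c else 1) fun _ => 1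
  have h1 : ∀ E : Finset (Fin n),
      (∏ l, if l ∈ E then (if l ∈ S then c else 1) else 1) = c ^ (S ∩ E).card := by
    intro E
    rw [← Finset.prod_filter, Finset.filter_univ_mem, ← Finset.prod_filter, Finset.prod_const,
      Finset.filter_mem_eq_inter, Finset.inter_comm]
  have h2 : ∀ l : Fin n, (p : ℝ) * (if l ∈ S then c else 1) + (1 - p) * 1 =
      if l ∈ S then p * c + (1 - p) else 1 := by
    intro l
    split_ifs <;> ring
  simp only [h1, h2] at h
  rw [h, Finset.prod_ite_mem, Finset.univ_inter, Finset.prod_const]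

theorem expect_pow_card_compl_inter (p : unitInterval) {n : ℕ} (S : Finset (Fin n)) (c : ℝ) :
    (expect (erasureLaw p n) fun E => c ^ (Eᶜ ∩ S).card) =
      ((1 - p) * c + (1 - (1 - p))) ^ S.card := by
  have h := expect_erasureLaw_prod p n (fun _ => 1) fun l => if l ∈ S then c else 1
  have h1 : ∀ E : Finset (Fin n),
      (∏ l, if l ∈ E then 1 else (if l ∈ S then c else 1)) = c ^ (Eᶜ ∩ S).card := by
    intro E
    have : ∀ l, (if l ∈ E then 1 else (if l ∈ S then c else 1)) = if l ∈ Eᶜ ∩ S then c else 1 := by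
      intro l
      by_cases h1 : l ∈ E <;> by_cases h2 : l ∈ S <;> simp [h1, h2]
    simp only [this, Finset.prod_ite_mem, Finset.univ_inter, Finset.prod_const]
  have h2 : ∀ l : Fin n, (p : ℝ) * 1 + (1 - p) * (if l ∈ S then c else 1) =
      if l ∈ S then (1 - p) * c + (1 - (1 - p)) else 1 := by
    intro l
    split_ifs <;> ring
  simp only [h1, h2] at h
  rw [h, Finset.prod_ite_mem, Finset.univ_inter, Finset.prod_const]

section Tails

variable {p : unitInterval} {n : ℕ} {c δ : ℝ}

theorem prob_card_inter_lt (S : Finset (Fin n)) (hδ0 : 0 ≤ δ) (hδ1 : δ ≤ 1)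
    (hc : c ≤ 0 ∨ c ≤ p * S.card - δ * n) :
    (expect (erasureLaw p n) fun E => ind (((S ∩ E).card : ℝ) < c)) ≤ tail δ n :=
  chernoff p.2.1 p.2.2 hδ0 hδ1 (card_finset_fin_le S) hc fun _ => expect_pow_card_inter p S _

theorem prob_card_compl_inter_lt (S : Finset (Fin n)) (hδ0 : 0 ≤ δ) (hδ1 : δ ≤ 1)
    (hc : c ≤ 0 ∨ c ≤ (1 - p) * S.card - δ * n) :
    (expect (erasureLaw p n) fun E => ind (((Eᶜ ∩ S).card : ℝ) < c)) ≤ tail δ n :=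
  chernoff (sub_nonneg.2 p.2.2) (sub_le_self _ p.2.1) hδ0 hδ1 (card_finset_fin_le S) hc
    fun _ => expect_pow_card_compl_inter p S _

end Tails

/-! ### Sizes with a margin -/

/-- All sizes of a run keep a margin of `δ n` to what the channel provides on average. -/
structure Sizes.Margin (p : Fin 2 → unitInterval) (f : Fin 2) (B : Sizes) (δ : ℝ) : Prop where
  received_first : B.s f = 0 ∨ (B.s f : ℝ) ≤ (1 - p f) * B.n - δ * B.n
  erased_first : B.s f + B.left = 0 ∨ ((B.s f + B.left : ℕ) : ℝ) ≤ p f * B.n - δ * B.n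
  received_other : B.s (other f) = 0 ∨
    (B.s (other f) : ℝ) ≤ (1 - p (other f)) * B.left - δ * B.n
  erased_other : B.s (other f) = 0 ∨ (B.s (other f) : ℝ) ≤ p (other f) * B.left - δ * B.n
  key_first : B.k f = 0 ∨ (B.k f : ℝ) + δ * B.n ≤ p (other f) * B.s f - δ * B.n
  key_other : B.k (other f) = 0 ∨ (B.k (other f) : ℝ) + δ * B.n ≤ B.s (other f)
  k_le : ∀ i, B.k i ≤ B.n

section Margin

variable {p : Fin 2 → unitInterval} {f : Fin 2} {B : Sizes} {δ : ℝ}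

theorem Sizes.Margin.abort₁_le (h : B.Margin p f δ) (hδ0 : 0 ≤ δ) (hδ1 : δ ≤ 1) :
    (expect (drawsLaw p f B) fun d => ind (d.Abort₁ (B.s f) B.left)) ≤ 2 * tail δ B.n := by
  have h1 := prob_card_compl_inter_lt (p := p f) (c := B.s f) (Finset.univ : Finset (Fin B.n))
    hδ0 hδ1 (by simpa using h.received_first)
  have h2 := prob_card_inter_lt (p := p f) (c := (B.s f + B.left : ℕ))
    (Finset.univ : Finset (Fin B.n)) hδ0 hδ1
    (by simpa only [Finset.card_univ, Fintype.card_fin] using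
      h.erased_first.imp_left fun h => (Nat.cast_eq_zero.2 h).le)
  simp only [Finset.inter_univ, Finset.univ_inter, Nat.cast_lt] at h1 h2
  rw [two_mul]
  refine le_trans ?_ (add_le_add h1 h2)
  rw [← expect_drawsLaw_E p f B fun E => ind (Eᶜ.card < B.s f),
    ← expect_drawsLaw_E p f B fun E => ind (E.card < B.s f + B.left), ← expect_add]
  exact expect_mono fun d => ind_or_le _ _

/-- For a fixed `L` of full size both counts inside `L` are binomial, because `E'` is independent of
`L`. A shorter `L` occurs only after a first abort, which is accounted for separately. -/
theorem Sizes.Margin.abort₂_le (h : B.Margin p f δ) (hδ0 : 0 ≤ δ) (hδ1 : δ ≤ 1) :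
    (expect (drawsLaw p f B) fun d => ind (d.L.card = B.left ∧ d.Abort₂ (B.s (other f)))) ≤
      2 * tail δ B.n := by
  refine (expect_drawsLaw_indep p f B fun q E' => ind (q.2.2.2.card = B.left ∧
    ((E'ᶜ ∩ q.2.2.2).card < B.s (other f) ∨ (E' ∩ q.2.2.2).card < B.s (other f)))).trans_le ?_
  refine expect_le_of_le fun d _ => ?_
  set L := (d.first).2.2.2
  by_cases hL : L.card = B.left
  · have h1 := prob_card_compl_inter_lt (p := p (other f)) (c := B.s (other f)) L hδ0 hδ1
      (by rw [hL]; exact h.received_other.imp_left fun h => (Nat.cast_eq_zero.2 h).le)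
    have h2 := prob_card_inter_lt (p := p (other f)) (c := B.s (other f)) L hδ0 hδ1
      (by rw [hL]; exact h.erased_other.imp_left fun h => (Nat.cast_eq_zero.2 h).le)
    simp only [Nat.cast_lt] at h1 h2
    rw [two_mul]
    refine le_trans ?_ (add_le_add h1 h2)
    rw [← expect_add]
    refine expect_mono fun E' => (ind_mono fun hh => hh.2).trans ((ind_or_le _ _).trans_eq ?_)
    rw [Finset.inter_comm E' L]
  · simp only [hL, false_and, ind_of_not not_false, expect_const]
    have := tail_nonneg δ B.n
    linarith

theorem Sizes.Margin.abortProb_le (h : B.Margin p f δ) (hδ0 : 0 ≤ δ) (hδ1 : δ ≤ 1) :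
    abortProb p f B ≤ 4 * tail δ B.n := by
  have h1 := h.abort₁_le hδ0 hδ1
  have h2 := h.abort₂_le hδ0 hδ1
  have : abortProb p f B ≤ (expect (drawsLaw p f B) fun d => ind (d.Abort₁ (B.s f) B.left)) +
      expect (drawsLaw p f B) fun d => ind (d.L.card = B.left ∧ d.Abort₂ (B.s (other f))) := by
    rw [abortProb, ← expect_add]
    refine expect_mono_on fun d hd => le_trans (ind_mono fun hh => ?_) (ind_or_le _ _)
    by_cases h1 : d.Abort₁ (B.s f) B.left
    · exact Or.inl h1
    · exact Or.inr ⟨(drawsLaw_valid hd).L_card h1, hh.resolve_left h1⟩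
  linarith

/-- A surplus of δn hidden bits gives 2^(-δn), which is below `tail` since log 2 ≥ 1/2 and δ² ≤ δ.
The factor 2 bounds 1 / log 2. -/
theorem leakBound_le_of_le {k q n : ℕ} {δ : ℝ} (hδ0 : 0 ≤ δ) (hδ1 : δ ≤ 1)
    (h : (k : ℝ) + δ * n ≤ q) : leakBound k q ≤ 2 * tail δ n := by
  refine (min_le_right _ _).trans ?_
  have hl : (1 : ℝ) / 2 ≤ Real.log 2 := by linarith [Real.log_two_gt_d9]
  have h2 := log_two_pos
  have e : (2 : ℝ) ^ k / 2 ^ q = Real.exp (Real.log 2 * (k - q)) := by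
    rw [← Real.rpow_natCast, ← Real.rpow_natCast, ← Real.rpow_sub two_pos,
      Real.rpow_def_of_pos two_pos]
  rw [e, div_le_iff₀ h2]
  have h3 : Real.exp (Real.log 2 * (k - q)) ≤ tail δ n := by
    refine Real.exp_le_exp.2 ?_
    have hn : (0 : ℝ) ≤ n := Nat.cast_nonneg n
    have h5 : δ ^ 2 * n ≤ δ * n := by nlinarith [mul_nonneg hδ0 hn]
    have h6 : 0 ≤ δ * n := mul_nonneg hδ0 hn
    have h7 : Real.log 2 * (δ * n) ≤ Real.log 2 * (q - k) :=
      mul_le_mul_of_nonneg_left (by linarith) h2.le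
    have h8 : 1 / 2 * (δ * n) ≤ Real.log 2 * (δ * n) := mul_le_mul_of_nonneg_right hl h6
    linarith
  nlinarith [tail_nonneg δ n]

theorem leakBound_le_length (k q : ℕ) : leakBound k q ≤ k := min_le_left _ _

theorem leakBound_zero (q : ℕ) : leakBound 0 q = 0 :=
  le_antisymm ((leakBound_le_length 0 q).trans_eq Nat.cast_zero) (leakBound_nonneg 0 q)

/-- If few unknown bits are unlikely, little leaks on average. -/
theorem expect_leakBound_le_of_prob {Ω : Type} [Fintype Ω] {μ : PMF Ω} {k n : ℕ} {X : Ω → ℕ}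
    {c : ℝ} (hδ0 : 0 ≤ δ) (hδ1 : δ ≤ 1) (hk : k ≤ n) (hc : 0 ≤ c)
    (h : k = 0 ∨ (expect μ fun ω => ind ((X ω : ℝ) < k + δ * n)) ≤ c * tail δ n) :
    (expect μ fun ω => leakBound k (X ω)) ≤ (c * n + 2) * tail δ n := by
  have ht := tail_nonneg δ n
  rcases h with rfl | h
  · simp only [leakBound_zero, expect_const]
    positivity
  have hpt : ∀ ω, leakBound k (X ω) ≤
      n * ind ((X ω : ℝ) < k + δ * n) + 2 * tail δ n := by
    intro ω
    by_cases hX : (X ω : ℝ) < k + δ * n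
    · rw [ind_of hX]
      have h1 := leakBound_le_length k (X ω)
      have h2 : (k : ℝ) ≤ n := by exact_mod_cast hk
      linarith
    · rw [ind_of_not hX, mul_zero, zero_add]
      exact leakBound_le_of_le hδ0 hδ1 (not_lt.1 hX)
  refine (expect_mono hpt).trans ?_
  rw [expect_add, expect_mul_left, expect_const]
  have := mul_le_mul_of_nonneg_left h (Nat.cast_nonneg (α := ℝ) n)
  linarith

/-- The set is chosen independently of `E'`, so its hidden part is binomial with mean p_o s. Two
tails pay for a possible abort of the first receiver, one for the deviation; `S` is instantiated
with `A` and with `A'`. -/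
theorem Sizes.Margin.prob_key_first_le (h : B.Margin p f δ) (hδ0 : 0 ≤ δ) (hδ1 : δ ≤ 1)
    (hk : B.k f ≠ 0)
    (S : Finset (Fin B.n) × Finset (Fin B.n) × Finset (Fin B.n) × Finset (Fin B.n) →
      Finset (Fin B.n))
    (hS : ∀ d ∈ (drawsLaw p f B).support, ¬d.Abort₁ (B.s f) B.left →
      (S d.first).card = B.s f) :
    (expect (drawsLaw p f B) fun d =>
      ind (((S d.first ∩ d.E').card : ℝ) < B.k f + δ * B.n)) ≤ 3 * tail δ B.n := by
  have h0 := h.key_first.resolve_left hk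
  have h1 := h.abort₁_le hδ0 hδ1
  have h2 : (expect (drawsLaw p f B) fun d => ind ((S d.first).card = B.s f ∧
      ((S d.first ∩ d.E').card : ℝ) < B.k f + δ * B.n)) ≤ tail δ B.n := by
    refine (expect_drawsLaw_indep p f B fun q E' => ind ((S q).card = B.s f ∧
      ((S q ∩ E').card : ℝ) < B.k f + δ * B.n)).trans_le ?_
    refine expect_le_of_le fun d _ => ?_
    by_cases hd : (S d.first).card = B.s f
    · refine (expect_mono fun E' => ind_mono And.right).trans
        (prob_card_inter_lt (p := p (other f)) _ hδ0 hδ1 (Or.inr ?_))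
      rwa [hd]
    · simp only [hd, false_and, ind_of_not not_false, expect_const]
      exact tail_nonneg δ B.n
  have h3 : (expect (drawsLaw p f B) fun d =>
      ind (((S d.first ∩ d.E').card : ℝ) < B.k f + δ * B.n)) ≤
      (expect (drawsLaw p f B) fun d => ind (d.Abort₁ (B.s f) B.left)) +
      expect (drawsLaw p f B) fun d => ind ((S d.first).card = B.s f ∧
        ((S d.first ∩ d.E').card : ℝ) < B.k f + δ * B.n) := by
    rw [← expect_add]
    refine expect_mono_on fun d hd => le_trans (ind_mono fun hh => ?_) (ind_or_le _ _)
    by_cases h1 : d.Abort₁ (B.s f) B.left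
    · exact Or.inl h1
    · exact Or.inr ⟨hS d hd h1, hh⟩
  linarith

theorem Sizes.Margin.runLeak_le (h : B.Margin p f δ) (hδ0 : 0 ≤ δ) (hδ1 : δ ≤ 1) :
    runLeak p f B ≤ 16 * ((B.n + 1) * tail δ B.n) := by
  have ht := tail_nonneg δ B.n
  have hab := h.abortProb_le hδ0 hδ1
  have h1 := expect_leakBound_le_of_prob (μ := drawsLaw p f B) (X := fun d => (d.A ∩ d.E').card)
    hδ0 hδ1 (h.k_le f) zero_le_three (or_iff_not_imp_left.2 fun hk =>
      h.prob_key_first_le hδ0 hδ1 hk (fun q => q.2.1) fun d hd => (drawsLaw_valid hd).A_card)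
  have h2 := expect_leakBound_le_of_prob (μ := drawsLaw p f B) (X := fun d => (d.A' ∩ d.E').card)
    hδ0 hδ1 (h.k_le f) zero_le_three (or_iff_not_imp_left.2 fun hk =>
      h.prob_key_first_le hδ0 hδ1 hk (fun q => q.2.2.1) fun d hd => (drawsLaw_valid hd).A'_card)
  have key : ∀ X : Draws B.n → ℕ, (∀ d ∈ (drawsLaw p f B).support,
      ¬d.Abort (B.s f) B.left (B.s (other f)) → X d = B.s (other f)) →
      (expect (drawsLaw p f B) fun d => leakBound (B.k (other f)) (X d)) ≤
        (4 * B.n + 2) * tail δ B.n := by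
    intro X hX
    refine expect_leakBound_le_of_prob hδ0 hδ1 (h.k_le _) zero_le_four
      (h.key_other.imp_right fun hk => le_trans (expect_mono_on fun d hd => ind_mono fun hh => ?_)
        hab)
    by_contra hnot
    rw [hX d hd hnot] at hh
    linarith
  have h3 := key (fun d => d.D.card) fun d hd => fun hn =>
    (drawsLaw_valid hd).D_card fun hh => hn (Or.inr hh)
  have h4 := key (fun d => d.D'.card) fun d hd => fun hn =>
    (drawsLaw_valid hd).D'_card fun hh => hn (Or.inr hh)
  rw [runLeak, expect_add, expect_add, expect_add]
  -- The coefficients add up to 2(3n + 2) + 2(4n + 2) = 14n + 8.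
  nlinarith [mul_nonneg (Nat.cast_nonneg (α := ℝ) B.n) ht]

end Margin

open Filter Topology in
theorem tendsto_mul_tail {δ : ℝ} (hδ : 0 < δ) :
    Tendsto (fun n : ℕ => ((n : ℝ) + 1) * tail δ n) atTop (𝓝 0) := by
  have hb : (0 : ℝ) < δ ^ 2 / 4 := by positivity
  have h1 : Tendsto (fun x : ℝ => x * Real.exp (-(δ ^ 2 / 4 * x))) atTop (𝓝 0) := by
    have := Real.tendsto_pow_mul_exp_neg_atTop_nhds_zero 1
    have h2 := (this.comp (tendsto_id.const_mul_atTop hb)).const_mul (δ ^ 2 / 4)⁻¹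
    simp only [mul_zero] at h2
    refine h2.congr fun x => ?_
    simp only [Function.comp, id, pow_one]
    rw [← mul_assoc, inv_mul_cancel_left₀ hb.ne']
  have h3 : Tendsto (fun x : ℝ => Real.exp (-(δ ^ 2 / 4 * x))) atTop (𝓝 0) :=
    Real.tendsto_exp_neg_atTop_nhds_zero.comp (tendsto_id.const_mul_atTop hb)
  have h4 := (h1.add h3).comp tendsto_natCast_atTop_atTop
  simp only [add_zero] at h4
  refine h4.congr fun n => ?_
  simp only [Function.comp, tail]
  ring

/-! ### Sizes approaching a corner of the rate region -/

/-- Rates that the run with Bob-`f` first can serve on average. -/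
structure Attainable (p : Fin 2 → unitInterval) (f : Fin 2) (ρ : Fin 2 → ℝ) : Prop where
  nonneg : ∀ i, 0 ≤ ρ i
  first : ρ f ≤ p (other f) * min (p f : ℝ) (1 - p f)
  second : ρ (other f) ≤ min (p (other f) : ℝ) (1 - p (other f)) * (p f - min (p f : ℝ) (1 - p f))

/-- The length of the strings for Bob-`i` when the rate stays `10 l` below `ρ i`. -/
def stringLength (ρ : Fin 2 → ℝ) (l : ℚ) (n : ℕ) (i : Fin 2) : ℕ := ⌊n * (ρ i - 10 * l)⌋₊

/-- The protocol's parameter `r i` for strings of length `stringLength ρ l n i` and `λ' = l`. -/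
def rateParam (ρ : Fin 2 → ℝ) (l : ℚ) (n : ℕ) (i : Fin 2) : ℝ :=
  if stringLength ρ l n i = 0 then 0 else l + stringLength ρ l n i / n

/-- The protocol's sizes for `λ = 4 l`, `λ' = l` and the parameters `rateParam ρ l n`. -/
def runSizes (p : Fin 2 → unitInterval) (f : Fin 2) (ρ : Fin 2 → ℝ) (l : ℚ) (n : ℕ) : Sizes where
  n := n
  s i := if i = f then ⌊rateParam ρ l n f / ((p (other f) : ℝ) - l) * n⌋₊
    else if (1 / 2 : ℝ) < p f then ⌊rateParam ρ l n i * n⌋₊ else 0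
  left := if (1 / 2 : ℝ) < p f then
    ⌊((p f : ℝ) - 4 * l - rateParam ρ l n f / ((p (other f) : ℝ) - l)) * n⌋₊ else 0
  k := stringLength ρ l n

section RunSizes

variable {p : Fin 2 → unitInterval} {f : Fin 2} {ρ : Fin 2 → ℝ} {l : ℚ} {n : ℕ}

theorem rateParam_of_ne_zero {i : Fin 2} (h : stringLength ρ l n i ≠ 0) :
    0 < n ∧ rateParam ρ l n i = l + stringLength ρ l n i / n ∧
      rateParam ρ l n i * n = l * n + stringLength ρ l n i ∧
      rateParam ρ l n i ≤ ρ i - 9 * l ∧ (l : ℝ) < rateParam ρ l n i := by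
  have hn : 0 < n := by
    refine Nat.pos_of_ne_zero fun hn => h ?_
    simp [stringLength, hn]
  have hn' : (0 : ℝ) < n := by exact_mod_cast hn
  have hr : rateParam ρ l n i = l + stringLength ρ l n i / n := if_neg h
  have hk : (stringLength ρ l n i : ℝ) ≤ n * (ρ i - 10 * l) :=
    Nat.floor_le (Nat.pos_of_floor_pos (Nat.pos_of_ne_zero h)).le
  have hk0 : (0 : ℝ) < stringLength ρ l n i := by exact_mod_cast Nat.pos_of_ne_zero h
  refine ⟨hn, hr, ?_, ?_, ?_⟩
  · rw [hr]
    field_simp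
  · rw [hr]
    have : (stringLength ρ l n i : ℝ) / n ≤ ρ i - 10 * l := by
      rw [div_le_iff₀ hn']
      linarith
    linarith
  · rw [hr]
    have := div_pos hk0 hn'
    linarith

theorem rateParam_of_eq_zero {i : Fin 2} (h : stringLength ρ l n i = 0) :
    rateParam ρ l n i = 0 := if_pos h

theorem rateParam_eq_zero_iff (hl : 0 < l) {i : Fin 2} :
    rateParam ρ l n i = 0 ↔ stringLength ρ l n i = 0 := by
  refine ⟨fun h => ?_, rateParam_of_eq_zero⟩
  by_contra hne
  have := (rateParam_of_ne_zero hne).2.2.2.2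
  have hl' : (0 : ℝ) < l := by exact_mod_cast hl
  linarith

theorem min_self_compl_le_half (x : ℝ) : min x (1 - x) ≤ 1 / 2 := by
  rcases le_total x (1 / 2) with h | h
  · exact (min_le_left _ _).trans h
  · exact (min_le_right _ _).trans (by linarith)

theorem min_self_compl_nonneg (x : unitInterval) : 0 ≤ min (x : ℝ) (1 - x) :=
  le_min x.2.1 (sub_nonneg.2 x.2.2)

theorem Attainable.le_one (h : Attainable p f ρ) (i : Fin 2) : ρ i ≤ 1 := by
  have h1 := min_self_compl_nonneg (p f)
  have h2 := min_self_compl_nonneg (p (other f))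
  have h3 := min_self_compl_le_half (p f)
  have h4 := min_self_compl_le_half (p (other f))
  have h5 := (p f).2.1
  have h6 := (p f).2.2
  have h7 := (p (other f)).2.1
  have h8 := (p (other f)).2.2
  rcases eq_or_eq_other f i with rfl | rfl
  · nlinarith [h.first]
  · nlinarith [h.second]

/-- For p_f ≤ 1/2 the bound on the second rate is 0: serving the first receiver uses up his
erasures. -/
theorem Attainable.half_lt (h : Attainable p f ρ) (hl : 0 < l)
    (hk : stringLength ρ l n (other f) ≠ 0) : (1 / 2 : ℝ) < p f := by
  by_contra hp
  have h1 := (rateParam_of_ne_zero hk).2.2.2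
  have h2 := h.second
  rw [min_eq_left (a := (p f : ℝ)) (by linarith), sub_self, mul_zero] at h2
  have hl' : (0 : ℝ) < l := by exact_mod_cast hl
  linarith

/-- The share of positions in each of the two sets of the first receiver. -/
theorem Attainable.share_bounds (h : Attainable p f ρ) (hl : 0 < l)
    (hk : stringLength ρ l n f ≠ 0) :
    0 ≤ rateParam ρ l n f / (p (other f) - l) ∧
      rateParam ρ l n f / (p (other f) - l) ≤ min (p f : ℝ) (1 - p f) - 3 * l ∧
      rateParam ρ l n f ≤ p (other f) * (rateParam ρ l n f / (p (other f) - l)) := by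
  obtain ⟨-, -, -, h1, h2⟩ := rateParam_of_ne_zero hk
  have hl' : (0 : ℝ) < l := by exact_mod_cast hl
  have h3 := h.first
  have q0 := min_self_compl_nonneg (p f)
  have q1 := min_self_compl_le_half (p f)
  have p0 := (p (other f)).2.1
  have p1 := (p (other f)).2.2
  set P : ℝ := (p (other f) : ℝ)
  set q := min (p f : ℝ) (1 - p f)
  set r := rateParam ρ l n f
  have hP : (0 : ℝ) < P - l := by nlinarith
  have hx : 0 ≤ r / (P - l) := div_nonneg (by linarith) hP.le
  refine ⟨hx, ?_, ?_⟩
  -- The gap 9l in the rate exceeds the loss l q + 3l P incurred by lowering `P` by l and q by 3l.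
  · rw [div_le_iff₀ hP]
    nlinarith
  · have := div_mul_cancel₀ r hP.ne'
    nlinarith

theorem Attainable.share_le (h : Attainable p f ρ) (hl : 0 < l) :
    rateParam ρ l n f / (p (other f) - l) ≤ min (p f : ℝ) (1 - p f) := by
  have hl' : (0 : ℝ) < l := by exact_mod_cast hl
  by_cases hk : stringLength ρ l n f = 0
  · rw [rateParam_of_eq_zero hk, zero_div]
    exact min_self_compl_nonneg _
  · linarith [(h.share_bounds hl hk).2.1]

/-- The rate parameters stay 9l below the attainable rates, which leaves room for the required slack
λ = 4l. -/
theorem Attainable.isProtocolSizes (h : Attainable p f ρ) (hl : 0 < l) (hl1 : (l : ℝ) < 1 / 4) :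
    IsProtocolSizes p f (runSizes p f ρ l n) := by
  have hl' : (0 : ℝ) < l := by exact_mod_cast hl
  have key : ∀ i, (stringLength ρ l n i : ℝ) =
      if rateParam ρ l n i = 0 then 0 else n * (rateParam ρ l n i - l) := by
    intro i
    by_cases hk : stringLength ρ l n i = 0
    · rw [if_pos (rateParam_of_eq_zero hk), hk, Nat.cast_zero]
    · rw [if_neg (mt (rateParam_eq_zero_iff hl).1 hk)]
      have := (rateParam_of_ne_zero hk).2.2.1
      linarith
  refine ⟨rateParam ρ l n, 4 * l, l, by linarith, by linarith, hl, fun i => ?_, if_pos rfl, key f,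
    ?_⟩
  · by_cases hk : stringLength ρ l n i = 0
    · exact Or.inr (rateParam_of_eq_zero hk)
    refine Or.inl ⟨(rateParam_of_ne_zero hk).2.2.2.2, ?_⟩
    have h1 := (rateParam_of_ne_zero hk).2.2.2.1
    rcases eq_or_eq_other f i with rfl | rfl
    · linarith [h.first]
    · rw [other_other]
      have h2 := h.second
      have := mul_nonneg (min_self_compl_nonneg (p (other f)))
        (min_self_compl_nonneg (p f))
      nlinarith
  · by_cases hp : (1 / 2 : ℝ) < p f
    · rw [if_pos hp]
      exact ⟨if_pos hp, (if_neg (other_ne f)).trans (if_pos hp), key _⟩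
    · rw [if_neg hp]
      exact ⟨if_neg hp, (if_neg (other_ne f)).trans (if_neg hp),
        not_not.1 fun hk => hp (h.half_lt hl hk)⟩

/-- Every size inequality has slack at least of order l n, and rounding costs at most 1. The bound
`2 ≤ l * n` is tailored to the key of the first receiver: there l n - 1 must cover two margins of l
n / 4. -/
theorem Attainable.margin (h : Attainable p f ρ) (hl : 0 < l) (hn : 2 ≤ (l : ℝ) * n) :
    (runSizes p f ρ l n).Margin p f (l / 4) := by
  have hl' : (0 : ℝ) < l := by exact_mod_cast hl
  have hn0 : (0 : ℝ) ≤ n := Nat.cast_nonneg n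
  have q0 := min_self_compl_nonneg (p f)
  have qp := min_le_left (p f : ℝ) (1 - p f)
  have qp' := min_le_right (p f : ℝ) (1 - p f)
  have o0 := min_self_compl_nonneg (p (other f))
  have o1 := min_self_compl_le_half (p (other f))
  have op := min_le_left (p (other f) : ℝ) (1 - p (other f))
  have op' := min_le_right (p (other f) : ℝ) (1 - p (other f))
  have p1 := (p (other f)).2.2
  have hxq := h.share_le (n := n) hl
  set x := rateParam ρ l n f / (p (other f) - l) with hx
  set q := min (p f : ℝ) (1 - p f)
  set q' := min (p (other f) : ℝ) (1 - p (other f))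
  have sf : (runSizes p f ρ l n).s f = ⌊x * n⌋₊ := if_pos rfl
  have so : (runSizes p f ρ l n).s (other f) =
      if (1 / 2 : ℝ) < p f then ⌊rateParam ρ l n (other f) * n⌋₊ else 0 :=
    if_neg (other_ne f)
  have left : (runSizes p f ρ l n).left =
      if (1 / 2 : ℝ) < p f then ⌊((p f : ℝ) - 4 * l - x) * n⌋₊ else 0 := rfl
  have hsf : (runSizes p f ρ l n).s f = 0 ∨ 0 ≤ x ∧ x ≤ q - 3 * l ∧
      ((runSizes p f ρ l n).s f : ℝ) ≤ x * n := by
    by_cases hk : stringLength ρ l n f = 0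
    · left
      rw [sf, hx, rateParam_of_eq_zero hk, zero_div, zero_mul, Nat.floor_zero]
    · right
      obtain ⟨h1, h2, -⟩ := h.share_bounds hl hk
      exact ⟨h1, h2, by rw [sf]; exact Nat.floor_le (mul_nonneg h1 hn0)⟩
  have hso : (runSizes p f ρ l n).s (other f) = 0 ∨
      ((runSizes p f ρ l n).s (other f) : ℝ) ≤
        q' * (runSizes p f ρ l n).left - l / 4 * n := by
    by_cases hk : stringLength ρ l n (other f) = 0
    · left
      rw [so, rateParam_of_eq_zero hk, zero_mul, Nat.floor_zero, ite_self]
    · right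
      have hp := h.half_lt hl hk
      obtain ⟨-, -, -, h1, h2⟩ := rateParam_of_ne_zero hk
      have h3 := Nat.lt_floor_add_one (((p f : ℝ) - 4 * l - x) * n)
      have h4 := Nat.floor_le (mul_nonneg (hl'.le.trans h2.le) hn0)
      have h5 := h.second
      rw [so, left, if_pos hp, if_pos hp]
      have h6 : rateParam ρ l n (other f) * n ≤ (q' * (p f - q) - 9 * l) * n :=
        mul_le_mul_of_nonneg_right (by linarith) hn0
      -- The share `x` used by the first receiver is at most q, so at least this many erasures are
      -- left for the second phase.
      have h7 : (p f - q - 4 * l) * n - 1 ≤ ⌊((p f : ℝ) - 4 * l - x) * n⌋₊ := by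
        nlinarith [mul_le_mul_of_nonneg_right hxq hn0]
      have h8 := mul_le_mul_of_nonneg_left h7 o0
      have h9 : q' * (l * n) ≤ 1 / 2 * (l * n) := mul_le_mul_of_nonneg_right o1 (by linarith)
      nlinarith
  have hleft : (0 : ℝ) ≤ (runSizes p f ρ l n).left := Nat.cast_nonneg _
  constructor
  · refine hsf.imp_right fun ⟨_, h1, h2⟩ => h2.trans ?_
    change x * n ≤ (1 - p f) * n - l / 4 * n
    nlinarith [mul_le_mul_of_nonneg_right h1 hn0, mul_le_mul_of_nonneg_right qp' hn0]
  · change _ ∨ _ ≤ (p f : ℝ) * n - l / 4 * n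
    push_cast
    by_cases hl0 : (runSizes p f ρ l n).left = 0
    · rw [hl0]
      refine hsf.imp id fun ⟨_, h1, h2⟩ => ?_
      rw [Nat.cast_zero, add_zero]
      nlinarith [mul_le_mul_of_nonneg_right h1 hn0, mul_le_mul_of_nonneg_right qp hn0]
    · right
      have h3 : ((runSizes p f ρ l n).left : ℝ) ≤ (p f - 4 * l - x) * n := by
        rw [left] at hl0 ⊢
        split_ifs at hl0 ⊢ with hp
        · exact Nat.floor_le (Nat.pos_of_floor_pos (Nat.pos_of_ne_zero hl0)).le
        · exact absurd rfl hl0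
      have h4 : ((runSizes p f ρ l n).s f : ℝ) ≤ x * n := by
        by_cases hk : stringLength ρ l n f = 0
        · rw [sf, hx, rateParam_of_eq_zero hk]
          simp
        · rw [sf]
          exact Nat.floor_le (mul_nonneg (h.share_bounds hl hk).1 hn0)
      nlinarith
  · refine hso.imp_right fun h1 => h1.trans ?_
    change _ ≤ _ - l / 4 * (n : ℝ)
    nlinarith
  · refine hso.imp_right fun h1 => h1.trans ?_
    change _ ≤ _ - l / 4 * (n : ℝ)
    nlinarith
  · change stringLength ρ l n f = 0 ∨
      (stringLength ρ l n f : ℝ) + l / 4 * n ≤ _ - l / 4 * (n : ℝ)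
    refine or_iff_not_imp_left.2 fun hk => ?_
    obtain ⟨h1, -, h2⟩ := h.share_bounds hl hk
    have h3 := (rateParam_of_ne_zero hk).2.2.1
    have h4 := Nat.lt_floor_add_one (x * n)
    have h5 := mul_le_mul_of_nonneg_right h2 hn0
    rw [sf]
    have h6 : (p (other f) : ℝ) * (x * n) ≤ p (other f) * ⌊x * n⌋₊ + 1 := by
      nlinarith [mul_le_mul_of_nonneg_left h4.le (p (other f)).2.1]
    nlinarith
  · change stringLength ρ l n (other f) = 0 ∨
      (stringLength ρ l n (other f) : ℝ) + l / 4 * n ≤ _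
    refine or_iff_not_imp_left.2 fun hk => ?_
    have h3 := (rateParam_of_ne_zero hk).2.2.1
    have h4 := Nat.lt_floor_add_one (rateParam ρ l n (other f) * n)
    rw [so, if_pos (h.half_lt hl hk)]
    linarith
  · intro i
    change stringLength ρ l n i ≤ n
    refine Nat.floor_le_of_le ?_
    nlinarith [h.le_one i]

theorem Attainable.abs_stringLength_sub_le (h : Attainable p f ρ) (hl : 0 < l) (i : Fin 2) :
    |(stringLength ρ l n i : ℝ) - ρ i * n| ≤ 10 * l * n + 1 := by
  have hl' : (0 : ℝ) < l := by exact_mod_cast hl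
  have hn0 : (0 : ℝ) ≤ n := Nat.cast_nonneg n
  have h1 := Nat.lt_floor_add_one (n * (ρ i - 10 * l))
  have h2 : (stringLength ρ l n i : ℝ) ≤ ρ i * n := by
    by_cases hk : stringLength ρ l n i = 0
    · rw [hk, Nat.cast_zero]
      exact mul_nonneg (h.nonneg i) hn0
    · have := (rateParam_of_ne_zero hk).2.2
      nlinarith
  rw [abs_of_nonpos (by linarith)]
  rw [stringLength]
  linarith

end RunSizes

open Filter Topology

/-! ### Time sharing -/

theorem abortProb_eq_zero {p : Fin 2 → unitInterval} {f : Fin 2} {B : Sizes} (hs : ∀ i, B.s i = 0)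
    (hl : B.left = 0) : abortProb p f B = 0 := by
  have : ∀ d : Draws B.n, ¬d.Abort (B.s f) B.left (B.s (other f)) := by
    intro d
    simp [Draws.Abort, Draws.Abort₁, Draws.Abort₂, hs, hl]
  simp only [abortProb, ind_of_not (this _), expect_const]

theorem runLeak_eq_zero {p : Fin 2 → unitInterval} {f : Fin 2} {B : Sizes} (hk : ∀ i, B.k i = 0) :
    runLeak p f B = 0 := by
  simp only [runLeak, hk, leakBound_zero, add_zero, expect_const]

/-- The run approaches attainable rates with vanishing abort probability and leakage. -/
theorem Attainable.exists_sizes {p : Fin 2 → unitInterval} {f : Fin 2} {ρ : Fin 2 → ℝ}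
    (h : Attainable p f ρ) {ε : ℝ} (hε : 0 < ε) : ∃ N : ℕ, ∀ n : ℕ, n = 0 ∨ N ≤ n →
      ∃ B : Sizes, B.n = n ∧ IsProtocolSizes p f B ∧ (∀ i, |(B.k i : ℝ) - ρ i * n| ≤ ε * n) ∧
        abortProb p f B ≤ ε ∧ runLeak p f B ≤ ε := by
  obtain ⟨l, hl, hlε⟩ := exists_rat_btwn (show (0 : ℝ) < min (ε / 20) (1 / 20) by positivity)
  have hl1 : (l : ℝ) < 1 / 4 := (hlε.trans_le (min_le_right _ _)).trans (by norm_num)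
  have hl2 : (l : ℝ) < ε / 20 := hlε.trans_le (min_le_left _ _)
  have hl0 : 0 < l := by exact_mod_cast hl
  have hδ : (0 : ℝ) < l / 4 := by linarith
  have e1 : ∀ᶠ n : ℕ in atTop, 2 / (l : ℝ) ≤ n :=
    tendsto_natCast_atTop_atTop.eventually_ge_atTop _
  have e2 : ∀ᶠ n : ℕ in atTop, ((n : ℝ) + 1) * tail (l / 4) n < ε / 16 :=
    (tendsto_mul_tail hδ).eventually_lt_const (by positivity)
  obtain ⟨N, hN⟩ := eventually_atTop.1 (e1.and e2)
  refine ⟨N, fun n hn => ⟨runSizes p f ρ l n, rfl, h.isProtocolSizes hl0 hl1, ?_⟩⟩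
  rcases hn with rfl | hn
  -- A run without channel uses occurs when time sharing gives all uses to one order; all its sizes
  -- vanish.
  · have hk : ∀ i, stringLength ρ l 0 i = 0 := fun i => by simp [stringLength]
    refine ⟨fun i => ?_, (abortProb_eq_zero (fun i => ?_) ?_).trans_le hε.le,
      (runLeak_eq_zero hk).trans_le hε.le⟩
    · change |(stringLength ρ l 0 i : ℝ) - _| ≤ _
      simp [hk]
    · simp [runSizes]
    · simp [runSizes]
  · obtain ⟨h1, h2⟩ := hN n hn
    rw [div_le_iff₀ hl] at h1
    have hm := h.margin hl0 (by linarith : 2 ≤ (l : ℝ) * n)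
    have h3 := hm.abortProb_le hδ.le (by linarith)
    have h4 := hm.runLeak_le hδ.le (by linarith)
    change _ ≤ 4 * tail (l / 4) n at h3
    change _ ≤ 16 * (((n : ℝ) + 1) * tail (l / 4) n) at h4
    have h5 : tail (l / 4) n ≤ ((n : ℝ) + 1) * tail (l / 4) n :=
      le_mul_of_one_le_left (tail_nonneg _ _) (by linarith [Nat.cast_nonneg (α := ℝ) n])
    refine ⟨fun i => (h.abs_stringLength_sub_le hl0 i).trans ?_, by linarith, by linarith⟩
    nlinarith

/-- What has to vanish for a shared protocol to achieve the rates `R`. -/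
def defect (p : Fin 2 → unitInterval) (R : Fin 2 → ℝ) (P : Shared) : ℝ :=
  |(P.len 0 : ℝ) / P.uses - R 0| + |(P.len 1 : ℝ) / P.uses - R 1| +
    (abortProb p 0 P.a + abortProb p 1 P.b) + (runLeak p 0 P.a + runLeak p 1 P.b)

theorem tendsto_floor_mul_or_zero {θ : ℝ} (hθ : 0 ≤ θ) (N : ℕ) :
    ∀ᶠ n : ℕ in atTop, ⌊θ * n⌋₊ = 0 ∨ N ≤ ⌊θ * n⌋₊ := by
  rcases hθ.eq_or_lt with rfl | hθ
  · exact Eventually.of_forall fun n => Or.inl (by simp)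
  · have h := tendsto_natCast_atTop_atTop (R := ℝ).const_mul_atTop hθ
    exact (h.eventually_ge_atTop (N : ℝ)).mono fun n hn => Or.inr (Nat.le_floor hn)

theorem tendsto_sub_floor_mul_or_zero {θ : ℝ} (hθ : 0 ≤ θ) (hθ1 : θ ≤ 1) (N : ℕ) :
    ∀ᶠ n : ℕ in atTop, n - ⌊θ * n⌋₊ = 0 ∨ N ≤ n - ⌊θ * n⌋₊ := by
  rcases hθ1.eq_or_lt with rfl | hθ1
  · exact Eventually.of_forall fun n => Or.inl (by simp)
  · have h := tendsto_natCast_atTop_atTop (R := ℝ).const_mul_atTop (sub_pos.2 hθ1)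
    refine (h.eventually_ge_atTop (N : ℝ)).mono fun n hn => Or.inr (Nat.le_sub_of_add_le ?_)
    have h1 := Nat.floor_le (mul_nonneg hθ (Nat.cast_nonneg (α := ℝ) n))
    have h2 : ((N + ⌊θ * n⌋₊ : ℕ) : ℝ) ≤ n := by
      push_cast
      linarith
    exact_mod_cast h2

/-- The first run receives ⌊θn⌋ uses and the second one the rest. By the two preceding lemmas each
run is eventually either empty or long enough for `exists_sizes`. -/
theorem eventually_exists_defect_le {p : Fin 2 → unitInterval} {ρa ρb : Fin 2 → ℝ} {θ : ℝ}
    (ha : Attainable p 0 ρa) (hb : Attainable p 1 ρb) (hθ : 0 ≤ θ) (hθ1 : θ ≤ 1) {ε : ℝ}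
    (hε : 0 < ε) : ∀ᶠ n : ℕ in atTop, ∃ P : Shared, (IsProtocol p P ∧ P.uses = n) ∧
      defect p (fun i => θ * ρa i + (1 - θ) * ρb i) P ≤ ε := by
  have hη : 0 < ε / 8 := by positivity
  obtain ⟨Na, hNa⟩ := ha.exists_sizes hη
  obtain ⟨Nb, hNb⟩ := hb.exists_sizes hη
  have e : ∀ᶠ n : ℕ in atTop, 8 / ε ≤ (n : ℝ) :=
    tendsto_natCast_atTop_atTop.eventually_ge_atTop _
  filter_upwards [tendsto_floor_mul_or_zero hθ Na, tendsto_sub_floor_mul_or_zero hθ hθ1 Nb, e,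
    eventually_gt_atTop 0] with n h1 h2 h3 hn
  obtain ⟨Ba, na, pa, ka, aa, la⟩ := hNa _ h1
  obtain ⟨Bb, nb, pb, kb, ab, lb⟩ := hNb _ h2
  have hn' : (0 : ℝ) < n := by exact_mod_cast hn
  have f1 := Nat.floor_le (mul_nonneg hθ hn'.le)
  have f2 := Nat.lt_floor_add_one (θ * n)
  have hle : ⌊θ * n⌋₊ ≤ n := Nat.floor_le_of_le (mul_le_of_le_one_left hn'.le hθ1)
  have huses : Shared.uses ⟨Ba, Bb⟩ = n := by
    rw [Shared.uses, na, nb]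
    exact Nat.add_sub_of_le hle
  rw [div_le_iff₀ hε] at h3
  -- The rate errors of the runs contribute ε/8 in total, and the rounding of θn at most 1/n ≤ ε/8.
  -- Each of the four terms of `defect` is then at most ε/4.
  have key : ∀ i, |(Shared.len ⟨Ba, Bb⟩ i : ℝ) / n - (θ * ρa i + (1 - θ) * ρb i)| ≤ ε / 4 := by
    intro i
    have q1 := abs_le.1 (ka i)
    have q2 := abs_le.1 (kb i)
    rw [Nat.cast_sub hle] at q2
    set m : ℝ := (⌊θ * n⌋₊ : ℝ)
    have r0 := ha.nonneg i
    have r1 := ha.le_one i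
    have s0 := hb.nonneg i
    have s1 := hb.le_one i
    have hd : |(ρa i - ρb i) * (θ * n - m)| ≤ 1 := by
      rw [abs_mul]
      exact mul_le_one₀ (abs_le.2 ⟨by linarith, by linarith⟩) (abs_nonneg _)
        (abs_le.2 ⟨by linarith, by linarith⟩)
    have hd' := abs_le.1 hd
    have e1 : (Shared.len ⟨Ba, Bb⟩ i : ℝ) = Ba.k i + Bb.k i := by
      simp [Shared.len]
    have e2 : (Shared.len ⟨Ba, Bb⟩ i : ℝ) / n - (θ * ρa i + (1 - θ) * ρb i) =
        ((Ba.k i - ρa i * m) + (Bb.k i - ρb i * (n - m)) - (ρa i - ρb i) * (θ * n - m)) / n := by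
      rw [e1]
      field_simp
      ring
    rw [e2, abs_div, abs_of_pos hn', div_le_iff₀ hn', abs_le]
    constructor <;> nlinarith
  refine ⟨⟨Ba, Bb⟩, ⟨⟨pa, pb⟩, huses⟩, ?_⟩
  have k0 := key 0
  have k1 := key 1
  rw [defect, huses]
  dsimp only
  linarith

/-! ### Decomposition of the inner region by time sharing -/

/-- Points below a sum split into points below the summands. -/
theorem exists_split {θ c c' R : ℝ} (hθ : 0 ≤ θ) (hθ1 : θ ≤ 1) (hc : 0 ≤ c) (hc' : 0 ≤ c')
    (hR : 0 ≤ R) (h : R ≤ θ * c + (1 - θ) * c') :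
    ∃ x y, 0 ≤ x ∧ x ≤ c ∧ 0 ≤ y ∧ y ≤ c' ∧ R = θ * x + (1 - θ) * y := by
  set S := θ * c + (1 - θ) * c'
  have hS : 0 ≤ S := hR.trans h
  -- Both summands are scaled by the same factor. If `S = 0`, the quotient is 0 by convention, and
  -- `R = 0` as well.
  refine ⟨R / S * c, R / S * c', by positivity, ?_, by positivity, ?_, ?_⟩
  · exact mul_le_of_le_one_left hc (div_le_one_of_le₀ h hS)
  · exact mul_le_of_le_one_left hc' (div_le_one_of_le₀ h hS)
  · have : θ * (R / S * c) + (1 - θ) * (R / S * c') = R / S * S := by ring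
    rw [this]
    rcases hS.eq_or_lt with h0 | h0
    · rw [← h0, mul_zero]
      linarith
    · rw [div_mul_cancel₀ R h0.ne']

/-- The inner region is the set of time-shared attainable rates. -/
theorem exists_attainable_of_mem_innerRegion {p : Fin 2 → unitInterval} {R : ℝ × ℝ}
    (h : R ∈ innerRegion (p 0) (p 1)) : ∃ (θ : ℝ) (ρa ρb : Fin 2 → ℝ), 0 ≤ θ ∧ θ ≤ 1 ∧
      Attainable p 0 ρa ∧ Attainable p 1 ρb ∧ R.1 = θ * ρa 0 + (1 - θ) * ρb 0 ∧
      R.2 = θ * ρa 1 + (1 - θ) * ρb 1 := by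
  obtain ⟨h1, h2, h3, h4, h5⟩ := h
  have q0 := min_self_compl_nonneg (p 0)
  have q1 := min_self_compl_nonneg (p 1)
  have qp0 := min_le_left (p 0 : ℝ) (1 - p 0)
  have qp1 := min_le_left (p 1 : ℝ) (1 - p 1)
  have hp0 := (p 0).2.1
  have hp1 := (p 1).2.1
  have o0 : other 0 = 1 := rfl
  have o1 : other 1 = 0 := rfl
  set a := min (p 0 : ℝ) (1 - p 0) with ha
  set b := min (p 1 : ℝ) (1 - p 1) with hb
  -- The share of the order with Bob-2 first is `t`: each order costs the receiver served last a * b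
  -- of his maximal rate. Bob-2 profits from a large `t`, so `t` is as large as `R.1` permits,
  -- capped at 1; the sum bound then yields the claim for `R.2`.
  obtain ⟨t, t0, t1, g1, g2⟩ : ∃ t : ℝ, 0 ≤ t ∧ t ≤ 1 ∧ R.1 ≤ p 1 * a - t * (a * b) ∧
      R.2 ≤ p 0 * b - (1 - t) * (a * b) := by
    rcases (mul_nonneg q0 q1).eq_or_lt with hab | hab
    · exact ⟨0, le_rfl, zero_le_one, by linarith, by rw [← hab]; linarith⟩
    · rcases le_total (p 1 * a - R.1) (a * b) with hle | hle
      · have hx := div_mul_cancel₀ (p 1 * a - R.1) hab.ne'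
        refine ⟨(p 1 * a - R.1) / (a * b), div_nonneg (by linarith) hab.le,
          div_le_one_of_le₀ hle hab.le, by linarith, by linarith⟩
      · exact ⟨1, zero_le_one, le_rfl, by linarith, by linarith⟩
  obtain ⟨x0, y0, k1, k2, k3, k4, k5⟩ := exists_split (θ := 1 - t) (c := p 1 * a)
    (c' := a * (p 1 - b)) (sub_nonneg.2 t1) (sub_le_self _ t0) (by positivity)
    (mul_nonneg q0 (by linarith)) h1 (by linarith)
  obtain ⟨x1, y1, l1, l2, l3, l4, l5⟩ := exists_split (θ := 1 - t) (c := b * (p 0 - a))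
    (c' := p 0 * b) (sub_nonneg.2 t1) (sub_le_self _ t0)
    (mul_nonneg q1 (by linarith)) (by positivity) h2 (by linarith)
  refine ⟨1 - t, ![x0, x1], ![y0, y1], sub_nonneg.2 t1, sub_le_self _ t0, ⟨?_, k2, l2⟩,
    ⟨?_, l4, k4⟩, k5, l5⟩
  · intro i
    fin_cases i
    exacts [k1, l1]
  · intro i
    fin_cases i
    exacts [k3, l3]

/-! ### Selection of a sequence of protocols -/

/-- A selection with vanishing values. -/
theorem exists_seq_tendsto_zero {α : Type*} {C : ℕ → α → Prop} {v : α → ℝ} (hv : ∀ a, 0 ≤ v a)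
    (hC : ∀ n, ∃ a, C n a) (h : ∀ ε > 0, ∀ᶠ n in atTop, ∃ a, C n a ∧ v a ≤ ε) :
    ∃ u : ℕ → α, (∀ n, C n (u n)) ∧ Tendsto (fun n => v (u n)) atTop (𝓝 0) := by
  -- Almost minimal elements are as good as any competitor in the limit, so no schedule of
  -- tolerances is needed; the error 1/(n + 1) allows for an infimum that is not attained.
  have key : ∀ n, ∃ a, C n a ∧ ∀ b, C n b → v a ≤ v b + 1 / ((n : ℝ) + 1) := by
    intro n
    have hne : (v '' {a | C n a}).Nonempty := Set.Nonempty.image v (hC n)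
    have hbdd : BddBelow (v '' {a | C n a}) := ⟨0, by rintro _ ⟨a, -, rfl⟩; exact hv a⟩
    obtain ⟨_, ⟨a, ha, rfl⟩, hlt⟩ := exists_lt_of_csInf_lt hne
      (lt_add_of_pos_right (sInf (v '' {a | C n a})) (Nat.one_div_pos_of_nat (α := ℝ) (n := n)))
    exact ⟨a, ha, fun b hb => hlt.le.trans
      (add_le_add (csInf_le hbdd ⟨b, hb, rfl⟩) le_rfl)⟩
  choose u hu hle using key
  refine ⟨u, hu, ?_⟩
  rw [Metric.tendsto_nhds]
  intro ε hε
  have e1 := (tendsto_one_div_add_atTop_nhds_zero_nat (𝕜 := ℝ)).eventually_lt_const (half_pos hε)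
  filter_upwards [h (ε / 2) (half_pos hε), e1] with n ⟨a, ha, hva⟩ hn
  rw [Real.dist_eq, sub_zero, abs_of_nonneg (hv _)]
  linarith [hle n a ha]

/-- Membership in the rate region asks for an instance at every `n`, also before the asymptotics
apply; rates 0 are always attainable. -/
theorem exists_protocol (p : Fin 2 → unitInterval) (n : ℕ) :
    ∃ P : Shared, IsProtocol p P ∧ P.uses = n := by
  have h : ∀ f, Attainable p f 0 := fun f =>
    ⟨fun _ => le_rfl, mul_nonneg (p _).2.1 (min_self_compl_nonneg _),
      mul_nonneg (min_self_compl_nonneg _) (sub_nonneg.2 (min_le_left _ _))⟩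
  have hl : (0 : ℚ) < 1 / 8 := by norm_num
  have hl1 : ((1 / 8 : ℚ) : ℝ) < 1 / 4 := by norm_num
  exact ⟨⟨runSizes p 0 0 (1 / 8) n, runSizes p 1 0 (1 / 8) 0⟩,
    ⟨(h 0).isProtocolSizes hl hl1, (h 1).isProtocolSizes hl hl1⟩, rfl⟩

/-- The terms of `defect` are nonnegative, so one sequence along which it vanishes gives the rates,
correctness and secrecy simultaneously. -/
theorem innerRegion_subset_rateRegion (H : (s k : ℕ) → TwoUniversal s k)
    (p : Fin 2 → unitInterval) : innerRegion (p 0) (p 1) ⊆ rateRegion H p := by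
  intro R hR
  obtain ⟨θ, ρa, ρb, hθ, hθ1, ha, hb, e1, e2⟩ := exists_attainable_of_mem_innerRegion hR
  have nonneg : ∀ P : Shared, 0 ≤ abortProb p 0 P.a + abortProb p 1 P.b ∧
      0 ≤ runLeak p 0 P.a + runLeak p 1 P.b := fun P =>
    ⟨add_nonneg (abortProb_nonneg _ _ _) (abortProb_nonneg _ _ _),
      add_nonneg (runLeak_nonneg _ _ _) (runLeak_nonneg _ _ _)⟩
  have le : ∀ P : Shared, ∀ {x : ℝ}, defect p (fun i => θ * ρa i + (1 - θ) * ρb i) P ≤ x →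
      |(P.len 0 : ℝ) / P.uses - R.1| ≤ x ∧ |(P.len 1 : ℝ) / P.uses - R.2| ≤ x ∧
      abortProb p 0 P.a + abortProb p 1 P.b ≤ x ∧ runLeak p 0 P.a + runLeak p 1 P.b ≤ x := by
    intro P x hx
    rw [defect] at hx
    rw [← e1, ← e2] at hx
    obtain ⟨n1, n2⟩ := nonneg P
    have n3 := abs_nonneg ((P.len 0 : ℝ) / P.uses - R.1)
    have n4 := abs_nonneg ((P.len 1 : ℝ) / P.uses - R.2)
    exact ⟨by linarith, by linarith, by linarith, by linarith⟩
  obtain ⟨P, hP, hlim⟩ := exists_seq_tendsto_zero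
    (C := fun n P => IsProtocol p P ∧ P.uses = n)
    (fun P => (abs_nonneg _).trans (le P le_rfl).1) (exists_protocol p)
    fun ε hε => eventually_exists_defect_le ha hb hθ hθ1 hε
  refine ⟨hR.1, hR.2.1, P, hP, ?_, ?_, secure_of_tendsto H p P ?_ ?_⟩
  · rw [tendsto_iff_dist_tendsto_zero]
    refine squeeze_zero (fun _ => dist_nonneg) (fun n => ?_) hlim
    rw [Real.dist_eq]
    have hle := (le (P n) le_rfl).1
    rwa [(hP n).2] at hle
  · rw [tendsto_iff_dist_tendsto_zero]
    refine squeeze_zero (fun _ => dist_nonneg) (fun n => ?_) hlim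
    rw [Real.dist_eq]
    have hle := (le (P n) le_rfl).2.1
    rwa [(hP n).2] at hle
  · exact squeeze_zero (fun n => (nonneg (P n)).1) (fun n => (le (P n) le_rfl).2.2.1) hlim
  · exact squeeze_zero (fun n => (nonneg (P n)).2) (fun n => (le (P n) le_rfl).2.2.2) hlim

end

end BroadcastOT

theorem mainTheorem5 (H : (s k : ℕ) → BroadcastOT.TwoUniversal s k)
    (p : Fin 2 → unitInterval) :
    BroadcastOT.innerRegion (p 0) (p 1) ⊆ BroadcastOT.rateRegion H p ∧
      BroadcastOT.rateRegion H p ⊆ BroadcastOT.outerRegion (p 0) (p 1) ∧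
      BroadcastOT.freeSizesRegion H p ⊆ BroadcastOT.outerRegion (p 0) (p 1) :=
  ⟨BroadcastOT.innerRegion_subset_rateRegion H p,
    (BroadcastOT.rateRegion_subset_freeSizesRegion H p).trans
      (BroadcastOT.freeSizesRegion_subset H p),
    BroadcastOT.freeSizesRegion_subset H p⟩
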